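/- Let $k$ be a field and let $(H,\Delta,\varepsilon,\Phi,S,\alpha,\beta)$ be a quasi-Hopf algebra over $k$ whose antipode $S$ is an anti-automorphism of the algebra $H$, with $S(h_1)\alpha h_2=\varepsilon(h)\alpha$, $h_1\beta S(h_2)=\varepsilon(h)\beta$, $X^1\beta S(X^2)\alpha X^3=1$, $S(x^1)\alpha x^2\beta S(x^3)=1$. Here $\Phi=X^1\otimes X^2\otimes X^3$, $\Phi^{-1}=x^1\otimes x^2\otimes x^3$, $(\mathrm{id}\otimes\Delta)(\Delta(h))=\Phi\,(\Delta\otimes \mathrm{id})(\Delta(h))\,\Phi^{-1}$; further letters $Y^i$ denote another copy of $\Phi$, and summation is understood throughout. Put $$p_R=p^1\otimes p^2=x^1\otimes x^2\beta S(x^3),\quad q_R=q^1\otimes q^2=X^1\otimes S^{-1}(\alpha X^3)X^2,\quad q_L=\tilde q^1\otimes\tilde q^2=S(x^1)\alpha x^2\otimes x^3,$$ let $\gamma=S(A^2)\alpha A^3\otimes S(A^1)\alpha A^4$ and $\delta=B^1\beta S(B^4)\otimes B^2\beta S(B^3)$ with $A=(\Phi\otimes1)(\Delta\otimes \mathrm{id}\otimes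 \mathrm{id})(\Phi^{-1})$ and $B=(\Delta\otimes \mathrm{id}\otimes \mathrm{id})(\Phi)(\Phi^{-1}\otimes1)$, and let $$f=f^1\otimes f^2=(S\otimes S)(\Delta^{\rm op}(x^1))\,\gamma\,\Delta(x^2\beta S(x^3)),\qquad f^{-1}=g^1\otimes g^2=\Delta(S(x^1)\alpha x^2)\,\delta\,(S\otimes S)(\Delta^{\rm op}(x^3)),$$ $$\mathcal F=S(g^2)f^1\otimes S(g^1)f^2,\qquad V=V^1\otimes V^2=S^{-1}(f^2p^2)\otimes S^{-1}(f^1p^1).$$ A (left) Yetter-Drinfeld module is a left $H$-module $M$ with a linear map $\lambda:M\to H\otimes M$, $\lambda(m)=m_{(-1)}\otimes m_{(0)}$, such that $\varepsilon(m_{(-1)})m_{(0)}=m$, $h_1m_{(-1)}\otimes h_2\cdot m_{(0)}=(h_1\cdot m)_{(-1)}h_2\otimes(h_1\cdot m)_{(0)}$ and $$X^1m_{(-1)}\otimes (X^2\cdot m_{(0)})_{(-1)}X^3\otimes (X^2\cdot m_{(0)})_{(0)}=X^1(Y^1\cdot m)_{(-1)_1}Y^2\otimes X^2(Y^1\cdot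 m)_{(-1)_2}Y^3\otimes X^3\cdot (Y^1\cdot m)_{(0)}.$$ Morphisms are the linear maps preserving action and coaction. For an invertible $\mathfrak F\in H\otimes H$ with inverse $\mathfrak G$ write $\lambda^{\mathfrak F}(m)=m^{\mathfrak F}_{(-1)}\otimes m^{\mathfrak F}_{(0)}=\mathfrak F^1(\mathfrak G^1\cdot m)_{(-1)}\mathfrak G^2\otimes\mathfrak F^2\cdot(\mathfrak G^1\cdot m)_{(0)}$. Let $M$ be a finite-dimensional Yetter-Drinfeld module with basis $({}_im)$, dual basis $({}^im)$, and let ${}^{*i}m$ be the image of ${}_im$ under the canonical map from $M$ to its double dual. The left dual $M^*$ and the right dual ${}^*M$ are the dual vector space with $$(h\cdot m^*)(m)=m^*(S(h)\cdot m),\quad \lambda(m^*)=\langle m^*,f^2\cdot(g^1\cdot{}_im)_{(0)}\rangle\,S^{-1}(f^1(g^1\cdot{}_im)_{(-1)}g^2)\otimes{}^im,$$ $$(h\cdot {}^*m)(m)={}^*m(S^{-1}(h)\cdot m),\quad \lambda({}^*m)=\langle{}^*m,S^{-1}(f^1)\cdot(S^{-1}(g^2)\cdot{}_im)_{(0)}\rangle\,g^1S((S^{-1}(g^2)\cdot{}_im)_{(-1)})f^2\otimes{}^im,$$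 respectively, and with the (co)evaluations $$\mathrm{ev}(m^*\otimes m)=m^*(\alpha\cdot m),\quad \mathrm{coev}(1)=\beta\cdot{}_im\otimes{}^im,\quad \mathrm{ev}'(m\otimes{}^*m)={}^*m(S^{-1}(\alpha)\cdot m),\quad \mathrm{coev}'(1)={}^im\otimes S^{-1}(\beta)\cdot{}_im.$$ The associativity constraint $a$ is the action of $\Phi$, the braiding is $c_{M,N}(m\otimes n)=m_{(-1)}\cdot n\otimes m_{(0)}$, with inverse $$c_{M,N}^{-1}(n\otimes m)=\tilde q^2_1X^2\cdot(p^1\cdot m)_{(0)}\otimes S^{-1}\bigl(\tilde q^1X^1(p^1\cdot m)_{(-1)}p^2S(\tilde q^2_2X^3)\bigr)\cdot n.$$ Unit constraints being treated as identities, let $$\theta_M=(\mathrm{ev}'_M\otimes\mathrm{id})\,a^{-1}\,(\mathrm{id}\otimes\mathrm{coev}_{{}^*M}):M\to({}^*M)^*,\qquad \theta_M^{-1}=(\mathrm{ev}_{{}^*M}\otimes\mathrm{id})\,a^{-1}\,(\mathrm{id}\otimes\mathrm{coev}'_M),$$ $$\theta'_M=(\mathrm{id}\otimes\mathrm{ev}_M)\,a\,(\mathrm{coev}'_{M^*}\otimes\mathrm{id}):M\to{}^*(M^*),\qquad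 \theta'^{-1}_M=(\mathrm{id}\otimes\mathrm{ev}'_{M^*})\,a\,(\mathrm{coev}_M\otimes\mathrm{id}),$$ $$\Theta_M=(\mathrm{id}\otimes\mathrm{ev}_M)\,a\,(c_{M^*,{}^*M}\otimes\mathrm{id})\,a^{-1}\,(\mathrm{id}\otimes\mathrm{coev}'_M):M^*\to{}^*M,$$ $$\Theta_M^{-1}=(\mathrm{ev}'_M\otimes\mathrm{id})\,a^{-1}\,(\mathrm{id}\otimes c^{-1}_{{}^*M,M^*})\,a\,(\mathrm{coev}_M\otimes\mathrm{id}):{}^*M\to M^*.$$ Then the following hold. (1) $\theta'_M$ and $\theta'^{-1}_M$ are mutually inverse, and so are $\Theta_{M^*}$ and $\Theta_{M^*}^{-1}$. The map ${}^r\Gamma_M=\theta'^{-1}_M\circ\Theta_{M^*}:M^{**}\to M$ is an isomorphism of Yetter-Drinfeld modules, and for $m^{**}\in M^{**}$ $${}^r\Gamma_M(m^{**})=\langle m^{**},{}^im\rangle\,q^1S^{-2}\bigl((S^2(p^1)\cdot{}_im)^{\mathcal F}_{(-1)}\bigr)p^2S^2(q^2)\cdot(S^2(p^1)\cdot{}_im)^{\mathcal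 F}_{(0)}.$$ Its inverse is $\Theta^{-1}_{M^*}\circ\theta'_M$, that is, for $m\in M$ $${}^r\Gamma_M^{-1}(m)=\langle{}^im,S((p^1\cdot m)_{(-1)}p^2)\alpha\cdot(p^1\cdot m)_{(0)}\rangle\,{}^{*i}m.$$ (2) $\theta_M$ and $\theta_M^{-1}$ are mutually inverse, and so are $\Theta_{{}^*M}$ and $\Theta_{{}^*M}^{-1}$. The map ${}^l\Gamma_M=\theta_M^{-1}\circ\Theta^{-1}_{{}^*M}:{}^{**}M\to M$ is an isomorphism of Yetter-Drinfeld modules, and for ${}^{**}m\in{}^{**}M$ $${}^l\Gamma_M({}^{**}m)=\langle{}^{**}m,{}^im\rangle\,V^1g^1S\bigl((S^{-1}(V^2g^2)\cdot{}_im)_{(-1)}\bigr)\alpha\cdot(S^{-1}(V^2g^2)\cdot{}_im)_{(0)}.$$ Its inverse is given, for $m\in M$, by $${}^l\Gamma_M^{-1}(m)=\langle{}^im,S^{-2}\bigl(q^1(p^1\cdot m)_{(-1)}p^2\bigr)q^2\cdot(p^1\cdot m)_{(0)}\rangle\,{}^{*i}m.$$ -/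

import Mathlib

open scoped TensorProduct

noncomputable section

universe u v w w'

/-- The linear map `x ⊗ y ↦ S(x) a y`. -/
def sandwichLeft {k : Type u} {H : Type v} [Field k] [Ring H] [Algebra k H]
    (S : H →ₗ[k] H) (a : H) : H ⊗[k] H →ₗ[k] H :=
  LinearMap.mul' k H ∘ₗ TensorProduct.map (LinearMap.mulRight k a ∘ₗ S) LinearMap.id

/-- The linear map `x ⊗ y ↦ x a S(y)`. -/
def sandwichRight {k : Type u} {H : Type v} [Field k] [Ring H] [Algebra k H]
    (S : H →ₗ[k] H) (a : H) : H ⊗[k] H →ₗ[k] H :=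
  LinearMap.mul' k H ∘ₗ TensorProduct.map (LinearMap.mulRight k a) S

theorem sandwichLeft_tmul {k : Type u} {H : Type v} [Field k] [Ring H] [Algebra k H]
    (S : H →ₗ[k] H) (a x y : H) : sandwichLeft S a (x ⊗ₜ[k] y) = S x * a * y := by
  simp [sandwichLeft]

theorem sandwichRight_tmul {k : Type u} {H : Type v} [Field k] [Ring H] [Algebra k H]
    (S : H →ₗ[k] H) (a x y : H) : sandwichRight S a (x ⊗ₜ[k] y) = x * a * S y := by
  simp [sandwichRight]

/-- For an algebra map `Δ : H → H ⊗ H` and any algebra `B`, the algebra map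
`Δ ⊗ id : H ⊗ B → H ⊗ (H ⊗ B)`, tensor products being bracketed to the right. -/
def comulFirst {k : Type u} {H : Type v} [Field k] [Ring H] [Algebra k H]
    (Δ : H →ₐ[k] H ⊗[k] H) (B : Type w) [Ring B] [Algebra k B] :
    H ⊗[k] B →ₐ[k] H ⊗[k] (H ⊗[k] B) :=
  (Algebra.TensorProduct.assoc k k k H H B).toAlgHom.comp
    (Algebra.TensorProduct.map Δ (AlgHom.id k B))

/-- A quasi-bialgebra structure `(Δ, ε, Φ)` on the `k`-algebra `H`. All iterated tensor powers of
`H` are bracketed to the right. -/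
structure QuasiBialgebra (k : Type u) (H : Type v) [Field k] [Ring H] [Algebra k H] where
  /-- the comultiplication `Δ` -/
  comul : H →ₐ[k] H ⊗[k] H
  /-- the counit `ε` -/
  counit : H →ₐ[k] k
  /-- the reassociator `Φ` -/
  reassoc : (H ⊗[k] (H ⊗[k] H))ˣ
  /-- `(id ⊗ Δ)(Δ(h)) = Φ (Δ ⊗ id)(Δ(h)) Φ⁻¹` -/
  coassoc : ∀ h : H,
    Algebra.TensorProduct.map (AlgHom.id k H) comul (comul h) =
      (reassoc : H ⊗[k] (H ⊗[k] H)) * comulFirst comul H (comul h) *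
        ((reassoc⁻¹ : (H ⊗[k] (H ⊗[k] H))ˣ) : H ⊗[k] (H ⊗[k] H))
  /-- `(id ⊗ ε)(Δ(h)) = h` -/
  comul_counit : ∀ h : H,
    TensorProduct.rid k H (TensorProduct.map LinearMap.id counit.toLinearMap (comul h)) = h
  /-- `(ε ⊗ id)(Δ(h)) = h` -/
  counit_comul : ∀ h : H,
    TensorProduct.lid k H (TensorProduct.map counit.toLinearMap LinearMap.id (comul h)) = h
  /-- `(1 ⊗ Φ)(id ⊗ Δ ⊗ id)(Φ)(Φ ⊗ 1) = (id ⊗ id ⊗ Δ)(Φ)(Δ ⊗ id ⊗ id)(Φ)` -/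
  cocycle :
    ((1 : H) ⊗ₜ[k] (reassoc : H ⊗[k] (H ⊗[k] H))) *
        Algebra.TensorProduct.map (AlgHom.id k H) (comulFirst comul H) reassoc *
        Algebra.TensorProduct.map (AlgHom.id k H)
          (Algebra.TensorProduct.map (AlgHom.id k H)
            (Algebra.TensorProduct.includeLeft : H →ₐ[k] H ⊗[k] H)) reassoc =
      Algebra.TensorProduct.map (AlgHom.id k H)
          (Algebra.TensorProduct.map (AlgHom.id k H) comul) reassoc *
        comulFirst comul (H ⊗[k] H) reassoc
  /-- `(id ⊗ ε ⊗ id)(Φ) = 1 ⊗ 1` -/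
  normalized :
    TensorProduct.map LinearMap.id
        ((TensorProduct.lid k H).toLinearMap ∘ₗ
          TensorProduct.map counit.toLinearMap LinearMap.id)
        (reassoc : H ⊗[k] (H ⊗[k] H)) = (1 : H) ⊗ₜ[k] (1 : H)

/-- A quasi-Hopf algebra structure `(Δ, ε, Φ, S, α, β)` on the `k`-algebra `H`; the antipode `S` is
an anti-automorphism, in particular it is bijective. -/
structure QuasiHopfAlgebra (k : Type u) (H : Type v) [Field k] [Ring H] [Algebra k H] extends
    QuasiBialgebra k H where
  /-- the antipode `S` -/
  antipode : H ≃ₗ[k] H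
  antipode_one : antipode 1 = 1
  antipode_mul : ∀ a b : H, antipode (a * b) = antipode b * antipode a
  /-- the element `α` -/
  alpha : H
  /-- the element `β` -/
  beta : H
  /-- `S(h₁) α h₂ = ε(h) α` -/
  antipode_alpha : ∀ h : H,
    sandwichLeft antipode.toLinearMap alpha (comul h) = counit h • alpha
  /-- `h₁ β S(h₂) = ε(h) β` -/
  beta_antipode : ∀ h : H,
    sandwichRight antipode.toLinearMap beta (comul h) = counit h • beta
  /-- `X¹ β S(X²) α X³ = 1`, where `Φ = X¹ ⊗ X² ⊗ X³` -/
  beta_alpha :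
    LinearMap.mul' k H (TensorProduct.map (LinearMap.mulRight k beta)
      (sandwichLeft antipode.toLinearMap alpha) (reassoc : H ⊗[k] (H ⊗[k] H))) = 1
  /-- `S(x¹) α x² β S(x³) = 1`, where `Φ⁻¹ = x¹ ⊗ x² ⊗ x³` -/
  alpha_beta :
    sandwichLeft antipode.toLinearMap alpha
      (TensorProduct.map LinearMap.id (sandwichRight antipode.toLinearMap beta)
        ((reassoc⁻¹ : (H ⊗[k] (H ⊗[k] H))ˣ) : H ⊗[k] (H ⊗[k] H))) = 1

namespace QuasiHopfAlgebra

variable {k : Type u} {H : Type v} [Field k] [Ring H] [Algebra k H] (Q : QuasiHopfAlgebra k H)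

/-- The antipode `S` as a linear map. -/
def S : H →ₗ[k] H := Q.antipode.toLinearMap

/-- The inverse `S⁻¹` of the antipode as a linear map. -/
def Sinv : H →ₗ[k] H := Q.antipode.symm.toLinearMap

theorem S_one : Q.S 1 = 1 := Q.antipode_one

theorem S_mul (a b : H) : Q.S (a * b) = Q.S b * Q.S a := Q.antipode_mul a b

theorem Sinv_one : Q.Sinv 1 = 1 := by
  change Q.antipode.symm 1 = 1
  rw [LinearEquiv.symm_apply_eq, Q.antipode_one]

theorem Sinv_mul (a b : H) : Q.Sinv (a * b) = Q.Sinv b * Q.Sinv a := by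
  change Q.antipode.symm (a * b) = Q.antipode.symm b * Q.antipode.symm a
  rw [LinearEquiv.symm_apply_eq, Q.antipode_mul]
  simp

/-- `Φ = X¹ ⊗ X² ⊗ X³` -/
def Phi : H ⊗[k] (H ⊗[k] H) := (Q.reassoc : H ⊗[k] (H ⊗[k] H))

/-- `Φ⁻¹ = x¹ ⊗ x² ⊗ x³` -/
def PhiInv : H ⊗[k] (H ⊗[k] H) :=
  ((Q.reassoc⁻¹ : (H ⊗[k] (H ⊗[k] H))ˣ) : H ⊗[k] (H ⊗[k] H))

/-- `p_R = p¹ ⊗ p² = x¹ ⊗ x² β S(x³)` -/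
def pR : H ⊗[k] H :=
  TensorProduct.map LinearMap.id (sandwichRight Q.S Q.beta) Q.PhiInv

/-- The linear map `y ⊗ z ↦ S⁻¹(α z) y`. -/
def qRAux : H ⊗[k] H →ₗ[k] H :=
  LinearMap.mul' k H ∘ₗ
    TensorProduct.map (Q.Sinv ∘ₗ LinearMap.mulLeft k Q.alpha) LinearMap.id ∘ₗ
      (TensorProduct.comm k H H).toLinearMap

theorem qRAux_tmul (y z : H) : Q.qRAux (y ⊗ₜ[k] z) = Q.Sinv (Q.alpha * z) * y := by
  simp [qRAux]

/-- `q_R = q¹ ⊗ q² = X¹ ⊗ S⁻¹(α X³) X²` -/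
def qR : H ⊗[k] H := TensorProduct.map LinearMap.id Q.qRAux Q.Phi

/-- `q_L = q̃¹ ⊗ q̃² = S(x¹) α x² ⊗ x³` -/
def qL : H ⊗[k] H :=
  TensorProduct.map (sandwichLeft Q.S Q.alpha) LinearMap.id
    ((TensorProduct.assoc k H H H).symm Q.PhiInv)

/-- The linear map `a ⊗ b ⊗ c ⊗ d ↦ S(b) α c ⊗ S(a) α d`. -/
def gammaAux : H ⊗[k] (H ⊗[k] (H ⊗[k] H)) →ₗ[k] H ⊗[k] H :=
  TensorProduct.map (sandwichLeft Q.S Q.alpha) (sandwichLeft Q.S Q.alpha) ∘ₗ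
    (TensorProduct.tensorTensorTensorComm k H H H H).toLinearMap ∘ₗ
      TensorProduct.map (TensorProduct.comm k H H).toLinearMap LinearMap.id ∘ₗ
        (TensorProduct.assoc k H H (H ⊗[k] H)).symm.toLinearMap

theorem gammaAux_tmul (a b c d : H) :
    Q.gammaAux (a ⊗ₜ[k] (b ⊗ₜ[k] (c ⊗ₜ[k] d))) =
      (Q.S b * Q.alpha * c) ⊗ₜ[k] (Q.S a * Q.alpha * d) := by
  simp [gammaAux, sandwichLeft_tmul]

/-- The linear map `a ⊗ b ⊗ c ⊗ d ↦ a β S(d) ⊗ b β S(c)`. -/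
def deltaAux : H ⊗[k] (H ⊗[k] (H ⊗[k] H)) →ₗ[k] H ⊗[k] H :=
  TensorProduct.map (sandwichRight Q.S Q.beta) (sandwichRight Q.S Q.beta) ∘ₗ
    (TensorProduct.tensorTensorTensorComm k H H H H).toLinearMap ∘ₗ
      TensorProduct.map LinearMap.id (TensorProduct.comm k H H).toLinearMap ∘ₗ
        (TensorProduct.assoc k H H (H ⊗[k] H)).symm.toLinearMap

theorem deltaAux_tmul (a b c d : H) :
    Q.deltaAux (a ⊗ₜ[k] (b ⊗ₜ[k] (c ⊗ₜ[k] d))) =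
      (a * Q.beta * Q.S d) ⊗ₜ[k] (b * Q.beta * Q.S c) := by
  simp [deltaAux, sandwichRight_tmul]

/-- The map `t ↦ t ⊗ 1` from `H ⊗ H ⊗ H` to `H ⊗ H ⊗ H ⊗ H`. -/
def tensorOne (H : Type v) [Ring H] [Algebra k H] :
    H ⊗[k] (H ⊗[k] H) →ₐ[k] H ⊗[k] (H ⊗[k] (H ⊗[k] H)) :=
  Algebra.TensorProduct.map (AlgHom.id k H)
    (Algebra.TensorProduct.map (AlgHom.id k H)
      (Algebra.TensorProduct.includeLeft : H →ₐ[k] H ⊗[k] H))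

/-- `γ = S(A²) α A³ ⊗ S(A¹) α A⁴`, where
`A¹ ⊗ A² ⊗ A³ ⊗ A⁴ = (Φ ⊗ 1)(Δ ⊗ id ⊗ id)(Φ⁻¹)` -/
def gamma : H ⊗[k] H :=
  Q.gammaAux (tensorOne H Q.Phi * comulFirst Q.comul (H ⊗[k] H) Q.PhiInv)

/-- `δ = B¹ β S(B⁴) ⊗ B² β S(B³)`, where
`B¹ ⊗ B² ⊗ B³ ⊗ B⁴ = (Δ ⊗ id ⊗ id)(Φ)(Φ⁻¹ ⊗ 1)` -/
def delta : H ⊗[k] H :=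
  Q.deltaAux (comulFirst Q.comul (H ⊗[k] H) Q.Phi * tensorOne H Q.PhiInv)

/-- The map `a ⊗ b ↦ S(b) ⊗ S(a)`, that is `(S ⊗ S)` after the flip. -/
def flipS : H ⊗[k] H →ₗ[k] H ⊗[k] H :=
  TensorProduct.map Q.S Q.S ∘ₗ (TensorProduct.comm k H H).toLinearMap

/-- The twist `f = f¹ ⊗ f² = (S ⊗ S)(Δᵒᵖ(x¹)) γ Δ(x² β S(x³))` -/
def f : H ⊗[k] H :=
  LinearMap.mul' k (H ⊗[k] H)
    (TensorProduct.map
      (LinearMap.mulRight k Q.gamma ∘ₗ Q.flipS ∘ₗ Q.comul.toLinearMap)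
      (Q.comul.toLinearMap ∘ₗ sandwichRight Q.S Q.beta) Q.PhiInv)

/-- The inverse twist `f⁻¹ = g¹ ⊗ g² = Δ(S(x¹) α x²) δ (S ⊗ S)(Δᵒᵖ(x³))` -/
def fInv : H ⊗[k] H :=
  LinearMap.mul' k (H ⊗[k] H)
    (TensorProduct.map
      (LinearMap.mulRight k Q.delta ∘ₗ Q.comul.toLinearMap ∘ₗ sandwichLeft Q.S Q.alpha)
      (Q.flipS ∘ₗ Q.comul.toLinearMap) ((TensorProduct.assoc k H H H).symm Q.PhiInv))

/-- `𝓕 = S(g²) f¹ ⊗ S(g¹) f²` -/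
def calF : H ⊗[k] H := Q.flipS Q.fInv * Q.f

/-- `V = V¹ ⊗ V² = S⁻¹(f² p²) ⊗ S⁻¹(f¹ p¹)` -/
def V : H ⊗[k] H :=
  TensorProduct.map Q.Sinv Q.Sinv (TensorProduct.comm k H H (Q.f * Q.pR))

end QuasiHopfAlgebra

/-- A left `H`-module structure on the `k`-vector space `M` together with a `k`-linear map
`λ : M → H ⊗ M`, `λ(m) = m₍₋₁₎ ⊗ m₍₀₎`, without compatibility conditions. -/
structure YDData (k : Type u) (H : Type v) (M : Type w) [Field k] [Ring H] [Algebra k H]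
    [AddCommGroup M] [Module k M] where
  /-- the action, `h · m = act h m` -/
  act : H →ₐ[k] Module.End k M
  /-- the coaction `λ` -/
  coact : M →ₗ[k] H ⊗[k] M

/-- For representations `ρ` of `A` on `M` and `σ` of `B` on `N`, the representation of `A ⊗ B` on
`M ⊗ N` given by `(a ⊗ b)(m ⊗ n) = a m ⊗ b n`. -/
def tensorAct {k : Type u} [Field k] {A B M N : Type*} [Ring A] [Algebra k A] [Ring B]
    [Algebra k B] [AddCommGroup M] [Module k M] [AddCommGroup N] [Module k N]
    (ρ : A →ₐ[k] Module.End k M) (σ : B →ₐ[k] Module.End k N) :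
    A ⊗[k] B →ₐ[k] Module.End k (M ⊗[k] N) :=
  Module.endTensorEndAlgHom.comp (Algebra.TensorProduct.map ρ σ)

theorem tensorAct_tmul {k : Type u} [Field k] {A B M N : Type*} [Ring A] [Algebra k A] [Ring B]
    [Algebra k B] [AddCommGroup M] [Module k M] [AddCommGroup N] [Module k N]
    (ρ : A →ₐ[k] Module.End k M) (σ : B →ₐ[k] Module.End k N) (a : A) (b : B) (m : M) (n : N) :
    tensorAct ρ σ (a ⊗ₜ[k] b) (m ⊗ₜ[k] n) = ρ a m ⊗ₜ[k] σ b n := by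
  simp [tensorAct, Module.endTensorEndAlgHom_apply]

/-- For a finite-dimensional space `M` and `T : M → X`, the element `∑ᵢ T(mᵢ) ⊗ mⁱ` of `X ⊗ M^*`,
where `(mᵢ)` is a basis of `M` with dual basis `(mⁱ)`. -/
def dualSum (k : Type u) (M : Type w) (X : Type*) [Field k] [AddCommGroup M] [Module k M]
    [Module.Finite k M] [AddCommGroup X] [Module k X] :
    (M →ₗ[k] X) →ₗ[k] X ⊗[k] Module.Dual k M where
  toFun T := ∑ i, T (Module.finBasis k M i) ⊗ₜ[k] (Module.finBasis k M).coord i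
  map_add' T U := by simp [TensorProduct.add_tmul, Finset.sum_add_distrib]
  map_smul' c T := by simp [TensorProduct.smul_tmul', Finset.smul_sum]

/-- The element `∑ᵢ T(mᵢ) ⊗ mⁱ` does not depend on the chosen basis. -/
theorem dualSum_eq {k : Type u} {M : Type w} {X : Type*} [Field k] [AddCommGroup M] [Module k M]
    [Module.Finite k M] [AddCommGroup X] [Module k X] {ι : Type*} [Fintype ι]
    (b : Module.Basis ι k M) (T : M →ₗ[k] X) :
    dualSum k M X T = ∑ i, T (b i) ⊗ₜ[k] b.coord i := by
  have h : ∀ j, (Module.finBasis k M).coord j =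
      ∑ i, (Module.finBasis k M).coord j (b i) • b.coord i := by
    intro j
    refine b.ext fun i => ?_
    classical
    simp [LinearMap.sum_apply, Finsupp.single_apply]
  have h' : ∀ i, T (b i) =
      ∑ j, (Module.finBasis k M).coord j (b i) • T (Module.finBasis k M j) := by
    intro i
    conv_lhs => rw [← (Module.finBasis k M).sum_repr (b i)]
    simp only [map_sum, map_smul, Module.Basis.coord_apply]
  change ∑ j, T (Module.finBasis k M j) ⊗ₜ[k] (Module.finBasis k M).coord j = _
  calc _ = ∑ j, ∑ i, (Module.finBasis k M).coord j (b i) •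
        (T (Module.finBasis k M j) ⊗ₜ[k] b.coord i) := by
        refine Finset.sum_congr rfl fun j _ => ?_
        conv_lhs => rw [h j]
        simp only [TensorProduct.tmul_sum, TensorProduct.tmul_smul]
    _ = ∑ i, ∑ j, (Module.finBasis k M).coord j (b i) •
        (T (Module.finBasis k M j) ⊗ₜ[k] b.coord i) := Finset.sum_comm
    _ = _ := by
        refine Finset.sum_congr rfl fun i _ => ?_
        conv_rhs => rw [h' i]
        simp only [TensorProduct.sum_tmul, TensorProduct.smul_tmul']

namespace YDData

variable {k : Type u} {H : Type v} [Field k] [Ring H] [Algebra k H]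
variable {M : Type w} [AddCommGroup M] [Module k M]
variable {N : Type w'} [AddCommGroup N] [Module k N]

/-- The linear map sending `a ⊗ b` to `m ↦ (a · m)₍₋₁₎ b ⊗ (a · m)₍₀₎`. -/
def coactMul (V : YDData k H M) : H ⊗[k] H →ₗ[k] M →ₗ[k] H ⊗[k] M :=
  TensorProduct.lift (LinearMap.mk₂ k
    (fun a b => TensorProduct.map (LinearMap.mulRight k b) LinearMap.id ∘ₗ V.coact ∘ₗ V.act a)
    (by intros; simp [LinearMap.comp_add])
    (by intros; simp [LinearMap.comp_smul])
    (by
      intro a b c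
      simp only [← LinearMap.rTensor_def]
      rw [← LinearMap.add_comp, ← LinearMap.rTensor_add]
      congr 2
      ext x
      simp [mul_add])
    (by
      intro r a b
      simp only [← LinearMap.rTensor_def]
      rw [← LinearMap.smul_comp, ← LinearMap.rTensor_smul]
      congr 2
      ext x
      simp))

/-- The linear map sending `a ⊗ (b ⊗ c)` to
`m ↦ a m₍₋₁₎ ⊗ (b · m₍₀₎)₍₋₁₎ c ⊗ (b · m₍₀₎)₍₀₎`. -/
def coactTwice (V : YDData k H M) :
    H ⊗[k] (H ⊗[k] H) →ₗ[k] M →ₗ[k] H ⊗[k] (H ⊗[k] M) :=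
  TensorProduct.lift (LinearMap.mk₂ k
    (fun a t => TensorProduct.map (LinearMap.mulLeft k a) (V.coactMul t) ∘ₗ V.coact)
    (by
      intro a b t
      rw [← LinearMap.add_comp, ← TensorProduct.map_add_left]
      congr 2
      ext x
      simp [add_mul])
    (by
      intro r a t
      rw [← LinearMap.smul_comp, ← TensorProduct.map_smul_left]
      congr 2
      ext x
      simp)
    (by intros; simp [TensorProduct.map_add_right, LinearMap.add_comp])
    (by intros; simp [TensorProduct.map_smul_right, LinearMap.smul_comp]))

/-- For a comultiplication `Δ`, the linear map sending `a ⊗ (b ⊗ c)` to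
`m ↦ (a · m)₍₋₁₎₁ b ⊗ (a · m)₍₋₁₎₂ c ⊗ (a · m)₍₀₎`. -/
def coactComul (V : YDData k H M) (Δ : H →ₐ[k] H ⊗[k] H) :
    H ⊗[k] (H ⊗[k] H) →ₗ[k] M →ₗ[k] H ⊗[k] (H ⊗[k] M) :=
  TensorProduct.lift (LinearMap.mk₂ k
    (fun a t => (TensorProduct.assoc k H H M).toLinearMap ∘ₗ
      TensorProduct.map (LinearMap.mulRight k t ∘ₗ Δ.toLinearMap) LinearMap.id ∘ₗ
        V.coact ∘ₗ V.act a)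
    (by intros; simp [LinearMap.comp_add])
    (by intros; simp [LinearMap.comp_smul])
    (by
      intro a t s
      simp only [← LinearMap.rTensor_def]
      rw [← LinearMap.comp_add, ← LinearMap.add_comp, ← LinearMap.rTensor_add]
      congr 3
      ext x
      simp [mul_add])
    (by
      intro r a t
      simp only [← LinearMap.rTensor_def]
      rw [← LinearMap.comp_smul, ← LinearMap.smul_comp, ← LinearMap.rTensor_smul]
      congr 3
      ext x
      simp))

/-- The conditions making an `H`-module with a map `λ : M → H ⊗ M` a left Yetter-Drinfeld module
over the quasi-bialgebra `H`. -/
structure IsYetterDrinfeld (Q : QuasiBialgebra k H) (V : YDData k H M) : Prop where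
  /-- `X¹ m₍₋₁₎ ⊗ (X² · m₍₀₎)₍₋₁₎ X³ ⊗ (X² · m₍₀₎)₍₀₎ =
  X¹ (Y¹ · m)₍₋₁₎₁ Y² ⊗ X² (Y¹ · m)₍₋₁₎₂ Y³ ⊗ X³ · (Y¹ · m)₍₀₎` -/
  coassoc : ∀ m : M,
    V.coactTwice Q.reassoc m =
      tensorAct (Algebra.lmul k H) (tensorAct (Algebra.lmul k H) V.act) Q.reassoc
        (V.coactComul Q.comul Q.reassoc m)
  /-- `ε(m₍₋₁₎) m₍₀₎ = m` -/
  counit : ∀ m : M,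
    TensorProduct.lid k M (TensorProduct.map Q.counit.toLinearMap LinearMap.id (V.coact m)) = m
  /-- `h₁ m₍₋₁₎ ⊗ h₂ · m₍₀₎ = (h₁ · m)₍₋₁₎ h₂ ⊗ (h₁ · m)₍₀₎` -/
  compat : ∀ (h : H) (m : M),
    tensorAct (Algebra.lmul k H) V.act (Q.comul h) (V.coact m) = V.coactMul (Q.comul h) m

/-- `e` is an isomorphism of Yetter-Drinfeld modules: its source and target are Yetter-Drinfeld
modules, and the bijection `e` preserves the action and the coaction. -/
structure IsYDIso (Q : QuasiBialgebra k H) (V : YDData k H M) (W : YDData k H N)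
    (e : M ≃ₗ[k] N) : Prop where
  source : V.IsYetterDrinfeld Q
  target : W.IsYetterDrinfeld Q
  map_act : ∀ (h : H) (m : M), e (V.act h m) = W.act h (e m)
  map_coact : ∀ m : M, W.coact (e m) = TensorProduct.map LinearMap.id e.toLinearMap (V.coact m)

/-- For `F = F¹ ⊗ F²` and `G = G¹ ⊗ G²`, the map
`m ↦ F¹ (G¹ · m)₍₋₁₎ G² ⊗ F² · (G¹ · m)₍₀₎`. -/
def twistCoactAux (V : YDData k H M) (F G : H ⊗[k] H) : M →ₗ[k] H ⊗[k] M :=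
  tensorAct (Algebra.lmul k H) V.act F ∘ₗ V.coactMul G

/-- The coaction `λ^F` obtained from `λ` by the invertible element `F` of `H ⊗ H`:
`m ↦ F¹ (G¹ · m)₍₋₁₎ G² ⊗ F² · (G¹ · m)₍₀₎`, where `F⁻¹ = G¹ ⊗ G²`. -/
def twistCoact (V : YDData k H M) (F : H ⊗[k] H) : M →ₗ[k] H ⊗[k] M :=
  V.twistCoactAux F (Ring.inverse F)

/-- For a linear form `φ` on `M`, the map `h ⊗ m ↦ φ(m) h`. -/
def contract (φ : Module.Dual k M) : H ⊗[k] M →ₗ[k] H :=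
  (TensorProduct.rid k H).toLinearMap ∘ₗ TensorProduct.map LinearMap.id φ

theorem contract_add (φ ψ : Module.Dual k M) :
    (contract (φ + ψ) : H ⊗[k] M →ₗ[k] H) = contract φ + contract ψ := by
  ext; simp [contract, add_smul]

theorem contract_smul (c : k) (φ : Module.Dual k M) :
    (contract (c • φ) : H ⊗[k] M →ₗ[k] H) = c • contract φ := by
  ext; simp [contract, mul_smul]

section Dual

variable [Module.Finite k M] (Q : QuasiHopfAlgebra k H) (V : YDData k H M)

/-- The action on the left dual: `(h · φ)(m) = φ(S(h) · m)`. -/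
def leftDualAct : H →ₐ[k] Module.End k (Module.Dual k M) :=
  AlgHom.ofLinearMap
    { toFun := fun h => (V.act (Q.S h)).dualMap
      map_add' := by intros; ext; simp
      map_smul' := by intros; ext; simp }
    (by ext; simp [Q.S_one])
    (by intros; ext; simp [Q.S_mul])

/-- The action on the right dual: `(h · φ)(m) = φ(S⁻¹(h) · m)`. -/
def rightDualAct : H →ₐ[k] Module.End k (Module.Dual k M) :=
  AlgHom.ofLinearMap
    { toFun := fun h => (V.act (Q.Sinv h)).dualMap
      map_add' := by intros; ext; simp
      map_smul' := by intros; ext; simp }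
    (by ext; simp [Q.Sinv_one])
    (by intros; ext; simp [Q.Sinv_mul])

/-- The left dual `M^*`, with coaction
`λ(φ) = ∑ᵢ ⟨φ, f² · (g¹ · mᵢ)₍₀₎⟩ S⁻¹(f¹ (g¹ · mᵢ)₍₋₁₎ g²) ⊗ mⁱ`. -/
def leftDual : YDData k H (Module.Dual k M) where
  act := V.leftDualAct Q
  coact :=
    { toFun := fun φ =>
        dualSum k M H (Q.Sinv ∘ₗ contract φ ∘ₗ V.twistCoactAux Q.f Q.fInv)
      map_add' := by
        intros; simp only [contract_add, LinearMap.add_comp, LinearMap.comp_add, map_add]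
      map_smul' := by
        intros
        simp only [contract_smul, LinearMap.smul_comp, LinearMap.comp_smul, map_smul,
          RingHom.id_apply] }

/-- The linear map sending `g¹ ⊗ g²` to
`m ↦ g¹ S((S⁻¹(g²) · m)₍₋₁₎) ⊗ (S⁻¹(g²) · m)₍₀₎`. -/
def rightDualG : H ⊗[k] H →ₗ[k] M →ₗ[k] H ⊗[k] M :=
  TensorProduct.lift (LinearMap.mk₂ k
    (fun a b => TensorProduct.map (LinearMap.mulLeft k a ∘ₗ Q.S) LinearMap.id ∘ₗ
      V.coact ∘ₗ V.act (Q.Sinv b))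
    (by
      intro a b c
      simp only [← LinearMap.rTensor_def]
      rw [← LinearMap.add_comp, ← LinearMap.rTensor_add]
      congr 2
      ext x
      simp [add_mul])
    (by
      intro r a b
      simp only [← LinearMap.rTensor_def]
      rw [← LinearMap.smul_comp, ← LinearMap.rTensor_smul]
      congr 2
      ext x
      simp)
    (by intros; simp [LinearMap.comp_add])
    (by intros; simp [LinearMap.comp_smul]))

/-- The linear map sending `f¹ ⊗ f²` to `h ⊗ m ↦ h f² ⊗ S⁻¹(f¹) · m`. -/
def rightDualF : H ⊗[k] H →ₗ[k] H ⊗[k] M →ₗ[k] H ⊗[k] M :=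
  TensorProduct.lift (LinearMap.mk₂ k
    (fun a b => TensorProduct.map (LinearMap.mulRight k b) (V.act (Q.Sinv a)))
    (by intros; ext; simp [TensorProduct.tmul_add])
    (by intros; ext; simp)
    (by intros; ext; simp [mul_add, TensorProduct.add_tmul])
    (by intros; ext; simp [TensorProduct.smul_tmul']))

/-- The right dual `^*M`, with coaction
`λ(φ) = ∑ᵢ ⟨φ, S⁻¹(f¹) · (S⁻¹(g²) · mᵢ)₍₀₎⟩ g¹ S((S⁻¹(g²) · mᵢ)₍₋₁₎) f² ⊗ mⁱ`. -/
def rightDual : YDData k H (Module.Dual k M) where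
  act := V.rightDualAct Q
  coact :=
    { toFun := fun φ =>
        dualSum k M H (contract φ ∘ₗ V.rightDualF Q Q.f ∘ₗ V.rightDualG Q Q.fInv)
      map_add' := by
        intros; simp only [contract_add, LinearMap.add_comp, map_add]
      map_smul' := by
        intros
        simp only [contract_smul, LinearMap.smul_comp, map_smul, RingHom.id_apply] }

/-- `ev : M^* ⊗ M → k`, `φ ⊗ m ↦ φ(α · m)`. -/
def ev : Module.Dual k M ⊗[k] M →ₗ[k] k :=
  contractLeft k M ∘ₗ TensorProduct.map LinearMap.id (V.act Q.alpha)

/-- `coev(1) = ∑ᵢ β · mᵢ ⊗ mⁱ` in `M ⊗ M^*`. -/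
def coev : M ⊗[k] Module.Dual k M := dualSum k M M (V.act Q.beta)

/-- `ev' : M ⊗ ^*M → k`, `m ⊗ φ ↦ φ(S⁻¹(α) · m)`. -/
def ev' : M ⊗[k] Module.Dual k M →ₗ[k] k :=
  contractRight k M ∘ₗ TensorProduct.map (V.act (Q.Sinv Q.alpha)) LinearMap.id

/-- `coev'(1) = ∑ᵢ mⁱ ⊗ S⁻¹(β) · mᵢ` in `^*M ⊗ M`. -/
def coev' : Module.Dual k M ⊗[k] M :=
  TensorProduct.comm k M (Module.Dual k M) (dualSum k M M (V.act (Q.Sinv Q.beta)))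

end Dual

/-- The associativity constraint
`(u ⊗ v) ⊗ w ↦ X¹ · u ⊗ (X² · v ⊗ X³ · w)`. -/
def assoc (Q : QuasiHopfAlgebra k H) {A B C : Type*} [AddCommGroup A] [Module k A]
    [AddCommGroup B] [Module k B] [AddCommGroup C] [Module k C]
    (U : YDData k H A) (V : YDData k H B) (W : YDData k H C) :
    (A ⊗[k] B) ⊗[k] C →ₗ[k] A ⊗[k] (B ⊗[k] C) :=
  tensorAct U.act (tensorAct V.act W.act) Q.Phi ∘ₗ (TensorProduct.assoc k A B C).toLinearMap

/-- The inverse associativity constraint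
`u ⊗ (v ⊗ w) ↦ (x¹ · u ⊗ x² · v) ⊗ x³ · w`. -/
def assocInv (Q : QuasiHopfAlgebra k H) {A B C : Type*} [AddCommGroup A] [Module k A]
    [AddCommGroup B] [Module k B] [AddCommGroup C] [Module k C]
    (U : YDData k H A) (V : YDData k H B) (W : YDData k H C) :
    A ⊗[k] (B ⊗[k] C) →ₗ[k] (A ⊗[k] B) ⊗[k] C :=
  (TensorProduct.assoc k A B C).symm.toLinearMap ∘ₗ
    tensorAct U.act (tensorAct V.act W.act) Q.PhiInv

/-- The linear map sending `h ⊗ m` to `n ↦ h · n ⊗ m`. -/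
def braidingAux (M : Type w) [AddCommGroup M] [Module k M] (W : YDData k H N) :
    H ⊗[k] M →ₗ[k] N →ₗ[k] N ⊗[k] M :=
  TensorProduct.lift (LinearMap.mk₂ k
    (fun h m => (TensorProduct.mk k N M).flip m ∘ₗ W.act h)
    (by intros; ext; simp)
    (by intros; ext; simp [TensorProduct.smul_tmul'])
    (by intros; ext; simp)
    (by intros; ext; simp))

/-- The braiding `c : M ⊗ N → N ⊗ M`, `c(m ⊗ n) = m₍₋₁₎ · n ⊗ m₍₀₎`. -/
def braiding (V : YDData k H M) (W : YDData k H N) : M ⊗[k] N →ₗ[k] N ⊗[k] M :=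
  TensorProduct.lift (braidingAux M W ∘ₗ V.coact)

/-- The linear map sending `h ⊗ m` to `n ↦ m ⊗ S⁻¹(h) · n`. -/
def braidingInvAux (Q : QuasiHopfAlgebra k H) (M : Type w) [AddCommGroup M] [Module k M]
    (W : YDData k H N) : H ⊗[k] M →ₗ[k] N →ₗ[k] M ⊗[k] N :=
  TensorProduct.lift (LinearMap.mk₂ k
    (fun h m => TensorProduct.mk k M N m ∘ₗ W.act (Q.Sinv h))
    (by intros; ext; simp [TensorProduct.tmul_add])
    (by intros; ext; simp)
    (by intros; ext; simp)
    (by intros; ext; simp [TensorProduct.smul_tmul']))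

/-- The linear map sending `(a ⊗ b) ⊗ c` to `h ⊗ m ↦ a h S(c) ⊗ b · m`. -/
def braidingInvMul (Q : QuasiHopfAlgebra k H) (V : YDData k H M) :
    (H ⊗[k] H) ⊗[k] H →ₗ[k] H ⊗[k] M →ₗ[k] H ⊗[k] M :=
  TensorProduct.lift (LinearMap.mk₂ k
    (fun t c => TensorProduct.map (LinearMap.mulRight k (Q.S c)) LinearMap.id ∘ₗ
      tensorAct (Algebra.lmul k H) V.act t)
    (by intros; simp [LinearMap.comp_add])
    (by intros; simp [LinearMap.comp_smul])
    (by
      intro t a b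
      simp only [← LinearMap.rTensor_def]
      rw [← LinearMap.add_comp, ← LinearMap.rTensor_add]
      congr 2
      ext x
      simp [mul_add])
    (by
      intro r t a
      simp only [← LinearMap.rTensor_def]
      rw [← LinearMap.smul_comp, ← LinearMap.rTensor_smul]
      congr 2
      ext x
      simp))

/-- The inverse `c⁻¹ : N ⊗ M → M ⊗ N` of the braiding of `M` and `N`,
`c⁻¹(n ⊗ m) = q̃²₁ X² · (p¹ · m)₍₀₎ ⊗ S⁻¹(q̃¹ X¹ (p¹ · m)₍₋₁₎ p² S(q̃²₂ X³)) · n`. -/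
def braidingInv (Q : QuasiHopfAlgebra k H) (V : YDData k H M) (W : YDData k H N) :
    N ⊗[k] M →ₗ[k] M ⊗[k] N :=
  TensorProduct.lift (braidingInvAux Q M W ∘ₗ
    V.braidingInvMul Q ((TensorProduct.assoc k H H H).symm
      (Algebra.TensorProduct.map (AlgHom.id k H) Q.comul Q.qL * Q.Phi)) ∘ₗ
    V.coactMul Q.pR).flip

section Canonical

variable [Module.Finite k M] (Q : QuasiHopfAlgebra k H) (V : YDData k H M)

/-- The composite `M → M ⊗ (^*M ⊗ (^*M)^*) → (M ⊗ ^*M) ⊗ (^*M)^* → (^*M)^*` of the coevaluation of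
`^*M`, the inverse associativity constraint and `ev'` of `M`. -/
def theta : M →ₗ[k] Module.Dual k (Module.Dual k M) :=
  (TensorProduct.lid k _).toLinearMap ∘ₗ
    TensorProduct.map (V.ev' Q) LinearMap.id ∘ₗ
      assocInv Q V (V.rightDual Q) ((V.rightDual Q).leftDual Q) ∘ₗ
        (TensorProduct.mk k M _).flip ((V.rightDual Q).coev Q)

/-- The composite `(^*M)^* → (^*M)^* ⊗ (^*M ⊗ M) → ((^*M)^* ⊗ ^*M) ⊗ M → M` of `coev'` of `M`, the
inverse associativity constraint and the evaluation of `^*M`. -/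
def thetaInv : Module.Dual k (Module.Dual k M) →ₗ[k] M :=
  (TensorProduct.lid k _).toLinearMap ∘ₗ
    TensorProduct.map ((V.rightDual Q).ev Q) LinearMap.id ∘ₗ
      assocInv Q ((V.rightDual Q).leftDual Q) (V.rightDual Q) V ∘ₗ
        (TensorProduct.mk k _ (Module.Dual k M ⊗[k] M)).flip (V.coev' Q)

/-- The composite `M → (^*(M^*) ⊗ M^*) ⊗ M → ^*(M^*) ⊗ (M^* ⊗ M) → ^*(M^*)` of `coev'` of `M^*`, the
associativity constraint and the evaluation of `M`. -/
def theta' : M →ₗ[k] Module.Dual k (Module.Dual k M) :=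
  (TensorProduct.rid k _).toLinearMap ∘ₗ
    TensorProduct.map LinearMap.id (V.ev Q) ∘ₗ
      assoc Q ((V.leftDual Q).rightDual Q) (V.leftDual Q) V ∘ₗ
        TensorProduct.mk k _ M ((V.leftDual Q).coev' Q)

/-- The composite `^*(M^*) → (M ⊗ M^*) ⊗ ^*(M^*) → M ⊗ (M^* ⊗ ^*(M^*)) → M` of the coevaluation of
`M`, the associativity constraint and `ev'` of `M^*`. -/
def thetaInv' : Module.Dual k (Module.Dual k M) →ₗ[k] M :=
  (TensorProduct.rid k _).toLinearMap ∘ₗ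
    TensorProduct.map LinearMap.id ((V.leftDual Q).ev' Q) ∘ₗ
      assoc Q V (V.leftDual Q) ((V.leftDual Q).rightDual Q) ∘ₗ
        TensorProduct.mk k _ _ (V.coev Q)

/-- `Θ_M : M^* → ^*M`, the composite
`M^* → M^* ⊗ (^*M ⊗ M) → (M^* ⊗ ^*M) ⊗ M → (^*M ⊗ M^*) ⊗ M → ^*M ⊗ (M^* ⊗ M) → ^*M` of `coev'`,
the inverse associativity constraint, the braiding, the associativity constraint and `ev`. -/
def Theta : Module.Dual k M →ₗ[k] Module.Dual k M :=
  (TensorProduct.rid k _).toLinearMap ∘ₗ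
    TensorProduct.map LinearMap.id (V.ev Q) ∘ₗ
      assoc Q (V.rightDual Q) (V.leftDual Q) V ∘ₗ
        TensorProduct.map (braiding (V.leftDual Q) (V.rightDual Q)) LinearMap.id ∘ₗ
          assocInv Q (V.leftDual Q) (V.rightDual Q) V ∘ₗ
            (TensorProduct.mk k _ (Module.Dual k M ⊗[k] M)).flip (V.coev' Q)

/-- `Θ_M⁻¹ : ^*M → M^*`, the composite
`^*M → (M ⊗ M^*) ⊗ ^*M → M ⊗ (M^* ⊗ ^*M) → M ⊗ (^*M ⊗ M^*) → (M ⊗ ^*M) ⊗ M^* → M^*` of `coev`,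
the associativity constraint, the inverse of the braiding `^*M ⊗ M^* → M^* ⊗ ^*M`, the inverse
associativity constraint and `ev'`. -/
def ThetaInv : Module.Dual k M →ₗ[k] Module.Dual k M :=
  (TensorProduct.lid k _).toLinearMap ∘ₗ
    TensorProduct.map (V.ev' Q) LinearMap.id ∘ₗ
      assocInv Q V (V.rightDual Q) (V.leftDual Q) ∘ₗ
        TensorProduct.map LinearMap.id (braidingInv Q (V.rightDual Q) (V.leftDual Q)) ∘ₗ
          assoc Q V (V.leftDual Q) (V.rightDual Q) ∘ₗ
            TensorProduct.mk k _ _ (V.coev Q)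

/-- `ʳΓ_M = θ'_M⁻¹ ∘ Θ_{M^*} : M^** → M` -/
def rGamma : Module.Dual k (Module.Dual k M) →ₗ[k] M :=
  V.thetaInv' Q ∘ₗ (V.leftDual Q).Theta Q

/-- `ˡΓ_M = θ_M⁻¹ ∘ Θ_{^*M}⁻¹ : ^**M → M` -/
def lGamma : Module.Dual k (Module.Dual k M) →ₗ[k] M :=
  V.thetaInv Q ∘ₗ (V.rightDual Q).ThetaInv Q

end Canonical

section Explicit

variable (Q : QuasiHopfAlgebra k H) (V : YDData k H M)

/-- For a linear map `φ : H → H`, the map `h ⊗ m ↦ φ(h) · m`. -/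
def actVia (φ : H →ₗ[k] H) : H ⊗[k] M →ₗ[k] M :=
  TensorProduct.lift (V.act.toLinearMap ∘ₗ φ)

/-- The linear map sending `p¹ ⊗ p²` to
`m ↦ S⁻²((S²(p¹) · m)^𝓕₍₋₁₎) p² ⊗ (S²(p¹) · m)^𝓕₍₀₎`. -/
def rGammaP : H ⊗[k] H →ₗ[k] M →ₗ[k] H ⊗[k] M :=
  TensorProduct.lift (LinearMap.mk₂ k
    (fun a b => TensorProduct.map (LinearMap.mulRight k b ∘ₗ Q.Sinv ∘ₗ Q.Sinv) LinearMap.id ∘ₗ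
      V.twistCoact Q.calF ∘ₗ V.act (Q.S (Q.S a)))
    (by intros; simp [LinearMap.comp_add])
    (by intros; simp [LinearMap.comp_smul])
    (by
      intro a b c
      simp only [← LinearMap.rTensor_def]
      rw [← LinearMap.add_comp, ← LinearMap.rTensor_add]
      congr 2
      ext x
      simp [mul_add])
    (by
      intro r a b
      simp only [← LinearMap.rTensor_def]
      rw [← LinearMap.smul_comp, ← LinearMap.rTensor_smul]
      congr 2
      ext x
      simp))

/-- The linear map sending `q¹ ⊗ q²` to `h ⊗ m ↦ q¹ h S²(q²) · m`. -/
def rGammaQ : H ⊗[k] H →ₗ[k] H ⊗[k] M →ₗ[k] M :=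
  TensorProduct.lift (LinearMap.mk₂ k
    (fun a b => V.actVia (LinearMap.mulRight k (Q.S (Q.S b)) ∘ₗ LinearMap.mulLeft k a))
    (by intros; ext; simp [actVia, add_mul])
    (by intros; ext; simp [actVia])
    (by intros; ext; simp [actVia, mul_add])
    (by intros; ext; simp [actVia]))

/-- The map
`m ↦ q¹ S⁻²((S²(p¹) · m)^𝓕₍₋₁₎) p² S²(q²) · (S²(p¹) · m)^𝓕₍₀₎`. -/
def rGammaFormula : M →ₗ[k] M := V.rGammaQ Q Q.qR ∘ₗ V.rGammaP Q Q.pR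

/-- The map `m ↦ S((p¹ · m)₍₋₁₎ p²) α · (p¹ · m)₍₀₎`. -/
def rGammaInvFormula : M →ₗ[k] M :=
  V.actVia (LinearMap.mulRight k Q.alpha ∘ₗ Q.S) ∘ₗ V.coactMul Q.pR

/-- The linear map sending `a ⊗ b` to
`m ↦ a S((S⁻¹(b) · m)₍₋₁₎) α · (S⁻¹(b) · m)₍₀₎`. -/
def lGammaAux : H ⊗[k] H →ₗ[k] M →ₗ[k] M :=
  TensorProduct.lift (LinearMap.mk₂ k
    (fun a b => V.actVia (LinearMap.mulRight k Q.alpha ∘ₗ LinearMap.mulLeft k a ∘ₗ Q.S) ∘ₗ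
      V.coact ∘ₗ V.act (Q.Sinv b))
    (by
      intro a b c
      rw [← LinearMap.add_comp]
      congr 1
      ext
      simp [actVia, add_mul])
    (by
      intro r a b
      rw [← LinearMap.smul_comp]
      congr 1
      ext
      simp [actVia])
    (by intros; simp [LinearMap.comp_add])
    (by intros; simp [LinearMap.comp_smul]))

/-- The map
`m ↦ V¹ g¹ S((S⁻¹(V² g²) · m)₍₋₁₎) α · (S⁻¹(V² g²) · m)₍₀₎`. -/
def lGammaFormula : M →ₗ[k] M := V.lGammaAux Q (Q.V * Q.fInv)

/-- The linear map sending `q¹ ⊗ q²` to `h ⊗ m ↦ S⁻²(q¹ h) q² · m`. -/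
def lGammaInvAux : H ⊗[k] H →ₗ[k] H ⊗[k] M →ₗ[k] M :=
  TensorProduct.lift (LinearMap.mk₂ k
    (fun a b => V.actVia
      (LinearMap.mulRight k b ∘ₗ Q.Sinv ∘ₗ Q.Sinv ∘ₗ LinearMap.mulLeft k a))
    (by intros; ext; simp [actVia, add_mul])
    (by intros; ext; simp [actVia])
    (by intros; ext; simp [actVia, mul_add])
    (by intros; ext; simp [actVia]))

/-- The map `m ↦ S⁻²(q¹ (p¹ · m)₍₋₁₎ p²) q² · (p¹ · m)₍₀₎`. -/
def lGammaInvFormula : M →ₗ[k] M := V.lGammaInvAux Q Q.qR ∘ₗ V.coactMul Q.pR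

end Explicit

end YDData

/-- Two linear maps are mutually inverse. -/
def AreInverse {k : Type u} [Field k] {A B : Type*} [AddCommGroup A] [Module k A]
    [AddCommGroup B] [Module k B] (p : A →ₗ[k] B) (q : B →ₗ[k] A) : Prop :=
  q ∘ₗ p = LinearMap.id ∧ p ∘ₗ q = LinearMap.id

end

open scoped TensorProduct

noncomputable section

set_option maxSynthPendingDepth 10

/-! ### Commuting algebra maps ("legs") and functionals that contract them. -/

section Strings

variable {k : Type*} [Field k]

/-! Since M is finite-dimensional, a coaction is the same thing as an element R = R¹ ⊗ R² of H ⊗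
End(M), acting by m ↦ R¹ ⊗ R²m. The Yetter-Drinfeld axioms become conditions on R (`IsYDElement`): a
counit condition, Δ(h)R = RΔᵒᵖ(h), and one hexagon. From here on the argument is the quasi-Hopf
version of Drinfeld's theory of the element implementing S². Put u = S(R¹p²)αR²p¹ and v =
S⁻²(q¹R¹p²)q²R²p¹ in End(M) (`drinfeldElt`, `drinfeldInv`). Every map in the theorem turns out to be
composed of u, v and the canonical map from M to its double dual.

Three facts about u carry the proof.

(a) uh = S²(h)u and S(α)u = S(R¹)αR² (`drinfeldElt_mul`, `S_alpha_mul_drinfeldElt`). Both come from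
two exchange rules for p_R (`pR_mul_left`, `pR_mul_alpha`), valid for any form that absorbs a
coproduct at the left end of its argument.

(b) uv = 1 (`drinfeldElt_mul_drinfeldInv`). Moving u through v by (a) leaves an expression which is
the hexagon contracted with β and α (`outerForm_Phi`). Finite dimension then gives vu = 1.

(c) Conjugating R by the twist 𝓕 is the same as applying S² ⊗ id to R and conjugating by u
(`calF_conj_mul`). This is the hardest step. It needs that f and f⁻¹ are really inverse to each
other and intertwine Δ(S(h)) with S(h₂) ⊗ S(h₁) (`f_intertwine`, `fInv_mul_f`, `f_mul_fInv`). It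
also needs that f¹R¹g² ⊗ f²R²g¹, the braiding of the duals, is the transpose of R for the evaluation
pairing γ. Dualising that statement once more gives (c) with γ in place of f, and α is then
cancelled.

By (a) and (c), M^** is M transported along v composed with the inverse of the canonical map, and
^**M is M transported along u composed with that inverse; the mixed double duals are M transported
along the canonical map itself. So these maps are isomorphisms of Yetter-Drinfeld modules, and the
axioms for the double duals come by transport (`isYDIso_of_conjHom`). By the two antipode identities
involving Φ, the maps θ and θ' are the canonical map (`theta_eq`, `theta'_eq`). Contracting the dual
bases in Θ yields v, and in Θ⁻¹ yields u, up to transport (`Theta_leftDual`, `Theta_rightDual`,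
`ThetaInv_eq`); no inverse property of the formula for c⁻¹ enters. Thus ʳΓ is given by v and ˡΓ by
u, and the four explicit expressions are rewritings of u and v.

The calculus behind these computations is as follows. A word in reassociators is written in an
algebra B containing several commuting images of H, and evaluated by a linear map w. The axioms for
α and β say that w contracts two legs at the left or at the right end of the word. Combined with the
pentagon, this makes most reassociators trivial; the zigzag lemmas record the standard cases. -/

/-- Two algebra maps into the same algebra have commuting images. -/
class Commuting {A A' B : Type*} [Ring A] [Algebra k A] [Ring A'] [Algebra k A'] [Ring B]
    [Algebra k B] (a : A →ₐ[k] B) (b : A' →ₐ[k] B) : Prop where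
  comm : ∀ x y, Commute (a x) (b y)

variable {A A' A'' C B B' : Type*} [Ring A] [Algebra k A] [Ring A'] [Algebra k A'] [Ring A'']
  [Algebra k A''] [Ring C] [Algebra k C] [Ring B] [Algebra k B] [Ring B'] [Algebra k B']

instance (priority := 100) Commuting.symm (a : A →ₐ[k] B) (b : A' →ₐ[k] B) [h : Commuting a b] :
    Commuting b a := ⟨fun x y => (h.comm y x).symm⟩

/-- The algebra map `x ⊗ y ↦ a(x) b(y)` for commuting `a` and `b`. -/
def pairHom (a : A →ₐ[k] B) (b : A' →ₐ[k] B) [Commuting a b] : A ⊗[k] A' →ₐ[k] B :=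
  Algebra.TensorProduct.lift a b Commuting.comm

@[simp] theorem pairHom_tmul (a : A →ₐ[k] B) (b : A' →ₐ[k] B) [Commuting a b] (x : A) (y : A') :
    pairHom a b (x ⊗ₜ y) = a x * b y := by simp [pairHom]

instance Commuting.pair_left (a : A →ₐ[k] B) (b : A' →ₐ[k] B) (c : A'' →ₐ[k] B) [Commuting a b]
    [Commuting a c] [Commuting b c] : Commuting (pairHom a b) c := by
  refine ⟨fun x y => ?_⟩
  induction x using TensorProduct.induction_on with
  | zero => simp
  | tmul x x' => simpa using (Commuting.comm (a := a) x y).mul_left (Commuting.comm x' y)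
  | add x x' hx hx' => simpa using hx.add_left hx'

instance Commuting.pair_right (a : A →ₐ[k] B) (b : A' →ₐ[k] B) (c : A'' →ₐ[k] B) [Commuting a b]
    [Commuting c a] [Commuting c b] : Commuting c (pairHom a b) := Commuting.symm _ _

instance Commuting.comp_left (a : A →ₐ[k] B) (b : A' →ₐ[k] B) (g : A'' →ₐ[k] A)
    [h : Commuting a b] :
    Commuting (a.comp g) b := ⟨fun x y => h.comm (g x) y⟩

instance Commuting.comp_right (a : A →ₐ[k] B) (b : A' →ₐ[k] B) (g : A'' →ₐ[k] A')
    [h : Commuting a b] : Commuting a (b.comp g) := ⟨fun x y => h.comm x (g y)⟩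

theorem Commuting.map (φ : B →ₐ[k] B') (a : A →ₐ[k] B) (b : A' →ₐ[k] B) [h : Commuting a b] :
    Commuting (φ.comp a) (φ.comp b) := ⟨fun x y => (h.comm x y).map φ⟩

theorem map_pairHom (φ : B →ₐ[k] B') (a : A →ₐ[k] B) (b : A' →ₐ[k] B) [Commuting a b]
    [Commuting (φ.comp a) (φ.comp b)] (t : A ⊗[k] A') :
    φ (pairHom a b t) = pairHom (φ.comp a) (φ.comp b) t := by
  induction t using TensorProduct.induction_on with
  | zero => simp
  | tmul x x' => simp
  | add x x' hx hx' => simp [hx, hx']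

theorem pairHom_map {D D' : Type*} [Ring D] [Algebra k D] [Ring D'] [Algebra k D']
    (a : A →ₐ[k] B) (b : A' →ₐ[k] B) [Commuting a b] (g : D →ₐ[k] A) (g' : D' →ₐ[k] A')
    (t : D ⊗[k] D') :
    pairHom a b (Algebra.TensorProduct.map g g' t) = pairHom (a.comp g) (b.comp g') t := by
  induction t using TensorProduct.induction_on with
  | zero => simp
  | tmul x x' => simp
  | add x x' hx hx' => simp only [map_add, hx, hx']

theorem pairHom_assoc (a : A →ₐ[k] B) (b : A' →ₐ[k] B) (c : A'' →ₐ[k] B) [Commuting a b]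
    [Commuting a c] [Commuting b c] (t : (A ⊗[k] A') ⊗[k] A'') :
    pairHom a (pairHom b c) (Algebra.TensorProduct.assoc k k k A A' A'' t) =
      pairHom (pairHom a b) c t := by
  induction t using TensorProduct.induction_on with
  | zero => simp
  | tmul t z =>
    induction t using TensorProduct.induction_on with
    | zero => simp
    | tmul x y => simp [mul_assoc]
    | add x x' hx hx' => simp only [TensorProduct.add_tmul, map_add, hx, hx']
  | add x x' hx hx' => simp only [map_add, hx, hx']

variable {W : Type*} [AddCommGroup W] [Module k W]

/-- To the right of nothing, `w` does not distinguish between `a` and `a'`. -/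
def LeftEq (w : B →ₗ[k] W) (a a' : A →ₐ[k] B) : Prop := ∀ x y, w (a x * y) = w (a' x * y)

/-- To the left of nothing, `w` does not distinguish between `a` and `a'`. -/
def RightEq (w : B →ₗ[k] W) (a a' : A →ₐ[k] B) : Prop := ∀ x y, w (y * a x) = w (y * a' x)

theorem LeftEq.pair_left {w : B →ₗ[k] W} {a a' : A →ₐ[k] B} (h : LeftEq w a a') (c : C →ₐ[k] B)
    [Commuting a c] [Commuting a' c] : LeftEq w (pairHom a c) (pairHom a' c) := by
  intro t y
  induction t using TensorProduct.induction_on with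
  | zero => simp
  | tmul x z => simpa [mul_assoc] using h x (c z * y)
  | add x x' hx hx' => simp only [map_add, add_mul, hx, hx']

/-- The legs commute, so the factor from `c` can be moved to the right of the other one, which is
then leftmost. -/
theorem LeftEq.pair_right {w : B →ₗ[k] W} {a a' : A →ₐ[k] B} (h : LeftEq w a a') (c : C →ₐ[k] B)
    [Commuting a c] [Commuting a' c] : LeftEq w (pairHom c a) (pairHom c a') := by
  intro t y
  induction t using TensorProduct.induction_on with
  | zero => simp
  | tmul z x =>
    simpa [mul_assoc, (Commuting.comm (a := c) (b := a) z x).eq,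
      (Commuting.comm (a := c) (b := a') z x).eq] using h x (c z * y)
  | add x x' hx hx' => simp only [map_add, add_mul, hx, hx']

theorem LeftEq.comp {w : B →ₗ[k] W} {a a' : A →ₐ[k] B} (h : LeftEq w a a') (g : C →ₐ[k] A) :
    LeftEq w (a.comp g) (a'.comp g) := fun x y => h (g x) y

/-- A factor inserted at the left end must commute with both legs, so that they can still be brought
to the front; a factor at the right end would need no condition. -/
theorem LeftEq.mulLeft {w : B →ₗ[k] W} {a a' : A →ₐ[k] B} (h : LeftEq w a a') {z : B}
    (ha : ∀ x, Commute z (a x)) (ha' : ∀ x, Commute z (a' x)) :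
    LeftEq (w ∘ₗ LinearMap.mulLeft k z) a a' := by
  intro x y
  simp only [LinearMap.comp_apply, LinearMap.mulLeft_apply, ← mul_assoc, (ha x).eq, (ha' x).eq]
  simpa only [mul_assoc] using h x (z * y)

theorem RightEq.pair_right {w : B →ₗ[k] W} {a a' : A →ₐ[k] B} (h : RightEq w a a') (c : C →ₐ[k] B)
    [Commuting a c] [Commuting a' c] : RightEq w (pairHom c a) (pairHom c a') := by
  intro t y
  induction t using TensorProduct.induction_on with
  | zero => simp
  | tmul z x => simpa [mul_assoc] using h x (y * c z)
  | add x x' hx hx' => simp only [map_add, mul_add, hx, hx']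

theorem RightEq.pair_left {w : B →ₗ[k] W} {a a' : A →ₐ[k] B} (h : RightEq w a a') (c : C →ₐ[k] B)
    [Commuting a c] [Commuting a' c] : RightEq w (pairHom a c) (pairHom a' c) := by
  intro t y
  induction t using TensorProduct.induction_on with
  | zero => simp
  | tmul x z =>
    simpa [mul_assoc, (Commuting.comm (a := c) (b := a) z x).eq,
      (Commuting.comm (a := c) (b := a') z x).eq] using h x (y * c z)
  | add x x' hx hx' => simp only [map_add, mul_add, hx, hx']

theorem RightEq.comp {w : B →ₗ[k] W} {a a' : A →ₐ[k] B} (h : RightEq w a a') (g : C →ₐ[k] A) :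
    RightEq w (a.comp g) (a'.comp g) := fun x y => h (g x) y

theorem RightEq.mulRight {w : B →ₗ[k] W} {a a' : A →ₐ[k] B} (h : RightEq w a a') {z : B}
    (ha : ∀ x, Commute z (a x)) (ha' : ∀ x, Commute z (a' x)) :
    RightEq (w ∘ₗ LinearMap.mulRight k z) a a' := by
  intro x y
  simp only [LinearMap.comp_apply, LinearMap.mulRight_apply, mul_assoc, ← (ha x).eq, ← (ha' x).eq]
  simpa only [mul_assoc] using h x (y * z)

end Strings

/-! ### Coproduct, counit and reassociator read in arbitrary commuting legs. -/

namespace QuasiHopfAlgebra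

variable {k H : Type*} [Field k] [Ring H] [Algebra k H] (Q : QuasiHopfAlgebra k H)
variable {B B' C : Type*} [Ring B] [Algebra k B] [Ring B'] [Algebra k B'] [Ring C] [Algebra k C]

/-- The algebra map `h ↦ a(h₁) b(h₂)`. -/
def conv (a b : H →ₐ[k] B) [Commuting a b] : H →ₐ[k] B := (pairHom a b).comp Q.comul

theorem conv_apply (a b : H →ₐ[k] B) [Commuting a b] (h : H) :
    Q.conv a b h = pairHom a b (Q.comul h) := rfl

instance (a b : H →ₐ[k] B) (c : C →ₐ[k] B) [Commuting a b] [Commuting a c] [Commuting b c] :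
    Commuting (Q.conv a b) c := inferInstanceAs (Commuting ((pairHom a b).comp Q.comul) c)

instance (a b : H →ₐ[k] B) (c : C →ₐ[k] B) [Commuting a b] [Commuting c a] [Commuting c b] :
    Commuting c (Q.conv a b) := Commuting.symm _ _

/-- The counit as a map to `B`. -/
def unitHom (B : Type*) [Ring B] [Algebra k B] : H →ₐ[k] B := (Algebra.ofId k B).comp Q.counit

theorem unitHom_apply (h : H) : Q.unitHom B h = algebraMap k B (Q.counit h) := rfl

instance (c : C →ₐ[k] B) : Commuting (Q.unitHom B) c :=
  ⟨fun _ y => Algebra.commute_algebraMap_left _ (c y)⟩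

/-- The element `a(X¹) b(X²) c(X³)`. -/
def asc (a b c : H →ₐ[k] B) [Commuting a b] [Commuting a c] [Commuting b c] : B :=
  pairHom a (pairHom b c) Q.Phi

/-- The element `a(x¹) b(x²) c(x³)`. -/
def ascInv (a b c : H →ₐ[k] B) [Commuting a b] [Commuting a c] [Commuting b c] : B :=
  pairHom a (pairHom b c) Q.PhiInv

theorem Phi_mul_PhiInv : Q.Phi * Q.PhiInv = 1 := Q.reassoc.mul_inv

theorem PhiInv_mul_Phi : Q.PhiInv * Q.Phi = 1 := Q.reassoc.inv_mul

section

variable (a b c d : H →ₐ[k] B) [Commuting a b] [Commuting a c] [Commuting a d] [Commuting b c]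
  [Commuting b d] [Commuting c d]

theorem asc_mul_ascInv : Q.asc a b c * Q.ascInv a b c = 1 := by
  rw [asc, ascInv, ← map_mul, Phi_mul_PhiInv, map_one]

theorem ascInv_mul_asc : Q.ascInv a b c * Q.asc a b c = 1 := by
  rw [asc, ascInv, ← map_mul, PhiInv_mul_Phi, map_one]

theorem asc_mul_ascInv_mul (y : B) : Q.asc a b c * (Q.ascInv a b c * y) = y := by
  rw [← mul_assoc, asc_mul_ascInv, one_mul]

theorem ascInv_mul_asc_mul (y : B) : Q.ascInv a b c * (Q.asc a b c * y) = y := by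
  rw [← mul_assoc, ascInv_mul_asc, one_mul]

theorem pairHom_comulFirst {D : Type*} [Ring D] [Algebra k D] (e : D →ₐ[k] B) [Commuting a e]
    [Commuting b e] (t : H ⊗[k] D) :
    pairHom a (pairHom b e) (comulFirst Q.comul D t) = pairHom (Q.conv a b) e t := by
  rw [comulFirst, AlgHom.comp_apply]
  change pairHom a (pairHom b e) (Algebra.TensorProduct.assoc k k k H H D _) = _
  rw [pairHom_assoc, pairHom_map]
  rfl

/-- Three commuting legs define an algebra map on the triple tensor power of H, so the
coassociativity axiom can be pushed into B. `pentagon` is the image of the cocycle axiom under four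
legs in the same way. -/
theorem conv_asc (h : H) : Q.conv a (Q.conv b c) h * Q.asc a b c =
    Q.asc a b c * Q.conv (Q.conv a b) c h := by
  have := congrArg (pairHom a (pairHom b c)) (Q.coassoc h)
  rw [pairHom_map, map_mul, map_mul, pairHom_comulFirst] at this
  change Q.conv a (Q.conv b c) h = Q.asc a b c * Q.conv (Q.conv a b) c h * Q.ascInv a b c at this
  rw [this, mul_assoc, ascInv_mul_asc, mul_one]

theorem conv_ascInv (h : H) : Q.conv (Q.conv a b) c h * Q.ascInv a b c =
    Q.ascInv a b c * Q.conv a (Q.conv b c) h := by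
  have := Q.conv_asc a b c h
  calc _ = Q.ascInv a b c * (Q.asc a b c * Q.conv (Q.conv a b) c h) * Q.ascInv a b c := by
        rw [ascInv_mul_asc_mul]
    _ = _ := by rw [← this, mul_assoc, mul_assoc, asc_mul_ascInv, mul_one]

theorem pentagon : Q.asc b c d * Q.asc a (Q.conv b c) d * Q.asc a b c =
    Q.asc a b (Q.conv c d) * Q.asc (Q.conv a b) c d := by
  have := congrArg (pairHom a (pairHom b (pairHom c d))) Q.cocycle
  rw [map_mul, map_mul, map_mul, pairHom_comulFirst, pairHom_map, pairHom_map, pairHom_map,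
    pairHom_tmul, map_one, one_mul] at this
  have h1 : (pairHom b (pairHom c d)).comp (comulFirst Q.comul H) = pairHom (Q.conv b c) d :=
    AlgHom.ext fun t => Q.pairHom_comulFirst b c d t
  have h2 : (pairHom b (pairHom c d)).comp (Algebra.TensorProduct.map (AlgHom.id k H)
      (Algebra.TensorProduct.includeLeft : H →ₐ[k] H ⊗[k] H)) = pairHom b c := by
    ext <;> simp
  have h3 : (pairHom b (pairHom c d)).comp (Algebra.TensorProduct.map (AlgHom.id k H) Q.comul) =
      pairHom b (Q.conv c d) := by
    refine AlgHom.ext fun t => ?_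
    rw [AlgHom.comp_apply, pairHom_map]; rfl
  simp only [h1, h2, h3] at this
  exact this

theorem conv_unit_left : Q.conv (Q.unitHom B) a = a := by
  ext h
  have h1 : ∀ t : H ⊗[k] H, pairHom (Q.unitHom B) a t =
      a (TensorProduct.lid k H (TensorProduct.map Q.counit.toLinearMap LinearMap.id t)) := by
    intro t
    induction t using TensorProduct.induction_on with
    | zero => simp
    | tmul x y => simp [unitHom_apply, Algebra.smul_def]
    | add x y hx hy => simp only [map_add, hx, hy]
  rw [conv_apply, h1, Q.counit_comul]

theorem conv_unit_right : Q.conv a (Q.unitHom B) = a := by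
  ext h
  have h1 : ∀ t : H ⊗[k] H, pairHom a (Q.unitHom B) t =
      a (TensorProduct.rid k H (TensorProduct.map LinearMap.id Q.counit.toLinearMap t)) := by
    intro t
    induction t using TensorProduct.induction_on with
    | zero => simp
    | tmul x y => simp [unitHom_apply, Algebra.smul_def, Algebra.commutes]
    | add x y hx hy => simp only [map_add, hx, hy]
  rw [conv_apply, h1, Q.comul_counit]

theorem asc_unit_mid : Q.asc a (Q.unitHom B) c = 1 := by
  have h1 : ∀ t : H ⊗[k] (H ⊗[k] H), pairHom a (pairHom (Q.unitHom B) c) t =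
      pairHom a c (TensorProduct.map LinearMap.id ((TensorProduct.lid k H).toLinearMap ∘ₗ
          TensorProduct.map Q.counit.toLinearMap LinearMap.id) t) := by
    intro t
    induction t using TensorProduct.induction_on with
    | zero => simp
    | tmul x t =>
      induction t using TensorProduct.induction_on with
      | zero => simp
      | tmul y z => simp [unitHom_apply, Algebra.smul_def]
      | add y z hy hz => simp only [TensorProduct.tmul_add, map_add, hy, hz]
    | add x y hx hy => simp only [map_add, hx, hy]
  rw [asc, h1]
  have := Q.normalized
  rw [Phi, this]
  simp

/-- The axioms normalise Φ only in the middle slot. With the counit in the first two slots the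
pentagon says that this element is idempotent, and it is invertible. The right-hand slot is treated
with the counit in the last two. -/
theorem asc_unit_left : Q.asc (Q.unitHom B) c d = 1 := by
  have h := Q.pentagon (Q.unitHom B) (Q.unitHom B) c d
  simp only [conv_unit_left, conv_unit_right, asc_unit_mid, mul_one, one_mul] at h
  calc _ = Q.asc (Q.unitHom B) c d * Q.asc (Q.unitHom B) c d * Q.ascInv (Q.unitHom B) c d := by
        rw [mul_assoc, asc_mul_ascInv, mul_one]
    _ = 1 := by rw [h, asc_mul_ascInv]

theorem asc_unit_right : Q.asc a b (Q.unitHom B) = 1 := by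
  have h := Q.pentagon a b (Q.unitHom B) (Q.unitHom B)
  simp only [conv_unit_right, asc_unit_mid, mul_one, one_mul] at h
  calc _ = Q.asc a b (Q.unitHom B) * Q.asc a b (Q.unitHom B) * Q.ascInv a b (Q.unitHom B) := by
        rw [mul_assoc, asc_mul_ascInv, mul_one]
    _ = 1 := by rw [h, asc_mul_ascInv]

theorem ascInv_eq_one_of_asc (h : Q.asc a b c = 1) : Q.ascInv a b c = 1 := by
  have := Q.asc_mul_ascInv a b c
  rwa [h, one_mul] at this

end

end QuasiHopfAlgebra

theorem pairHom_intertwine {k A A' B : Type*} [Field k] [Ring A] [Algebra k A] [Ring A']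
    [Algebra k A'] [Ring B] [Algebra k B] {a a' : A →ₐ[k] B} {b b' : A' →ₐ[k] B}
    [Commuting a b] [Commuting a' b'] {z : B} (ha : ∀ x, z * a x = a' x * z)
    (hb : ∀ y, z * b y = b' y * z) (t : A ⊗[k] A') :
    z * pairHom a b t = pairHom a' b' t * z := by
  induction t using TensorProduct.induction_on with
  | zero => simp
  | tmul x y => rw [pairHom_tmul, pairHom_tmul, ← mul_assoc, ha, mul_assoc, hb, mul_assoc]
  | add x y hx hy => rw [map_add, map_add, mul_add, add_mul, hx, hy]

namespace QuasiHopfAlgebra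

variable {k H : Type*} [Field k] [Ring H] [Algebra k H] (Q : QuasiHopfAlgebra k H)
variable {B B' C : Type*} [Ring B] [Algebra k B] [Ring B'] [Algebra k B'] [Ring C] [Algebra k C]

section

variable {a b c a' b' c' : H →ₐ[k] B} [Commuting a b] [Commuting a c] [Commuting b c]
  [Commuting a' b'] [Commuting a' c'] [Commuting b' c']

/-- Naturality of the associativity constraint: whatever carries three legs to three other legs
passes through the reassociator. -/
theorem asc_intertwine {z : B} (ha : ∀ x, z * a x = a' x * z) (hb : ∀ y, z * b y = b' y * z)
    (hc : ∀ y, z * c y = c' y * z) : z * Q.asc a b c = Q.asc a' b' c' * z :=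
  pairHom_intertwine ha (pairHom_intertwine hb hc) _

theorem ascInv_intertwine {z : B} (ha : ∀ x, z * a x = a' x * z) (hb : ∀ y, z * b y = b' y * z)
    (hc : ∀ y, z * c y = c' y * z) : z * Q.ascInv a b c = Q.ascInv a' b' c' * z :=
  pairHom_intertwine ha (pairHom_intertwine hb hc) _

theorem conv_intertwine {z : B} (ha : ∀ x, z * a x = a' x * z) (hb : ∀ y, z * b y = b' y * z)
    (h : H) : z * Q.conv a b h = Q.conv a' b' h * z :=
  pairHom_intertwine ha hb _

theorem asc_comm (d : C →ₐ[k] B) [Commuting a d] [Commuting b d] [Commuting c d] (h : C) :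
    Q.asc a b c * d h = d h * Q.asc a b c :=
  (Commuting.comm (a := pairHom a (pairHom b c)) (b := d) Q.Phi h).eq

theorem ascInv_comm (d : C →ₐ[k] B) [Commuting a d] [Commuting b d] [Commuting c d] (h : C) :
    Q.ascInv a b c * d h = d h * Q.ascInv a b c :=
  (Commuting.comm (a := pairHom a (pairHom b c)) (b := d) Q.PhiInv h).eq

end

section

variable {W : Type*} [AddCommGroup W] [Module k W] {w : B →ₗ[k] W}
variable {a a' : H →ₐ[k] B} (c d : H →ₐ[k] B) [Commuting a c] [Commuting a d] [Commuting c d]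
  [Commuting a' c] [Commuting a' d]

theorem leftEq_conv_left (h : LeftEq w a a') : LeftEq w (Q.conv a c) (Q.conv a' c) :=
  (h.pair_left c).comp _

theorem leftEq_conv_right (h : LeftEq w a a') : LeftEq w (Q.conv c a) (Q.conv c a') :=
  (h.pair_right c).comp _

theorem leftEq_conv_unit_left (h : LeftEq w a (Q.unitHom B)) : LeftEq w (Q.conv a c) c := by
  simpa only [conv_unit_left] using Q.leftEq_conv_left c h

theorem leftEq_conv_unit_right (h : LeftEq w a (Q.unitHom B)) : LeftEq w (Q.conv c a) c := by
  simpa only [conv_unit_right] using Q.leftEq_conv_right c h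

theorem leftEq_asc_fst (h : LeftEq w a a') (y : B) :
    w (Q.asc a c d * y) = w (Q.asc a' c d * y) := h.pair_left _ _ _

theorem leftEq_asc_snd (h : LeftEq w a a') (y : B) :
    w (Q.asc c a d * y) = w (Q.asc c a' d * y) := (h.pair_left _).pair_right _ _ _

theorem leftEq_asc_trd (h : LeftEq w a a') (y : B) :
    w (Q.asc c d a * y) = w (Q.asc c d a' * y) := (h.pair_right _).pair_right _ _ _

theorem leftEq_ascInv_fst (h : LeftEq w a a') (y : B) :
    w (Q.ascInv a c d * y) = w (Q.ascInv a' c d * y) := h.pair_left _ _ _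

theorem leftEq_ascInv_snd (h : LeftEq w a a') (y : B) :
    w (Q.ascInv c a d * y) = w (Q.ascInv c a' d * y) := (h.pair_left _).pair_right _ _ _

theorem leftEq_ascInv_trd (h : LeftEq w a a') (y : B) :
    w (Q.ascInv c d a * y) = w (Q.ascInv c d a' * y) := (h.pair_right _).pair_right _ _ _

theorem rightEq_conv_left (h : RightEq w a a') : RightEq w (Q.conv a c) (Q.conv a' c) :=
  (h.pair_left c).comp _

theorem rightEq_conv_right (h : RightEq w a a') : RightEq w (Q.conv c a) (Q.conv c a') :=
  (h.pair_right c).comp _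

theorem rightEq_conv_unit_left (h : RightEq w a (Q.unitHom B)) : RightEq w (Q.conv a c) c := by
  simpa only [conv_unit_left] using Q.rightEq_conv_left c h

theorem rightEq_conv_unit_right (h : RightEq w a (Q.unitHom B)) : RightEq w (Q.conv c a) c := by
  simpa only [conv_unit_right] using Q.rightEq_conv_right c h

theorem rightEq_asc_fst (h : RightEq w a a') (y : B) :
    w (y * Q.asc a c d) = w (y * Q.asc a' c d) := h.pair_left _ _ _

theorem rightEq_asc_snd (h : RightEq w a a') (y : B) :
    w (y * Q.asc c a d) = w (y * Q.asc c a' d) := (h.pair_left _).pair_right _ _ _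

theorem rightEq_asc_trd (h : RightEq w a a') (y : B) :
    w (y * Q.asc c d a) = w (y * Q.asc c d a') := (h.pair_right _).pair_right _ _ _

theorem rightEq_ascInv_fst (h : RightEq w a a') (y : B) :
    w (y * Q.ascInv a c d) = w (y * Q.ascInv a' c d) := h.pair_left _ _ _

theorem rightEq_ascInv_snd (h : RightEq w a a') (y : B) :
    w (y * Q.ascInv c a d) = w (y * Q.ascInv c a' d) := (h.pair_left _).pair_right _ _ _

theorem rightEq_ascInv_trd (h : RightEq w a a') (y : B) :
    w (y * Q.ascInv c d a) = w (y * Q.ascInv c d a') := (h.pair_right _).pair_right _ _ _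

theorem ascInv_unit_left : Q.ascInv (Q.unitHom B) c d = 1 :=
  Q.ascInv_eq_one_of_asc _ _ _ (Q.asc_unit_left c d)

theorem ascInv_unit_mid : Q.ascInv c (Q.unitHom B) d = 1 :=
  Q.ascInv_eq_one_of_asc _ _ _ (Q.asc_unit_mid c d)

theorem ascInv_unit_right : Q.ascInv c d (Q.unitHom B) = 1 :=
  Q.ascInv_eq_one_of_asc _ _ _ (Q.asc_unit_right c d)

end

/-! ### Rearrangements of the pentagon and zigzag identities. -/

section

variable {W : Type*} [AddCommGroup W] [Module k W] {w : B →ₗ[k] W}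
variable (a b c d : H →ₐ[k] B) [Commuting a b] [Commuting a c] [Commuting a d] [Commuting b c]
  [Commuting b d] [Commuting c d]

theorem pentagon_one : Q.asc a (Q.conv b c) d * (Q.asc a b c * Q.ascInv (Q.conv a b) c d) =
    Q.ascInv b c d * Q.asc a b (Q.conv c d) := by
  calc _ = Q.ascInv b c d * (Q.asc b c d * Q.asc a (Q.conv b c) d * Q.asc a b c) *
        Q.ascInv (Q.conv a b) c d := by
        simp only [mul_assoc, ascInv_mul_asc_mul]
    _ = _ := by rw [pentagon]; simp only [mul_assoc, asc_mul_ascInv, mul_one]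

theorem pentagon_two : Q.ascInv b c d * Q.asc a b (Q.conv c d) =
    Q.asc a (Q.conv b c) d * (Q.asc a b c * Q.ascInv (Q.conv a b) c d) :=
  (Q.pentagon_one a b c d).symm

theorem pentagon_three : Q.asc (Q.conv a b) c d * Q.ascInv a b c =
    Q.ascInv a b (Q.conv c d) * (Q.asc b c d * Q.asc a (Q.conv b c) d) := by
  calc _ = Q.ascInv a b (Q.conv c d) * (Q.asc a b (Q.conv c d) * Q.asc (Q.conv a b) c d) *
        Q.ascInv a b c := by
        simp only [ascInv_mul_asc_mul]
    _ = _ := by rw [← pentagon]; simp only [mul_assoc, asc_mul_ascInv, mul_one]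

theorem pentagon_four : Q.asc a b c * Q.ascInv (Q.conv a b) c d =
    Q.ascInv a (Q.conv b c) d * (Q.ascInv b c d * Q.asc a b (Q.conv c d)) := by
  rw [← pentagon_one, ascInv_mul_asc_mul]

theorem pentagon_five : Q.ascInv a b (Q.conv c d) * Q.asc b c d =
    Q.asc (Q.conv a b) c d * (Q.ascInv a b c * Q.ascInv a (Q.conv b c) d) := by
  have := Q.pentagon_three a b c d
  rw [← mul_assoc, this]
  simp only [mul_assoc, asc_mul_ascInv, mul_one]

theorem pentagon_inv : Q.ascInv a b c * (Q.ascInv a (Q.conv b c) d * Q.ascInv b c d) =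
    Q.ascInv (Q.conv a b) c d * Q.ascInv a b (Q.conv c d) := by
  calc _ = Q.ascInv a b c * (Q.ascInv a (Q.conv b c) d * (Q.ascInv b c d *
        (Q.asc a b (Q.conv c d) * Q.ascInv a b (Q.conv c d)))) := by
        rw [asc_mul_ascInv, mul_one]
    _ = Q.ascInv a b c * ((Q.ascInv a (Q.conv b c) d * (Q.ascInv b c d *
        Q.asc a b (Q.conv c d))) * Q.ascInv a b (Q.conv c d)) := by simp only [mul_assoc]
    _ = _ := by rw [← pentagon_four]; simp only [mul_assoc, ascInv_mul_asc_mul]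

/-- The pentagon rewrites the product as three reassociators. The leftmost one contains the product
leg contracted by `w` at the left end, the rightmost one the product leg contracted at the right
end, so both become trivial and the middle one survives. The next three lemmas use the same
mechanism for other rearrangements. -/
theorem zigzag_one (hL : LeftEq w (Q.conv b c) (Q.unitHom B))
    (hR : RightEq w (Q.conv a b) (Q.unitHom B)) :
    w (Q.ascInv b c d * Q.asc a b (Q.conv c d)) = w (Q.asc a b c) := by
  rw [pentagon_two, Q.leftEq_asc_snd a d hL, asc_unit_mid, one_mul,
    Q.rightEq_ascInv_fst c d hR, ascInv_unit_left, mul_one]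

theorem zigzag_two (hL : LeftEq w (Q.conv c d) (Q.unitHom B))
    (hR : RightEq w (Q.conv b c) (Q.unitHom B)) :
    w (Q.asc (Q.conv a b) c d * Q.ascInv a b c) = w (Q.asc b c d) := by
  rw [pentagon_three, Q.leftEq_ascInv_trd a b hL, ascInv_unit_right, one_mul,
    Q.rightEq_asc_snd a d hR, asc_unit_mid, mul_one]

theorem zigzag_three (hL : LeftEq w (Q.conv b c) (Q.unitHom B))
    (hR : RightEq w (Q.conv c d) (Q.unitHom B)) :
    w (Q.asc a b c * Q.ascInv (Q.conv a b) c d) = w (Q.ascInv b c d) := by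
  rw [pentagon_four, Q.leftEq_ascInv_snd a d hL, ascInv_unit_mid, one_mul,
    Q.rightEq_asc_trd a b hR, asc_unit_right, mul_one]

theorem zigzag_four (hL : LeftEq w (Q.conv a b) (Q.unitHom B))
    (hR : RightEq w (Q.conv b c) (Q.unitHom B)) :
    w (Q.ascInv a b (Q.conv c d) * Q.asc b c d) = w (Q.ascInv a b c) := by
  rw [pentagon_five, Q.leftEq_asc_fst c d hL, asc_unit_left, one_mul,
    Q.rightEq_ascInv_snd a d hR, ascInv_unit_mid, mul_one]

end

end QuasiHopfAlgebra

section

variable {k A B W : Type*} [Field k] [Ring A] [Algebra k A] [Ring B] [Algebra k B]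
  [AddCommGroup W] [Module k W]

theorem LeftEq.mulRight {w : B →ₗ[k] W} {a a' : A →ₐ[k] B} (h : LeftEq w a a') (z : B) :
    LeftEq (w ∘ₗ LinearMap.mulRight k z) a a' := by
  intro x y
  simpa [mul_assoc] using h x (y * z)

theorem RightEq.mulLeft {w : B →ₗ[k] W} {a a' : A →ₐ[k] B} (h : RightEq w a a') (z : B) :
    RightEq (w ∘ₗ LinearMap.mulLeft k z) a a' := by
  intro x y
  simpa [mul_assoc] using h x (z * y)

end

/-! ### Zigzags for two nested pairs of dual legs. -/

namespace QuasiHopfAlgebra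

variable {k H : Type*} [Field k] [Ring H] [Algebra k H] (Q : QuasiHopfAlgebra k H)
variable {B W : Type*} [Ring B] [Algebra k B] [AddCommGroup W] [Module k W] {w : B →ₗ[k] W}

section

variable (p q r s p' q' : H →ₐ[k] B) [Commuting p q] [Commuting p r] [Commuting p s]
  [Commuting p p'] [Commuting p q'] [Commuting q r] [Commuting q s] [Commuting q p']
  [Commuting q q'] [Commuting r s] [Commuting r p'] [Commuting r q'] [Commuting s p']
  [Commuting s q'] [Commuting p' q']

/-- In categorical terms: if two objects have duals, the product of the duals in opposite order is
dual to the product of the objects. The long word is the zigzag of the product; it decouples into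
the zigzag on `q`, `r`, `q'` and the one on `p`, `s`, `p'`. -/
theorem nested_zigzag_one (hL₁ : LeftEq w (Q.conv s p') (Q.unitHom B))
    (hL₂ : LeftEq w (Q.conv r q') (Q.unitHom B)) (hR₁ : RightEq w (Q.conv q r) (Q.unitHom B))
    (hR₂ : RightEq w (Q.conv p s) (Q.unitHom B)) :
    w (Q.asc r s p' * (Q.ascInv (Q.conv r s) p' q' * (Q.asc (Q.conv p q) (Q.conv r s)
      (Q.conv p' q') * (Q.asc (Q.conv p q) r s * Q.ascInv p q r)))) =
    w (Q.asc q r q' * Q.asc p s p') := by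
  have e3 : Q.asc (Q.conv (Q.conv p q) r) s (Q.conv p' q') * Q.ascInv p q r =
      Q.ascInv p q r * Q.asc (Q.conv p (Q.conv q r)) s (Q.conv p' q') :=
    (Q.asc_intertwine (fun h => (Q.conv_ascInv p q r h).symm) (Q.ascInv_comm s)
      (Q.ascInv_comm (Q.conv p' q'))).symm
  have e4 : Q.ascInv s p' q' * Q.asc (Q.conv p q) r (Q.conv s (Q.conv p' q')) =
      Q.asc (Q.conv p q) r (Q.conv (Q.conv s p') q') * Q.ascInv s p' q' :=
    Q.asc_intertwine (Q.ascInv_comm (Q.conv p q)) (Q.ascInv_comm r)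
      (fun h => (Q.conv_ascInv s p' q' h).symm)
  have e5 : Q.ascInv s p' q' * Q.ascInv p q r = Q.ascInv p q r * Q.ascInv s p' q' :=
    Q.ascInv_intertwine (Q.ascInv_comm p) (Q.ascInv_comm q) (Q.ascInv_comm r)
  have e : Q.asc r (Q.conv s p') q' * (Q.asc r s p' * (Q.ascInv (Q.conv r s) p' q' *
      (Q.asc (Q.conv p q) (Q.conv r s)
      (Q.conv p' q') * (Q.asc (Q.conv p q) r s * Q.ascInv p q r)))) =
      Q.asc (Q.conv p q) r (Q.conv (Q.conv s p') q') * ((Q.ascInv p q r * Q.ascInv s p' q') *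
        Q.asc (Q.conv p (Q.conv q r)) s (Q.conv p' q')) := by
    calc _ = (Q.asc r (Q.conv s p') q' * (Q.asc r s p' * Q.ascInv (Q.conv r s) p' q')) *
        (Q.asc (Q.conv p q) (Q.conv r s) (Q.conv p' q') * (Q.asc (Q.conv p q) r s *
          Q.ascInv p q r)) := by simp only [mul_assoc]
      _ = Q.ascInv s p' q' * (Q.asc r s (Q.conv p' q') *
        Q.asc (Q.conv p q) (Q.conv r s) (Q.conv p' q') * Q.asc (Q.conv p q) r s) *
          Q.ascInv p q r := by rw [pentagon_one]; simp only [mul_assoc]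
      _ = (Q.ascInv s p' q' * Q.asc (Q.conv p q) r (Q.conv s (Q.conv p' q'))) *
          (Q.asc (Q.conv (Q.conv p q) r) s (Q.conv p' q') * Q.ascInv p q r) := by
          rw [pentagon]; simp only [mul_assoc]
      _ = _ := by rw [e3, e4, ← e5]; simp only [mul_assoc]
  -- The word is extended on the left by a reassociator containing the product of `s` and `p'`. It
  -- is trivial under `w`, and it is the term missing for the pentagon on `r`, `s`, `p'`, `q'`.
  rw [← one_mul (Q.asc r s p' * _), ← Q.asc_unit_mid r q', ← Q.leftEq_asc_snd r q' hL₁, e,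
    Q.leftEq_asc_trd (Q.conv p q) r (Q.leftEq_conv_unit_left q' hL₁), ← mul_assoc,
    Q.rightEq_asc_fst s (Q.conv p' q') (Q.rightEq_conv_unit_right p hR₁),
    mul_assoc, mul_assoc, pentagon_two, ← mul_assoc, ← mul_assoc, ← mul_assoc,
    Q.rightEq_ascInv_fst p' q' hR₂, ascInv_unit_left, mul_one, mul_assoc]
  have hw : LeftEq (w ∘ₗ LinearMap.mulLeft k (Q.asc (Q.conv p q) r q' * Q.ascInv p q r))
      (Q.conv s p') (Q.unitHom B) := by
    refine hL₁.mulLeft (fun x => ?_) (fun x => ?_)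
    · exact Commute.mul_left (Q.asc_comm _ x) (Q.ascInv_comm _ x)
    · exact Commute.mul_left (Q.asc_comm _ x) (Q.ascInv_comm _ x)
  have h1 := Q.leftEq_asc_snd p q' hw (Q.asc p s p')
  rw [asc_unit_mid, one_mul] at h1
  refine h1.trans ?_
  have h2 := Q.zigzag_two (w := w ∘ₗ LinearMap.mulRight k (Q.asc p s p')) p q r q'
    (hL₂.mulRight _) (hR₁.mulRight (Q.asc_comm _) (Q.asc_comm _))
  exact h2

end

section

variable (r s p q r' s' : H →ₐ[k] B) [Commuting r s] [Commuting r p] [Commuting r q]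
  [Commuting r r'] [Commuting r s'] [Commuting s p] [Commuting s q] [Commuting s r']
  [Commuting s s'] [Commuting p q] [Commuting p r'] [Commuting p s'] [Commuting q r']
  [Commuting q s'] [Commuting r' s']

/-- The pentagon regroups the word so that the adjacent pairs `s`, `p` and `q`, `r'` contract inside
larger reassociators. The two remaining halves involve disjoint zigzags, settled by `zigzag_three`
and `zigzag_four`. -/
theorem nested_zigzag_two (hL₁ : LeftEq w (Q.conv s p) (Q.unitHom B))
    (hL₂ : LeftEq w (Q.conv r q) (Q.unitHom B)) (hR₁ : RightEq w (Q.conv q r') (Q.unitHom B))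
    (hR₂ : RightEq w (Q.conv p s') (Q.unitHom B)) :
    w (Q.asc r s p * (Q.ascInv (Q.conv r s) p q * (Q.ascInv (Q.conv r s) (Q.conv p q)
      (Q.conv r' s') * (Q.asc (Q.conv p q) r' s' * Q.ascInv p q r')))) =
    w (Q.ascInv r q r' * Q.ascInv s p s') := by
  have e1 : Q.asc r s p * Q.ascInv (Q.conv (Q.conv r s) p) q (Q.conv r' s') =
      Q.ascInv (Q.conv r (Q.conv s p)) q (Q.conv r' s') * Q.asc r s p :=
    Q.ascInv_intertwine (fun h => (Q.conv_asc r s p h).symm) (Q.asc_comm _) (Q.asc_comm _)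
  have e2 : Q.ascInv (Q.conv r s) p (Q.conv q (Q.conv r' s')) * Q.asc q r' s' =
      Q.asc q r' s' * Q.ascInv (Q.conv r s) p (Q.conv (Q.conv q r') s') :=
    (Q.ascInv_intertwine (Q.asc_comm _) (Q.asc_comm _) (fun h => (Q.conv_asc q r' s' h).symm)).symm
  have e3 : Q.asc r s p * Q.asc q r' s' = Q.asc q r' s' * Q.asc r s p :=
    Q.asc_intertwine (Q.asc_comm _) (Q.asc_comm _) (Q.asc_comm _)
  have e : Q.asc r s p * (Q.ascInv (Q.conv r s) p q * (Q.ascInv (Q.conv r s) (Q.conv p q)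
      (Q.conv r' s') * (Q.asc (Q.conv p q) r' s' * Q.ascInv p q r'))) =
      Q.ascInv (Q.conv r (Q.conv s p)) q (Q.conv r' s') * (Q.asc r s p *
        (Q.ascInv (Q.conv r s) p (Q.conv q (Q.conv r' s')) *
          (Q.asc q r' s' * Q.asc p (Q.conv q r') s'))) := by
    rw [pentagon_three, ← mul_assoc (Q.ascInv (Q.conv r s) (Q.conv p q) (Q.conv r' s')),
      ← mul_assoc (Q.ascInv (Q.conv r s) p q), pentagon_inv]
    simp only [← mul_assoc]
    rw [e1]
  rw [e, Q.leftEq_ascInv_fst q (Q.conv r' s') (Q.leftEq_conv_unit_right r hL₁),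
    ← mul_assoc, ← mul_assoc, ← mul_assoc, Q.rightEq_asc_snd p s' hR₁, asc_unit_mid, mul_one,
    mul_assoc, e2, ← mul_assoc,
    Q.rightEq_ascInv_trd (Q.conv r s) p (Q.rightEq_conv_unit_left s' hR₁),
    mul_assoc, mul_assoc, ← mul_assoc (Q.asc r s p), e3, mul_assoc, ← mul_assoc]
  have c1 : ∀ x, Commute (Q.ascInv r q (Q.conv r' s') * Q.asc q r' s') (Q.conv s p x) :=
    fun x => Commute.mul_left (Q.ascInv_comm _ x) (Q.asc_comm _ x)
  have c2 : ∀ x, Commute (Q.ascInv r q (Q.conv r' s') * Q.asc q r' s') (Q.unitHom B x) :=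
    fun x => Commute.mul_left (Q.ascInv_comm _ x) (Q.asc_comm _ x)
  have h1 := Q.zigzag_three (w := w ∘ₗ LinearMap.mulLeft k
    (Q.ascInv r q (Q.conv r' s') * Q.asc q r' s')) r s p s' (hL₁.mulLeft c1 c2) (hR₂.mulLeft _)
  refine h1.trans ?_
  have h2 := Q.zigzag_four (w := w ∘ₗ LinearMap.mulRight k (Q.ascInv s p s')) r q r' s'
    (hL₂.mulRight _) (hR₁.mulRight (Q.ascInv_comm _) (Q.ascInv_comm _))
  exact h2

end

end QuasiHopfAlgebra

/-! ### Legs of tensor powers, and the forms built from S, α and β. -/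

section

variable {k : Type*} [Field k]
variable {A A' A'' B B' : Type*} [Ring A] [Algebra k A] [Ring A'] [Algebra k A'] [Ring A'']
  [Algebra k A''] [Ring B] [Algebra k B] [Ring B'] [Algebra k B']

instance Commuting.map_comp (φ : B →ₐ[k] B') (a : A →ₐ[k] B) (b : A' →ₐ[k] B) [Commuting a b] :
    Commuting (φ.comp a) (φ.comp b) := Commuting.map φ a b

instance : Commuting (Algebra.TensorProduct.includeLeft : A →ₐ[k] A ⊗[k] A')
    Algebra.TensorProduct.includeRight :=
  ⟨fun x y => by simp [Commute, SemiconjBy]⟩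

/-- The first leg of `A ⊗ A'`. -/
abbrev legL (k A A' : Type*) [Field k] [Ring A] [Algebra k A] [Ring A'] [Algebra k A'] :
    A →ₐ[k] A ⊗[k] A' := Algebra.TensorProduct.includeLeft

/-- The second leg of `A ⊗ A'`. -/
abbrev legR (k A A' : Type*) [Field k] [Ring A] [Algebra k A] [Ring A'] [Algebra k A'] :
    A' →ₐ[k] A ⊗[k] A' := Algebra.TensorProduct.includeRight

theorem pairHom_legL_legR : pairHom (legL k A A') (legR k A A') = AlgHom.id k _ := by
  ext x <;> simp

theorem comp_pairHom (φ : B →ₐ[k] B') (a : A →ₐ[k] B) (b : A' →ₐ[k] B) [Commuting a b]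
    [Commuting (φ.comp a) (φ.comp b)] :
    φ.comp (pairHom a b) = pairHom (φ.comp a) (φ.comp b) :=
  AlgHom.ext fun t => map_pairHom φ a b t

variable {W W' W'' : Type*} [AddCommGroup W] [Module k W] [AddCommGroup W'] [Module k W']
  [AddCommGroup W''] [Module k W'']

theorem LeftEq.map_left {w : B →ₗ[k] W} {a a' : A →ₐ[k] B} (h : LeftEq w a a') (w' : B' →ₗ[k] W') :
    LeftEq (TensorProduct.map w w') ((legL k B B').comp a) ((legL k B B').comp a') := by
  intro x y
  induction y using TensorProduct.induction_on with
  | zero => simp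
  | tmul y z => simp [h x y]
  | add y z hy hz => simp only [mul_add, map_add, hy, hz]

theorem LeftEq.map_right {w : B →ₗ[k] W} {a a' : A →ₐ[k] B} (h : LeftEq w a a')
    (w' : B' →ₗ[k] W') :
    LeftEq (TensorProduct.map w' w) ((legR k B' B).comp a) ((legR k B' B).comp a') := by
  intro x y
  induction y using TensorProduct.induction_on with
  | zero => simp
  | tmul y z => simp [h x z]
  | add y z hy hz => simp only [mul_add, map_add, hy, hz]

theorem RightEq.map_left {w : B →ₗ[k] W} {a a' : A →ₐ[k] B} (h : RightEq w a a')
    (w' : B' →ₗ[k] W') :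
    RightEq (TensorProduct.map w w') ((legL k B B').comp a) ((legL k B B').comp a') := by
  intro x y
  induction y using TensorProduct.induction_on with
  | zero => simp
  | tmul y z => simp [h x y]
  | add y z hy hz => simp only [add_mul, map_add, hy, hz]

theorem RightEq.map_right {w : B →ₗ[k] W} {a a' : A →ₐ[k] B} (h : RightEq w a a')
    (w' : B' →ₗ[k] W') :
    RightEq (TensorProduct.map w' w) ((legR k B' B).comp a) ((legR k B' B).comp a') := by
  intro x y
  induction y using TensorProduct.induction_on with
  | zero => simp
  | tmul y z => simp [h x z]
  | add y z hy hz => simp only [add_mul, map_add, hy, hz]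

theorem LeftEq.postcomp {w : B →ₗ[k] W} {a a' : A →ₐ[k] B} (h : LeftEq w a a') (g : W →ₗ[k] W') :
    LeftEq (g ∘ₗ w) a a' := fun x y => congrArg g (h x y)

theorem RightEq.postcomp {w : B →ₗ[k] W} {a a' : A →ₐ[k] B} (h : RightEq w a a')
    (g : W →ₗ[k] W') : RightEq (g ∘ₗ w) a a' := fun x y => congrArg g (h x y)

theorem tensor_induction_three {M N P : Type*} [AddCommGroup M] [Module k M] [AddCommGroup N]
    [Module k N] [AddCommGroup P] [Module k P] {p : M ⊗[k] (N ⊗[k] P) → Prop} (t)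
    (tmul : ∀ x y z, p (x ⊗ₜ (y ⊗ₜ z))) (add : ∀ s t, p s → p t → p (s + t)) : p t := by
  induction t using TensorProduct.induction_on with
  | zero => simpa using tmul 0 0 0
  | tmul x t =>
    induction t using TensorProduct.induction_on with
    | zero => simpa using tmul 0 0 0
    | tmul y z => exact tmul x y z
    | add s t hs ht => rw [TensorProduct.tmul_add]; exact add _ _ hs ht
  | add s t hs ht => exact add _ _ hs ht

theorem tensor_induction_four {M N P R : Type*} [AddCommGroup M] [Module k M] [AddCommGroup N]
    [Module k N] [AddCommGroup P] [Module k P] [AddCommGroup R] [Module k R]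
    {p : M ⊗[k] (N ⊗[k] (P ⊗[k] R)) → Prop} (t)
    (tmul : ∀ x y z u, p (x ⊗ₜ (y ⊗ₜ (z ⊗ₜ u)))) (add : ∀ s t, p s → p t → p (s + t)) : p t := by
  induction t using TensorProduct.induction_on with
  | zero => simpa using tmul 0 0 0 0
  | tmul x t =>
    induction t using tensor_induction_three with
    | tmul y z u => exact tmul x y z u
    | add s t hs ht => rw [TensorProduct.tmul_add]; exact add _ _ hs ht
  | add s t hs ht => exact add _ _ hs ht

theorem tensor_induction_two {M N : Type*} [AddCommGroup M] [Module k M] [AddCommGroup N]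
    [Module k N] {p : M ⊗[k] N → Prop} (t)
    (tmul : ∀ x y, p (x ⊗ₜ y)) (add : ∀ s t, p s → p t → p (s + t)) : p t := by
  induction t using TensorProduct.induction_on with
  | zero => simpa using tmul 0 0
  | tmul x t => exact tmul x t
  | add s t hs ht => exact add _ _ hs ht

end

namespace QuasiHopfAlgebra

variable {k H : Type*} [Field k] [Ring H] [Algebra k H] (Q : QuasiHopfAlgebra k H)

section

variable {B B' W : Type*} [Ring B] [Algebra k B] [Ring B'] [Algebra k B'] [AddCommGroup W]
  [Module k W]

theorem comp_conv (φ : B →ₐ[k] B') (a b : H →ₐ[k] B) [Commuting a b] :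
    φ.comp (Q.conv a b) = Q.conv (φ.comp a) (φ.comp b) :=
  AlgHom.ext fun h => map_pairHom φ a b (Q.comul h)

theorem comp_unitHom (φ : B →ₐ[k] B') : φ.comp (Q.unitHom B) = Q.unitHom B' := by
  ext h; simp [unitHom_apply]

theorem leftEq_conv_comp_left {w : B →ₗ[k] W} {W' : Type*} [AddCommGroup W'] [Module k W']
    {a b : H →ₐ[k] B} [Commuting a b] (h : LeftEq w (Q.conv a b) (Q.unitHom B))
    (w' : B' →ₗ[k] W') :
    LeftEq (TensorProduct.map w w') (Q.conv ((legL k B B').comp a) ((legL k B B').comp b))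
      (Q.unitHom (B ⊗[k] B')) := by
  rw [← comp_conv, ← Q.comp_unitHom (legL k B B')]; exact h.map_left w'

theorem leftEq_conv_comp_right {w : B →ₗ[k] W} {W' : Type*} [AddCommGroup W'] [Module k W']
    {a b : H →ₐ[k] B} [Commuting a b] (h : LeftEq w (Q.conv a b) (Q.unitHom B))
    (w' : B' →ₗ[k] W') :
    LeftEq (TensorProduct.map w' w) (Q.conv ((legR k B' B).comp a) ((legR k B' B).comp b))
      (Q.unitHom (B' ⊗[k] B)) := by
  rw [← comp_conv, ← Q.comp_unitHom (legR k B' B)]; exact h.map_right w'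

theorem rightEq_conv_comp_left {w : B →ₗ[k] W} {W' : Type*} [AddCommGroup W'] [Module k W']
    {a b : H →ₐ[k] B} [Commuting a b] (h : RightEq w (Q.conv a b) (Q.unitHom B))
    (w' : B' →ₗ[k] W') :
    RightEq (TensorProduct.map w w') (Q.conv ((legL k B B').comp a) ((legL k B B').comp b))
      (Q.unitHom (B ⊗[k] B')) := by
  rw [← comp_conv, ← Q.comp_unitHom (legL k B B')]; exact h.map_left w'

theorem rightEq_conv_comp_right {w : B →ₗ[k] W} {W' : Type*} [AddCommGroup W'] [Module k W']
    {a b : H →ₐ[k] B} [Commuting a b] (h : RightEq w (Q.conv a b) (Q.unitHom B))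
    (w' : B' →ₗ[k] W') :
    RightEq (TensorProduct.map w' w) (Q.conv ((legR k B' B).comp a) ((legR k B' B).comp b))
      (Q.unitHom (B' ⊗[k] B)) := by
  rw [← comp_conv, ← Q.comp_unitHom (legR k B' B)]; exact h.map_right w'

end

/-- The first leg of `H ⊗ H ⊗ H`. -/
abbrev leg₁ (k H : Type*) [Field k] [Ring H] [Algebra k H] : H →ₐ[k] H ⊗[k] (H ⊗[k] H) :=
  legL k H (H ⊗[k] H)

/-- The second leg of `H ⊗ H ⊗ H`. -/
abbrev leg₂ (k H : Type*) [Field k] [Ring H] [Algebra k H] : H →ₐ[k] H ⊗[k] (H ⊗[k] H) :=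
  (legR k H (H ⊗[k] H)).comp (legL k H H)

/-- The third leg of `H ⊗ H ⊗ H`. -/
abbrev leg₃ (k H : Type*) [Field k] [Ring H] [Algebra k H] : H →ₐ[k] H ⊗[k] (H ⊗[k] H) :=
  (legR k H (H ⊗[k] H)).comp (legR k H H)

theorem asc_legs : Q.asc (leg₁ k H) (leg₂ k H) (leg₃ k H) = Q.Phi := by
  have h : ∀ t, pairHom (leg₁ k H) (pairHom (leg₂ k H) (leg₃ k H)) t = t := fun t => by
    induction t using tensor_induction_three with
    | add s t hs ht => rw [map_add, hs, ht]
    | tmul x y z => simp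
  exact h _

theorem ascInv_legs : Q.ascInv (leg₁ k H) (leg₂ k H) (leg₃ k H) = Q.PhiInv := by
  have h : ∀ t, pairHom (leg₁ k H) (pairHom (leg₂ k H) (leg₃ k H)) t = t := fun t => by
    induction t using tensor_induction_three with
    | add s t hs ht => rw [map_add, hs, ht]
    | tmul x y z => simp
  exact h _

theorem map_asc {B B' : Type*} [Ring B] [Algebra k B] [Ring B'] [Algebra k B'] (φ : B →ₐ[k] B')
    (a b c : H →ₐ[k] B) [Commuting a b] [Commuting a c] [Commuting b c] :
    φ (Q.asc a b c) = Q.asc (φ.comp a) (φ.comp b) (φ.comp c) := by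
  rw [asc, map_pairHom]
  simp only [comp_pairHom]
  rfl

theorem map_ascInv {B B' : Type*} [Ring B] [Algebra k B] [Ring B'] [Algebra k B'] (φ : B →ₐ[k] B')
    (a b c : H →ₐ[k] B) [Commuting a b] [Commuting a c] [Commuting b c] :
    φ (Q.ascInv a b c) = Q.ascInv (φ.comp a) (φ.comp b) (φ.comp c) := by
  rw [ascInv, map_pairHom]
  simp only [comp_pairHom]
  rfl

theorem sandwichLeft_comul (h : H) : sandwichLeft Q.S Q.alpha (Q.comul h) = Q.counit h • Q.alpha :=
  Q.antipode_alpha h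

theorem sandwichRight_comul (h : H) : sandwichRight Q.S Q.beta (Q.comul h) = Q.counit h • Q.beta :=
  Q.beta_antipode h

/-- As S reverses products, a factor at the left end of the argument lands next to α, where the
antipode axiom applies. For β it is the factor at the right end, which is why contractions with α
are left ones and contractions with β are right ones. -/
theorem leftEq_sandwichLeft : LeftEq (sandwichLeft Q.S Q.alpha)
    (Q.conv (legL k H H) (legR k H H)) (Q.unitHom _) := by
  intro h y
  rw [conv_apply, pairHom_legL_legR, AlgHom.id_apply, unitHom_apply, ← Algebra.smul_def, map_smul]
  induction y using tensor_induction_two with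
  | add s t hs ht => simp only [mul_add, map_add, smul_add, hs, ht]
  | tmul a b =>
    have : ∀ d : H ⊗[k] H, sandwichLeft Q.S Q.alpha (d * a ⊗ₜ b) =
        Q.S a * sandwichLeft Q.S Q.alpha d * b := by
      intro d
      induction d using tensor_induction_two with
      | add s t hs ht => simp only [add_mul, mul_add, map_add, hs, ht]
      | tmul x y => simp [sandwichLeft_tmul, Q.S_mul, mul_assoc]
    rw [this, sandwichLeft_comul, sandwichLeft_tmul]
    simp

theorem rightEq_sandwichRight : RightEq (sandwichRight Q.S Q.beta)
    (Q.conv (legL k H H) (legR k H H)) (Q.unitHom _) := by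
  intro h y
  rw [conv_apply, pairHom_legL_legR, AlgHom.id_apply, unitHom_apply, ← Algebra.commutes,
    ← Algebra.smul_def, map_smul]
  induction y using tensor_induction_two with
  | add s t hs ht => simp only [add_mul, map_add, smul_add, hs, ht]
  | tmul a b =>
    have : ∀ d : H ⊗[k] H, sandwichRight Q.S Q.beta (a ⊗ₜ b * d) =
        a * sandwichRight Q.S Q.beta d * Q.S b := by
      intro d
      induction d using tensor_induction_two with
      | add s t hs ht => simp only [add_mul, mul_add, map_add, hs, ht]
      | tmul x y => simp [sandwichRight_tmul, Q.S_mul, mul_assoc]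
    rw [this, sandwichRight_comul, sandwichRight_tmul]
    simp

/-- The map `x ⊗ y ⊗ z ↦ x β S(y) α z`. -/
def betaAlpha : H ⊗[k] (H ⊗[k] H) →ₗ[k] H :=
  LinearMap.mul' k H ∘ₗ TensorProduct.map (LinearMap.mulRight k Q.beta) (sandwichLeft Q.S Q.alpha)

theorem betaAlpha_tmul (x y z : H) :
    Q.betaAlpha (x ⊗ₜ (y ⊗ₜ z)) = x * Q.beta * (Q.S y * Q.alpha * z) := by
  simp [betaAlpha, sandwichLeft_tmul]

theorem betaAlpha_Phi : Q.betaAlpha Q.Phi = 1 := Q.beta_alpha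

/-- The map `x ⊗ y ⊗ z ↦ S(x) α y β S(z)`. -/
def alphaBeta : H ⊗[k] (H ⊗[k] H) →ₗ[k] H :=
  sandwichLeft Q.S Q.alpha ∘ₗ TensorProduct.map LinearMap.id (sandwichRight Q.S Q.beta)

theorem alphaBeta_tmul (x y z : H) :
    Q.alphaBeta (x ⊗ₜ (y ⊗ₜ z)) = Q.S x * Q.alpha * (y * Q.beta * Q.S z) := by
  simp [alphaBeta, sandwichLeft_tmul, sandwichRight_tmul]

theorem alphaBeta_PhiInv : Q.alphaBeta Q.PhiInv = 1 := Q.alpha_beta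

theorem leftEq_betaAlpha : LeftEq Q.betaAlpha (Q.conv (leg₂ k H) (leg₃ k H)) (Q.unitHom _) :=
  (Q.leftEq_conv_comp_right Q.leftEq_sandwichLeft _).postcomp _

theorem rightEq_betaAlpha : RightEq Q.betaAlpha (Q.conv (leg₁ k H) (leg₂ k H)) (Q.unitHom _) := by
  intro h y
  rw [unitHom_apply, ← Algebra.commutes, ← Algebra.smul_def, map_smul, conv_apply]
  induction y using tensor_induction_three with
  | add s t hs ht => simp only [add_mul, map_add, smul_add, hs, ht]
  | tmul a b c =>
    have : ∀ d : H ⊗[k] H, Q.betaAlpha (a ⊗ₜ (b ⊗ₜ c) * pairHom (leg₁ k H) (leg₂ k H) d) =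
        a * sandwichRight Q.S Q.beta d * Q.S b * Q.alpha * c := by
      intro d
      induction d using tensor_induction_two with
      | add s t hs ht => simp only [add_mul, mul_add, map_add, hs, ht]
      | tmul x y => simp [betaAlpha_tmul, sandwichRight_tmul, Q.S_mul, mul_assoc]
    rw [this, sandwichRight_comul, betaAlpha_tmul]
    simp [mul_assoc]

theorem rightEq_alphaBeta : RightEq Q.alphaBeta (Q.conv (leg₂ k H) (leg₃ k H)) (Q.unitHom _) :=
  (Q.rightEq_conv_comp_right Q.rightEq_sandwichRight _).postcomp _

theorem leftEq_alphaBeta : LeftEq Q.alphaBeta (Q.conv (leg₁ k H) (leg₂ k H)) (Q.unitHom _) := by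
  intro h y
  rw [unitHom_apply, ← Algebra.smul_def, map_smul, conv_apply]
  induction y using tensor_induction_three with
  | add s t hs ht => simp only [mul_add, map_add, smul_add, hs, ht]
  | tmul a b c =>
    have : ∀ d : H ⊗[k] H, Q.alphaBeta (pairHom (leg₁ k H) (leg₂ k H) d * a ⊗ₜ (b ⊗ₜ c)) =
        Q.S a * sandwichLeft Q.S Q.alpha d * b * Q.beta * Q.S c := by
      intro d
      induction d using tensor_induction_two with
      | add s t hs ht => simp only [add_mul, mul_add, map_add, hs, ht]
      | tmul x y => simp [alphaBeta_tmul, sandwichLeft_tmul, Q.S_mul, mul_assoc]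
    rw [this, sandwichLeft_comul, alphaBeta_tmul]
    simp [mul_assoc]

theorem flipS_tmul (a b : H) : Q.flipS (a ⊗ₜ b) = Q.S b ⊗ₜ Q.S a := by simp [flipS]

theorem flipS_mul (s t : H ⊗[k] H) : Q.flipS (s * t) = Q.flipS t * Q.flipS s := by
  induction s using tensor_induction_two with
  | add s t hs ht => simp only [add_mul, mul_add, map_add, hs, ht]
  | tmul x y =>
    induction t using tensor_induction_two with
    | add s t hs ht => simp only [add_mul, mul_add, map_add, hs, ht]
    | tmul a b => simp [flipS_tmul, Q.S_mul]

theorem flipS_one : Q.flipS 1 = 1 := by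
  rw [Algebra.TensorProduct.one_def, flipS_tmul, Q.S_one]

/-- The antihomomorphism `h ↦ S(h₂) ⊗ S(h₁)`. -/
def coS : H →ₗ[k] H ⊗[k] H := Q.flipS ∘ₗ Q.comul.toLinearMap

theorem coS_apply (h : H) : Q.coS h = Q.flipS (Q.comul h) := rfl

theorem coS_mul (a b : H) : Q.coS (a * b) = Q.coS b * Q.coS a := by
  simp [coS_apply, flipS_mul]

theorem coS_one : Q.coS 1 = 1 := by simp [coS_apply, flipS_one]

end QuasiHopfAlgebra

/-! ### The elements γ and δ as α and β of a tensor product. -/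

namespace QuasiHopfAlgebra

variable {k H : Type*} [Field k] [Ring H] [Algebra k H] (Q : QuasiHopfAlgebra k H)

section FourLegs

variable (k H)

/-- The first leg of `H ⊗ H ⊗ H ⊗ H`. -/
abbrev quadLeg₁ : H →ₐ[k] H ⊗[k] (H ⊗[k] (H ⊗[k] H)) := legL k H _

/-- The second leg of `H ⊗ H ⊗ H ⊗ H`. -/
abbrev quadLeg₂ : H →ₐ[k] H ⊗[k] (H ⊗[k] (H ⊗[k] H)) := (legR k H _).comp (leg₁ k H)

/-- The third leg of `H ⊗ H ⊗ H ⊗ H`. -/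
abbrev quadLeg₃ : H →ₐ[k] H ⊗[k] (H ⊗[k] (H ⊗[k] H)) := (legR k H _).comp (leg₂ k H)

/-- The fourth leg of `H ⊗ H ⊗ H ⊗ H`. -/
abbrev quadLeg₄ : H →ₐ[k] H ⊗[k] (H ⊗[k] (H ⊗[k] H)) := (legR k H _).comp (leg₃ k H)

end FourLegs

theorem pairHom_quadLegs (t : H ⊗[k] (H ⊗[k] (H ⊗[k] H))) :
    pairHom (quadLeg₁ k H) (pairHom (quadLeg₂ k H) (pairHom (quadLeg₃ k H) (quadLeg₄ k H))) t =
      t := by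
  induction t using tensor_induction_four with
  | add s t hs ht => rw [map_add, hs, ht]
  | tmul x y z u => simp

theorem tensorOne_eq (t : H ⊗[k] (H ⊗[k] H)) : tensorOne H t =
    pairHom (quadLeg₁ k H) (pairHom (quadLeg₂ k H) (quadLeg₃ k H)) t := by
  induction t using tensor_induction_three with
  | add s t hs ht => simp only [map_add, hs, ht]
  | tmul x y z => simp [tensorOne]

theorem comulFirst_eq (t : H ⊗[k] (H ⊗[k] H)) : comulFirst Q.comul (H ⊗[k] H) t =
    pairHom (Q.conv (quadLeg₁ k H) (quadLeg₂ k H)) (pairHom (quadLeg₃ k H) (quadLeg₄ k H)) t := by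
  rw [← pairHom_comulFirst, pairHom_quadLegs]

theorem gamma_eq : Q.gamma = Q.gammaAux
    (Q.asc (quadLeg₁ k H) (quadLeg₂ k H) (quadLeg₃ k H) *
      Q.ascInv (Q.conv (quadLeg₁ k H) (quadLeg₂ k H)) (quadLeg₃ k H) (quadLeg₄ k H)) := by
  rw [gamma, tensorOne_eq, comulFirst_eq]; rfl

theorem delta_eq : Q.delta = Q.deltaAux
    (Q.asc (Q.conv (quadLeg₁ k H) (quadLeg₂ k H)) (quadLeg₃ k H) (quadLeg₄ k H) *
      Q.ascInv (quadLeg₁ k H) (quadLeg₂ k H) (quadLeg₃ k H)) := by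
  rw [delta, tensorOne_eq, comulFirst_eq]; rfl

theorem gammaAux_mul (t : H ⊗[k] (H ⊗[k] (H ⊗[k] H))) (d e : H ⊗[k] H) :
    Q.gammaAux (t * (pairHom (quadLeg₁ k H) (quadLeg₂ k H) d *
      pairHom (quadLeg₃ k H) (quadLeg₄ k H) e)) = Q.flipS d * Q.gammaAux t * e := by
  induction t using tensor_induction_four with
  | add s t hs ht => simp only [add_mul, mul_add, map_add, hs, ht]
  | tmul x y z u =>
  induction d using tensor_induction_two with
  | add s t hs ht => simp only [add_mul, mul_add, map_add, hs, ht]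
  | tmul a b =>
  induction e using tensor_induction_two with
  | add s t hs ht => simp only [mul_add, map_add, hs, ht]
  | tmul a' b' => simp [gammaAux_tmul, flipS_tmul, Q.S_mul, mul_assoc]

theorem deltaAux_mul (t : H ⊗[k] (H ⊗[k] (H ⊗[k] H))) (d e : H ⊗[k] H) :
    Q.deltaAux (pairHom (quadLeg₁ k H) (quadLeg₂ k H) d *
      pairHom (quadLeg₃ k H) (quadLeg₄ k H) e * t) = d * Q.deltaAux t * Q.flipS e := by
  induction t using tensor_induction_four with
  | add s t hs ht => simp only [add_mul, mul_add, map_add, hs, ht]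
  | tmul x y z u =>
  induction d using tensor_induction_two with
  | add s t hs ht => simp only [add_mul, map_add, hs, ht]
  | tmul a b =>
  induction e using tensor_induction_two with
  | add s t hs ht => simp only [add_mul, mul_add, map_add, hs, ht]
  | tmul a' b' => simp [deltaAux_tmul, flipS_tmul, Q.S_mul, mul_assoc]

theorem leftEq_gammaAux_mid : LeftEq Q.gammaAux (Q.conv (quadLeg₂ k H) (quadLeg₃ k H))
    (Q.unitHom (H ⊗[k] (H ⊗[k] (H ⊗[k] H)))) := by
  intro h y
  rw [unitHom_apply, ← Algebra.smul_def, map_smul, conv_apply]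
  induction y using tensor_induction_four with
  | add s t hs ht => simp only [mul_add, map_add, smul_add, hs, ht]
  | tmul a b c e =>
    have : ∀ d : H ⊗[k] H, Q.gammaAux (pairHom (quadLeg₂ k H) (quadLeg₃ k H) d *
        a ⊗ₜ (b ⊗ₜ (c ⊗ₜ e))) =
        (Q.S b * sandwichLeft Q.S Q.alpha d * c) ⊗ₜ (Q.S a * Q.alpha * e) := by
      intro d
      induction d using tensor_induction_two with
      | add s t hs ht => simp only [add_mul, mul_add, map_add, TensorProduct.add_tmul, hs, ht]
      | tmul x y => simp [gammaAux_tmul, sandwichLeft_tmul, Q.S_mul, mul_assoc]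
    rw [this, sandwichLeft_comul, gammaAux_tmul]
    simp [TensorProduct.smul_tmul']

theorem leftEq_gammaAux_outer : LeftEq Q.gammaAux (Q.conv (quadLeg₁ k H) (quadLeg₄ k H))
    (Q.unitHom (H ⊗[k] (H ⊗[k] (H ⊗[k] H)))) := by
  intro h y
  rw [unitHom_apply, ← Algebra.smul_def, map_smul, conv_apply]
  induction y using tensor_induction_four with
  | add s t hs ht => simp only [mul_add, map_add, smul_add, hs, ht]
  | tmul a b c e =>
    have : ∀ d : H ⊗[k] H, Q.gammaAux (pairHom (quadLeg₁ k H) (quadLeg₄ k H) d *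
        a ⊗ₜ (b ⊗ₜ (c ⊗ₜ e))) =
        (Q.S b * Q.alpha * c) ⊗ₜ (Q.S a * sandwichLeft Q.S Q.alpha d * e) := by
      intro d
      induction d using tensor_induction_two with
      | add s t hs ht => simp only [add_mul, mul_add, map_add, TensorProduct.tmul_add, hs, ht]
      | tmul x y => simp [gammaAux_tmul, sandwichLeft_tmul, Q.S_mul, mul_assoc]
    rw [this, sandwichLeft_comul, gammaAux_tmul]
    simp [TensorProduct.tmul_smul]

theorem rightEq_deltaAux_mid : RightEq Q.deltaAux (Q.conv (quadLeg₂ k H) (quadLeg₃ k H))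
    (Q.unitHom (H ⊗[k] (H ⊗[k] (H ⊗[k] H)))) := by
  intro h y
  rw [unitHom_apply, ← Algebra.commutes, ← Algebra.smul_def, map_smul, conv_apply]
  induction y using tensor_induction_four with
  | add s t hs ht => simp only [add_mul, map_add, smul_add, hs, ht]
  | tmul a b c e =>
    have : ∀ d : H ⊗[k] H, Q.deltaAux (a ⊗ₜ (b ⊗ₜ (c ⊗ₜ e)) *
        pairHom (quadLeg₂ k H) (quadLeg₃ k H) d) =
        (a * Q.beta * Q.S e) ⊗ₜ (b * sandwichRight Q.S Q.beta d * Q.S c) := by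
      intro d
      induction d using tensor_induction_two with
      | add s t hs ht => simp only [add_mul, mul_add, map_add, TensorProduct.tmul_add, hs, ht]
      | tmul x y => simp [deltaAux_tmul, sandwichRight_tmul, Q.S_mul, mul_assoc]
    rw [this, sandwichRight_comul, deltaAux_tmul]
    simp [TensorProduct.tmul_smul]

theorem rightEq_deltaAux_outer : RightEq Q.deltaAux (Q.conv (quadLeg₁ k H) (quadLeg₄ k H))
    (Q.unitHom (H ⊗[k] (H ⊗[k] (H ⊗[k] H)))) := by
  intro h y
  rw [unitHom_apply, ← Algebra.commutes, ← Algebra.smul_def, map_smul, conv_apply]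
  induction y using tensor_induction_four with
  | add s t hs ht => simp only [add_mul, map_add, smul_add, hs, ht]
  | tmul a b c e =>
    have : ∀ d : H ⊗[k] H, Q.deltaAux (a ⊗ₜ (b ⊗ₜ (c ⊗ₜ e)) *
        pairHom (quadLeg₁ k H) (quadLeg₄ k H) d) =
        (a * sandwichRight Q.S Q.beta d * Q.S e) ⊗ₜ (b * Q.beta * Q.S c) := by
      intro d
      induction d using tensor_induction_two with
      | add s t hs ht => simp only [add_mul, mul_add, map_add, TensorProduct.add_tmul, hs, ht]
      | tmul x y => simp [deltaAux_tmul, sandwichRight_tmul, Q.S_mul, mul_assoc]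
    rw [this, sandwichRight_comul, deltaAux_tmul]
    simp [TensorProduct.smul_tmul']

/-- The map `a ⊗ b ↦ S(a₂) γ₁ b₁ ⊗ S(a₁) γ₂ b₂`. -/
def gammaForm : H ⊗[k] H →ₗ[k] H ⊗[k] H :=
  LinearMap.mul' k (H ⊗[k] H) ∘ₗ
    TensorProduct.map (LinearMap.mulRight k Q.gamma ∘ₗ Q.coS) Q.comul.toLinearMap

theorem gammaForm_tmul (a b : H) : Q.gammaForm (a ⊗ₜ b) = Q.coS a * Q.gamma * Q.comul b := by
  simp [gammaForm]

/-- The map `a ⊗ b ↦ a₁ δ₁ S(b₂) ⊗ a₂ δ₂ S(b₁)`. -/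
def deltaForm : H ⊗[k] H →ₗ[k] H ⊗[k] H :=
  LinearMap.mul' k (H ⊗[k] H) ∘ₗ
    TensorProduct.map (LinearMap.mulRight k Q.delta ∘ₗ Q.comul.toLinearMap) Q.coS

theorem deltaForm_tmul (a b : H) : Q.deltaForm (a ⊗ₜ b) = Q.comul a * Q.delta * Q.coS b := by
  simp [deltaForm]

/-- γ satisfies for Δ the axiom that α satisfies for H. The iterated coproduct of h is carried to
the left end through the reassociators that define γ, rebracketed so that first the inner legs 2 and
3 and then the outer legs 1 and 4 contract against the two copies of α. -/
theorem gammaForm_comul (h : H) : Q.gammaForm (Q.comul h) = Q.counit h • Q.gamma := by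
  have h1 : ∀ t : H ⊗[k] H, Q.gammaForm t = Q.gammaAux
      (Q.asc (quadLeg₁ k H) (quadLeg₂ k H) (quadLeg₃ k H) *
        Q.ascInv (Q.conv (quadLeg₁ k H) (quadLeg₂ k H)) (quadLeg₃ k H) (quadLeg₄ k H) *
      pairHom (Q.conv (quadLeg₁ k H) (quadLeg₂ k H)) (Q.conv (quadLeg₃ k H) (quadLeg₄ k H)) t) := by
    intro t
    induction t using tensor_induction_two with
    | add s t hs ht => simp only [mul_add, map_add, hs, ht]
    | tmul a b => rw [pairHom_tmul, conv_apply, conv_apply, gammaAux_mul, gammaForm_tmul, gamma_eq,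
        coS_apply]
  rw [h1, ← conv_apply, mul_assoc, ← conv_ascInv, ← mul_assoc,
    Q.conv_intertwine (a' := Q.conv (quadLeg₁ k H) (Q.conv (quadLeg₂ k H) (quadLeg₃ k H)))
      (fun x => (Q.conv_asc _ _ _ x).symm) (Q.asc_comm _), mul_assoc,
    Q.leftEq_conv_left (quadLeg₄ k H)
      (Q.leftEq_conv_unit_right (quadLeg₁ k H) Q.leftEq_gammaAux_mid),
    Q.leftEq_gammaAux_outer, unitHom_apply, ← Algebra.smul_def, map_smul, ← gamma_eq]

/-- The mirror image for β: the coproduct is carried to the right end, where the inner and then the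
outer pair contract. -/
theorem deltaForm_comul (h : H) : Q.deltaForm (Q.comul h) = Q.counit h • Q.delta := by
  have h1 : ∀ t : H ⊗[k] H, Q.deltaForm t = Q.deltaAux
      (pairHom (Q.conv (quadLeg₁ k H) (quadLeg₂ k H)) (Q.conv (quadLeg₃ k H) (quadLeg₄ k H)) t *
      (Q.asc (Q.conv (quadLeg₁ k H) (quadLeg₂ k H)) (quadLeg₃ k H) (quadLeg₄ k H) *
        Q.ascInv (quadLeg₁ k H) (quadLeg₂ k H) (quadLeg₃ k H))) := by
    intro t
    induction t using tensor_induction_two with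
    | add s t hs ht => simp only [add_mul, map_add, hs, ht]
    | tmul a b => rw [pairHom_tmul, conv_apply, conv_apply, deltaAux_mul, deltaForm_tmul, delta_eq,
        coS_apply]
  rw [h1, ← conv_apply, ← mul_assoc, conv_asc, mul_assoc,
    ← Q.conv_intertwine (a := Q.conv (quadLeg₁ k H) (Q.conv (quadLeg₂ k H) (quadLeg₃ k H)))
      (fun x => (Q.conv_ascInv _ _ _ x).symm) (Q.ascInv_comm _), ← mul_assoc,
    Q.rightEq_conv_left (quadLeg₄ k H)
      (Q.rightEq_conv_unit_right (quadLeg₁ k H) Q.rightEq_deltaAux_mid),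
    Q.rightEq_deltaAux_outer, unitHom_apply, ← Algebra.commutes, ← Algebra.smul_def, map_smul,
    ← delta_eq]

theorem gammaForm_mul (t : H ⊗[k] H) (a b : H) :
    Q.gammaForm (t * (a ⊗ₜ b)) = Q.coS a * Q.gammaForm t * Q.comul b := by
  induction t using tensor_induction_two with
  | add s t hs ht => simp only [add_mul, mul_add, map_add, hs, ht]
  | tmul x y => simp [gammaForm_tmul, coS_mul, mul_assoc]

theorem deltaForm_mul (t : H ⊗[k] H) (a b : H) :
    Q.deltaForm ((a ⊗ₜ b) * t) = Q.comul a * Q.deltaForm t * Q.coS b := by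
  induction t using tensor_induction_two with
  | add s t hs ht => simp only [add_mul, mul_add, map_add, hs, ht]
  | tmul x y => simp [deltaForm_tmul, coS_mul, mul_assoc]

end QuasiHopfAlgebra

/-! ### Exchange rules for p_R and q_L, and the intertwining properties of f and f⁻¹. -/

namespace QuasiHopfAlgebra

variable {k H : Type*} [Field k] [Ring H] [Algebra k H] (Q : QuasiHopfAlgebra k H)

/-- The twist is the value at p_R of a form that absorbs coproducts, so that its properties are
instances of general facts about p_R. Likewise f⁻¹ is a value at q_L. -/
theorem f_eq : Q.f = Q.gammaForm Q.pR := by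
  rw [f, gammaForm, pR, ← LinearMap.comp_apply, LinearMap.comp_apply, LinearMap.comp_apply,
    ← LinearMap.comp_apply (TensorProduct.map _ Q.comul.toLinearMap), ← TensorProduct.map_comp]
  rfl

theorem fInv_eq : Q.fInv = Q.deltaForm Q.qL := by
  rw [fInv, deltaForm, qL, LinearMap.comp_apply,
    ← LinearMap.comp_apply (TensorProduct.map _ Q.coS), ← TensorProduct.map_comp]
  rfl

theorem sandwichRight_legL_mul (h : H) (y : H ⊗[k] H) :
    sandwichRight Q.S Q.beta (legL k H H h * y) = h * sandwichRight Q.S Q.beta y := by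
  induction y using tensor_induction_two with
  | add s t hs ht => simp only [mul_add, map_add, hs, ht]
  | tmul a b => simp [sandwichRight_tmul, mul_assoc]

theorem sandwichLeft_mul_legR (h : H) (y : H ⊗[k] H) :
    sandwichLeft Q.S Q.alpha (y * legR k H H h) = sandwichLeft Q.S Q.alpha y * h := by
  induction y using tensor_induction_two with
  | add s t hs ht => simp only [add_mul, map_add, hs, ht]
  | tmul a b => simp [sandwichLeft_tmul, mul_assoc]

theorem sandwichLeft_mul_legL (h : H) (y : H ⊗[k] H) :
    sandwichLeft Q.S Q.alpha (y * legL k H H h) = Q.S h * sandwichLeft Q.S Q.alpha y := by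
  induction y using tensor_induction_two with
  | add s t hs ht => simp only [mul_add, add_mul, map_add, hs, ht]
  | tmul a b => simp [sandwichLeft_tmul, mul_assoc, Q.S_mul]

theorem betaAlpha_leg₁_mul (h : H) (y : H ⊗[k] (H ⊗[k] H)) :
    Q.betaAlpha (leg₁ k H h * y) = h * Q.betaAlpha y := by
  induction y using tensor_induction_three with
  | add s t hs ht => simp only [mul_add, map_add, hs, ht]
  | tmul a b c => simp [betaAlpha_tmul, mul_assoc]

theorem betaAlpha_mul_leg₃ (h : H) (y : H ⊗[k] (H ⊗[k] H)) :
    Q.betaAlpha (y * leg₃ k H h) = Q.betaAlpha y * h := by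
  induction y using tensor_induction_three with
  | add s t hs ht => simp only [add_mul, map_add, hs, ht]
  | tmul a b c => simp [betaAlpha_tmul, mul_assoc]

section

variable {B W : Type*} [Ring B] [Algebra k B] [AddCommGroup W] [Module k W]

/-- The map ψ turns left multiplication by `g h` into left multiplication by h, so the contraction
performed by F is not affected when its second argument is first produced by ψ. -/
theorem leftEq_map_id {F : H ⊗[k] H →ₗ[k] W}
    (hF : LeftEq F (Q.conv (legL k H H) (legR k H H)) (Q.unitHom _)) (ψ : B →ₗ[k] H)
    (g : H →ₐ[k] B) (hψ : ∀ h y, ψ (g h * y) = h * ψ y) :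
    LeftEq (F ∘ₗ TensorProduct.map LinearMap.id ψ)
      (Q.conv (legL k H B) ((legR k H B).comp g)) (Q.unitHom _) := by
  intro h y
  have e : ∀ d : H ⊗[k] H, TensorProduct.map LinearMap.id ψ
      (pairHom (legL k H B) ((legR k H B).comp g) d * y) =
      d * TensorProduct.map LinearMap.id ψ y := by
    intro d
    induction y using tensor_induction_two with
    | add s t hs ht => simp only [mul_add, map_add, hs, ht]
    | tmul a b =>
      induction d using tensor_induction_two with
      | add s t hs ht => simp only [add_mul, map_add, hs, ht]
      | tmul x y => simp [hψ]
  have hF' := hF h (TensorProduct.map LinearMap.id ψ y)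
  rw [conv_apply, pairHom_legL_legR, AlgHom.id_apply, unitHom_apply, ← Algebra.smul_def] at hF'
  rw [conv_apply, LinearMap.comp_apply, e, hF', unitHom_apply, ← Algebra.smul_def, map_smul,
    map_smul, LinearMap.comp_apply]

theorem rightEq_map_id {G : H ⊗[k] H →ₗ[k] W}
    (hG : RightEq G (Q.conv (legL k H H) (legR k H H)) (Q.unitHom _)) (ψ : B →ₗ[k] H)
    (g : H →ₐ[k] B) (hψ : ∀ h y, ψ (y * g h) = ψ y * h) :
    RightEq (G ∘ₗ TensorProduct.map ψ LinearMap.id)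
      (Q.conv ((legL k B H).comp g) (legR k B H)) (Q.unitHom _) := by
  intro h y
  have e : ∀ d : H ⊗[k] H, TensorProduct.map ψ LinearMap.id
      (y * pairHom ((legL k B H).comp g) (legR k B H) d) =
      TensorProduct.map ψ LinearMap.id y * d := by
    intro d
    induction y using tensor_induction_two with
    | add s t hs ht => simp only [add_mul, map_add, hs, ht]
    | tmul a b =>
      induction d using tensor_induction_two with
      | add s t hs ht => simp only [mul_add, map_add, hs, ht]
      | tmul x y => simp [hψ]
  have hG' := hG h (TensorProduct.map ψ LinearMap.id y)
  rw [conv_apply, pairHom_legL_legR, AlgHom.id_apply, unitHom_apply, ← Algebra.commutes,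
    ← Algebra.smul_def] at hG'
  rw [conv_apply, LinearMap.comp_apply, e, hG', unitHom_apply, ← Algebra.commutes,
    ← Algebra.smul_def, map_smul, map_smul, LinearMap.comp_apply]

/-- A form `F` with `F(h₁ y¹ ⊗ h₂ y²) = ε(h) F(y)` satisfies `F(p¹ ⊗ p² α) = F(1 ⊗ 1)`. -/
theorem pR_mul_alpha {F : H ⊗[k] H →ₗ[k] W}
    (hF : LeftEq F (Q.conv (legL k H H) (legR k H H)) (Q.unitHom _)) :
    F (Q.pR * (1 ⊗ₜ Q.alpha)) = F 1 := by
  have hL := Q.leftEq_map_id hF Q.betaAlpha (leg₁ k H) Q.betaAlpha_leg₁_mul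
  have hL' := (Q.leftEq_conv_comp_right Q.leftEq_betaAlpha (LinearMap.id : H →ₗ[k] H)).postcomp F
  have hR' := (Q.rightEq_conv_comp_right Q.rightEq_betaAlpha (LinearMap.id : H →ₗ[k] H)).postcomp F
  -- The form is x ⊗ y ⊗ z ⊗ t ↦ F(x ⊗ yβS(z)αt). Legs 1 and 2 contract as well, so the left side of
  -- the zigzag reduces to Φ⁻¹ in the first three legs, that is, to p_R times 1 ⊗ α. On the right
  -- side Φ sits in the last three legs and gives X¹βS(X²)αX³ = 1.
  have h := Q.zigzag_two (quadLeg₁ k H) (quadLeg₂ k H) (quadLeg₃ k H) (quadLeg₄ k H) hL' hR'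
  rw [Q.leftEq_asc_fst (quadLeg₃ k H) (quadLeg₄ k H) hL, asc_unit_left, one_mul] at h
  have h1 : ∀ t, TensorProduct.map LinearMap.id Q.betaAlpha
      (pairHom (quadLeg₁ k H) (pairHom (quadLeg₂ k H) (quadLeg₃ k H)) t) =
      TensorProduct.map LinearMap.id (sandwichRight Q.S Q.beta) t * (1 ⊗ₜ Q.alpha) := by
    intro t
    induction t using tensor_induction_three with
    | add s t hs ht => simp only [map_add, add_mul, hs, ht]
    | tmul a b c => simp [betaAlpha_tmul, sandwichRight_tmul, mul_assoc]
  have h2 : Q.asc (quadLeg₂ k H) (quadLeg₃ k H) (quadLeg₄ k H) = 1 ⊗ₜ Q.Phi := by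
    rw [← map_asc (φ := legR k H (H ⊗[k] (H ⊗[k] H))), asc_legs]; rfl
  rw [ascInv, LinearMap.comp_apply, h1, h2, LinearMap.comp_apply, TensorProduct.map_tmul,
    betaAlpha_Phi] at h
  exact h

/-- A form `F` with `F(h₁ y¹ ⊗ h₂ y²) = ε(h) F(y)` satisfies `F(p¹ h ⊗ p²) = F(p¹ ⊗ p² S(h))`. -/
theorem pR_mul_left {F : H ⊗[k] H →ₗ[k] W}
    (hF : LeftEq F (Q.conv (legL k H H) (legR k H H)) (Q.unitHom _)) (h : H) :
    F (Q.pR * (h ⊗ₜ 1)) = F (Q.pR * (1 ⊗ₜ Q.S h)) := by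
  have hL := Q.leftEq_map_id hF (sandwichRight Q.S Q.beta) (legL k H H) Q.sandwichRight_legL_mul
  have hR := (Q.rightEq_conv_comp_right Q.rightEq_sandwichRight
    (LinearMap.id : H →ₗ[k] H)).postcomp F
  -- The two iterated coproducts of h on either side of Φ⁻¹ are compared. At the left end F absorbs
  -- the first two legs and only the third survives, giving S(h); at the right end β absorbs the
  -- last two and only the first survives, giving h.
  have e := Q.conv_ascInv (leg₁ k H) (leg₂ k H) (leg₃ k H) h
  have e1 := Q.leftEq_conv_unit_left (leg₃ k H) hL h (Q.ascInv (leg₁ k H) (leg₂ k H) (leg₃ k H))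
  have e2 := Q.rightEq_conv_unit_right (leg₁ k H) hR h (Q.ascInv (leg₁ k H) (leg₂ k H) (leg₃ k H))
  have h1 : ∀ t, TensorProduct.map LinearMap.id (sandwichRight Q.S Q.beta)
      (leg₃ k H h * t) = TensorProduct.map LinearMap.id
        (sandwichRight Q.S Q.beta) t * (1 ⊗ₜ Q.S h) := by
    intro t
    induction t using tensor_induction_three with
    | add s t hs ht => simp only [map_add, mul_add, add_mul, hs, ht]
    | tmul a b c => simp [sandwichRight_tmul, mul_assoc, Q.S_mul]
  have h2 : ∀ t, TensorProduct.map LinearMap.id (sandwichRight Q.S Q.beta)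
      (t * leg₁ k H h) = TensorProduct.map LinearMap.id
        (sandwichRight Q.S Q.beta) t * (h ⊗ₜ 1) := by
    intro t
    induction t using tensor_induction_three with
    | add s t hs ht => simp only [map_add, add_mul, hs, ht]
    | tmul a b c => simp [sandwichRight_tmul]
  rw [LinearMap.comp_apply, LinearMap.comp_apply] at e1 e2
  rw [pR, ← ascInv_legs, ← h2, ← h1, ← e1, ← e2, e]

theorem ascInv_legs_left : Q.ascInv ((legL k (H ⊗[k] H) H).comp (legL k H H))
    ((legL k (H ⊗[k] H) H).comp (legR k H H)) (legR k (H ⊗[k] H) H) =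
    (TensorProduct.assoc k H H H).symm Q.PhiInv := by
  have h : ∀ t : H ⊗[k] (H ⊗[k] H), pairHom ((legL k (H ⊗[k] H) H).comp (legL k H H))
      (pairHom ((legL k (H ⊗[k] H) H).comp (legR k H H)) (legR k (H ⊗[k] H) H)) t =
      (TensorProduct.assoc k H H H).symm t := by
    intro t
    induction t using tensor_induction_three with
    | add s t hs ht => simp only [map_add, hs, ht]
    | tmul a b c => simp
  exact h _

/-- A form `G` with `G(y¹ h₁ ⊗ y² h₂) = ε(h) G(y)` satisfies `G(β q̃¹ ⊗ q̃²) = G(1 ⊗ 1)`. -/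
theorem beta_mul_qL {G : H ⊗[k] H →ₗ[k] W}
    (hG : RightEq G (Q.conv (legL k H H) (legR k H H)) (Q.unitHom _)) :
    G ((Q.beta ⊗ₜ 1) * Q.qL) = G 1 := by
  have hR := Q.rightEq_map_id hG Q.betaAlpha (leg₃ k H) Q.betaAlpha_mul_leg₃
  have hL' := (Q.leftEq_conv_comp_left Q.leftEq_betaAlpha (LinearMap.id : H →ₗ[k] H)).postcomp G
  have hR' := (Q.rightEq_conv_comp_left Q.rightEq_betaAlpha (LinearMap.id : H →ₗ[k] H)).postcomp G
  have h := Q.zigzag_one ((legL k _ H).comp (leg₁ k H)) ((legL k _ H).comp (leg₂ k H))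
    ((legL k _ H).comp (leg₃ k H)) (legR k _ H) hL' hR'
  rw [Q.rightEq_asc_trd _ _ hR, asc_unit_right, mul_one] at h
  have h1 : ∀ t, TensorProduct.map Q.betaAlpha LinearMap.id
      (pairHom ((legL k _ H).comp (leg₂ k H)) (pairHom ((legL k _ H).comp (leg₃ k H))
        (legR k _ H)) t) =
      (Q.beta ⊗ₜ 1) * TensorProduct.map (sandwichLeft Q.S Q.alpha) LinearMap.id
        ((TensorProduct.assoc k H H H).symm t) := by
    intro t
    induction t using tensor_induction_three with
    | add s t hs ht => simp only [map_add, mul_add, hs, ht]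
    | tmul a b c => simp [betaAlpha_tmul, sandwichLeft_tmul, mul_assoc]
  have h2 : Q.asc ((legL k _ H).comp (leg₁ k H)) ((legL k _ H).comp (leg₂ k H))
    ((legL k _ H).comp (leg₃ k H)) = Q.Phi ⊗ₜ 1 := by
    rw [← map_asc (φ := legL k (H ⊗[k] (H ⊗[k] H)) H), asc_legs]; rfl
  rw [ascInv, LinearMap.comp_apply, h1, h2, LinearMap.comp_apply, TensorProduct.map_tmul,
    betaAlpha_Phi] at h
  exact h

/-- A form `G` with `G(y¹ h₁ ⊗ y² h₂) = ε(h) G(y)` satisfies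
`G(q̃¹ ⊗ h q̃²) = G(S(h) q̃¹ ⊗ q̃²)`. -/
theorem mul_qL_right {G : H ⊗[k] H →ₗ[k] W}
    (hG : RightEq G (Q.conv (legL k H H) (legR k H H)) (Q.unitHom _)) (h : H) :
    G ((1 ⊗ₜ h) * Q.qL) = G ((Q.S h ⊗ₜ 1) * Q.qL) := by
  have hR := Q.rightEq_map_id hG (sandwichLeft Q.S Q.alpha) (legR k H H) Q.sandwichLeft_mul_legR
  have hL := (Q.leftEq_conv_comp_left Q.leftEq_sandwichLeft
    (LinearMap.id : H →ₗ[k] H)).postcomp G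
  have e := Q.conv_ascInv ((legL k (H ⊗[k] H) H).comp (legL k H H))
    ((legL k (H ⊗[k] H) H).comp (legR k H H)) (legR k (H ⊗[k] H) H) h
  have e1 := Q.leftEq_conv_unit_left (legR k (H ⊗[k] H) H) hL h
    (Q.ascInv ((legL k (H ⊗[k] H) H).comp (legL k H H))
    ((legL k (H ⊗[k] H) H).comp (legR k H H)) (legR k (H ⊗[k] H) H))
  have e2 := Q.rightEq_conv_unit_right ((legL k (H ⊗[k] H) H).comp (legL k H H)) hR h
    (Q.ascInv ((legL k (H ⊗[k] H) H).comp (legL k H H))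
    ((legL k (H ⊗[k] H) H).comp (legR k H H)) (legR k (H ⊗[k] H) H))
  have h1 : ∀ t, TensorProduct.map (sandwichLeft Q.S Q.alpha) LinearMap.id
      (legR k (H ⊗[k] H) H h * t) = (1 ⊗ₜ h) * TensorProduct.map
        (sandwichLeft Q.S Q.alpha) LinearMap.id t := by
    intro t
    induction t using tensor_induction_two with
    | add s t hs ht => simp only [map_add, mul_add, hs, ht]
    | tmul a b => simp
  have h2 : ∀ t, TensorProduct.map (sandwichLeft Q.S Q.alpha) LinearMap.id
      (t * (legL k (H ⊗[k] H) H).comp (legL k H H) h) = (Q.S h ⊗ₜ 1) *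
      TensorProduct.map (sandwichLeft Q.S Q.alpha) LinearMap.id t := by
    intro t
    induction t using tensor_induction_two with
    | add s t hs ht => simp only [map_add, mul_add, add_mul, hs, ht]
    | tmul a b =>
      have := Q.sandwichLeft_mul_legL h a
      simp only [legL, Algebra.TensorProduct.includeLeft_apply] at this
      simp [this]
  rw [LinearMap.comp_apply, LinearMap.comp_apply] at e1 e2
  rw [qL, ← ascInv_legs_left, ← h1, ← h2, ← e1, ← e2, e]

end

theorem leftEq_gammaForm : LeftEq Q.gammaForm (Q.conv (legL k H H) (legR k H H)) (Q.unitHom _) := by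
  intro h y
  rw [conv_apply, pairHom_legL_legR, AlgHom.id_apply, unitHom_apply, ← Algebra.smul_def, map_smul]
  induction y using tensor_induction_two with
  | add s t hs ht => simp only [mul_add, map_add, smul_add, hs, ht]
  | tmul a b => rw [gammaForm_mul, gammaForm_comul, gammaForm_tmul]; simp

theorem rightEq_deltaForm :
    RightEq Q.deltaForm (Q.conv (legL k H H) (legR k H H)) (Q.unitHom _) := by
  intro h y
  rw [conv_apply, pairHom_legL_legR, AlgHom.id_apply, unitHom_apply, ← Algebra.commutes,
    ← Algebra.smul_def, map_smul]
  induction y using tensor_induction_two with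
  | add s t hs ht => simp only [add_mul, map_add, smul_add, hs, ht]
  | tmul a b => rw [deltaForm_mul, deltaForm_comul, deltaForm_tmul]; simp

/-- This and `f_intertwine` are the two exchange rules for p_R evaluated on the form a ⊗ b ↦ (S(a₂)
⊗ S(a₁))γΔ(b). The corresponding statements for f⁻¹ use q_L and δ. -/
theorem f_mul_comul_alpha : Q.f * Q.comul Q.alpha = Q.gamma := by
  have h := Q.pR_mul_alpha Q.leftEq_gammaForm
  rw [gammaForm_mul, ← f_eq, coS_one, one_mul] at h
  rw [h, Algebra.TensorProduct.one_def, gammaForm_tmul, coS_one, map_one, one_mul, mul_one]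

theorem f_intertwine (h : H) : Q.coS h * Q.f = Q.f * Q.comul (Q.S h) := by
  have e := Q.pR_mul_left Q.leftEq_gammaForm h
  rwa [gammaForm_mul, gammaForm_mul, ← f_eq, coS_one, one_mul, map_one, mul_one] at e

theorem comul_beta_mul_fInv : Q.comul Q.beta * Q.fInv = Q.delta := by
  have h := Q.beta_mul_qL Q.rightEq_deltaForm
  rw [deltaForm_mul, ← fInv_eq, coS_one, mul_one] at h
  rw [h, Algebra.TensorProduct.one_def, deltaForm_tmul, coS_one, map_one, one_mul, mul_one]

theorem fInv_intertwine (h : H) : Q.fInv * Q.coS h = Q.comul (Q.S h) * Q.fInv := by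
  have e := Q.mul_qL_right Q.rightEq_deltaForm h
  rwa [deltaForm_mul, deltaForm_mul, ← fInv_eq, coS_one, mul_one, map_one, one_mul] at e

end QuasiHopfAlgebra

theorem pairHom_comp_legL {k A A' B : Type*} [Field k] [Ring A] [Algebra k A] [Ring A']
    [Algebra k A'] [Ring B] [Algebra k B] (a : A →ₐ[k] B) (b : A' →ₐ[k] B) [Commuting a b] :
    (pairHom a b).comp (legL k A A') = a := by ext; simp

theorem pairHom_comp_legR {k A A' B : Type*} [Field k] [Ring A] [Algebra k A] [Ring A']
    [Algebra k A'] [Ring B] [Algebra k B] (a : A →ₐ[k] B) (b : A' →ₐ[k] B) [Commuting a b] :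
    (pairHom a b).comp (legR k A A') = b := by ext; simp

/-! ### The twist f is invertible with inverse f⁻¹. -/

namespace QuasiHopfAlgebra

variable {k H : Type*} [Field k] [Ring H] [Algebra k H] (Q : QuasiHopfAlgebra k H)

section SixLegs

variable (k H)

/-- The `i`-th leg of the first factor of `(H ⊗ H ⊗ H) ⊗ (H ⊗ H ⊗ H)`. -/
abbrev upperLeg (i : H →ₐ[k] H ⊗[k] (H ⊗[k] H)) :
    H →ₐ[k] (H ⊗[k] (H ⊗[k] H)) ⊗[k] (H ⊗[k] (H ⊗[k] H)) := (legL k _ _).comp i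

/-- The `i`-th leg of the second factor of `(H ⊗ H ⊗ H) ⊗ (H ⊗ H ⊗ H)`. -/
abbrev lowerLeg (i : H →ₐ[k] H ⊗[k] (H ⊗[k] H)) :
    H →ₐ[k] (H ⊗[k] (H ⊗[k] H)) ⊗[k] (H ⊗[k] (H ⊗[k] H)) := (legR k _ _).comp i

end SixLegs

section

variable {B : Type*} [Ring B] [Algebra k B] (a b c d : H →ₐ[k] B) [Commuting a b] [Commuting a c]
  [Commuting a d] [Commuting b c] [Commuting b d] [Commuting c d]

/-- The algebra map `x ⊗ y ⊗ z ⊗ u ↦ a(x) b(y) c(z) d(u)`. -/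
def quadHom : H ⊗[k] (H ⊗[k] (H ⊗[k] H)) →ₐ[k] B := pairHom a (pairHom b (pairHom c d))

theorem quadHom_tmul (x y z u : H) :
    quadHom a b c d (x ⊗ₜ (y ⊗ₜ (z ⊗ₜ u))) = a x * (b y * (c z * d u)) := by simp [quadHom]

theorem quadHom_comp₁ : (quadHom a b c d).comp (quadLeg₁ k H) = a := by
  ext; simp [quadHom]

theorem quadHom_comp₂ : (quadHom a b c d).comp (quadLeg₂ k H) = b := by
  ext; simp [quadHom]

theorem quadHom_comp₃ : (quadHom a b c d).comp (quadLeg₃ k H) = c := by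
  ext; simp [quadHom]

theorem quadHom_comp₄ : (quadHom a b c d).comp (quadLeg₄ k H) = d := by
  ext; simp [quadHom]

theorem quadHom_pair₁₂ (t : H ⊗[k] H) :
    quadHom a b c d (pairHom (quadLeg₁ k H) (quadLeg₂ k H) t) = pairHom a b t := by
  rw [map_pairHom]; simp only [quadHom_comp₁, quadHom_comp₂]

theorem quadHom_pair₃₄ (t : H ⊗[k] H) :
    quadHom a b c d (pairHom (quadLeg₃ k H) (quadLeg₄ k H) t) = pairHom c d t := by
  rw [map_pairHom]; simp only [quadHom_comp₃, quadHom_comp₄]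

theorem quadHom_gamma_mul (x y : H ⊗[k] H) :
    quadHom a b c d (Q.asc (quadLeg₁ k H) (quadLeg₂ k H) (quadLeg₃ k H) *
      Q.ascInv (Q.conv (quadLeg₁ k H) (quadLeg₂ k H)) (quadLeg₃ k H) (quadLeg₄ k H) *
      (pairHom (quadLeg₁ k H) (quadLeg₂ k H) x * pairHom (quadLeg₃ k H) (quadLeg₄ k H) y)) =
    Q.asc a b c * Q.ascInv (Q.conv a b) c d * (pairHom a b x * pairHom c d y) := by
  rw [map_mul, map_mul, map_mul, map_asc, map_ascInv, quadHom_pair₁₂, quadHom_pair₃₄]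
  simp only [comp_conv, quadHom_comp₁, quadHom_comp₂, quadHom_comp₃, quadHom_comp₄]

theorem quadHom_mul_delta (x y : H ⊗[k] H) : quadHom a b c d
      (pairHom (quadLeg₁ k H) (quadLeg₂ k H) x * pairHom (quadLeg₃ k H) (quadLeg₄ k H) y *
        (Q.asc (Q.conv (quadLeg₁ k H) (quadLeg₂ k H)) (quadLeg₃ k H) (quadLeg₄ k H) *
        Q.ascInv (quadLeg₁ k H) (quadLeg₂ k H) (quadLeg₃ k H))) =
    pairHom a b x * pairHom c d y * (Q.asc (Q.conv a b) c d * Q.ascInv a b c) := by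
  rw [map_mul, map_mul, map_mul, map_asc, map_ascInv, quadHom_pair₁₂, quadHom_pair₃₄]
  simp only [comp_conv, quadHom_comp₁, quadHom_comp₂, quadHom_comp₃, quadHom_comp₄]

end

/-- Multiplying the form defining δ by the one defining γ produces xβS(y)αz in each of the two
tensor factors. The legs of the lower factor are nested between those of the upper one, as
`nested_zigzag_one` requires. -/
theorem deltaAux_mul_gammaAux (D A : H ⊗[k] (H ⊗[k] (H ⊗[k] H))) :
    Q.deltaAux D * Q.gammaAux A = TensorProduct.map Q.betaAlpha Q.betaAlpha
      (quadHom (lowerLeg k H (leg₂ k H)) (upperLeg k H (leg₂ k H)) (upperLeg k H (leg₃ k H))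
        (lowerLeg k H (leg₃ k H)) A *
       quadHom (upperLeg k H (leg₁ k H)) (lowerLeg k H (leg₁ k H)) (lowerLeg k H (leg₂ k H))
        (upperLeg k H (leg₂ k H)) D) := by
  induction D using tensor_induction_four with
  | add s t hs ht => simp only [add_mul, mul_add, map_add, hs, ht]
  | tmul a b c d =>
  induction A using tensor_induction_four with
  | add s t hs ht => simp only [add_mul, mul_add, map_add, hs, ht]
  | tmul a' b' c' d' =>
    simp [quadHom_tmul, deltaAux_tmul, gammaAux_tmul, betaAlpha_tmul, Q.S_mul, mul_assoc]

theorem gammaAux_mul_deltaAux (A D : H ⊗[k] (H ⊗[k] (H ⊗[k] H))) :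
    Q.gammaAux A * Q.deltaAux D = TensorProduct.map Q.alphaBeta Q.alphaBeta
      (quadHom (lowerLeg k H (leg₁ k H)) (upperLeg k H (leg₁ k H)) (upperLeg k H (leg₂ k H))
        (lowerLeg k H (leg₂ k H)) A *
       quadHom (upperLeg k H (leg₂ k H)) (lowerLeg k H (leg₂ k H)) (lowerLeg k H (leg₃ k H))
        (upperLeg k H (leg₃ k H)) D) := by
  induction D using tensor_induction_four with
  | add s t hs ht => simp only [mul_add, map_add, hs, ht]
  | tmul a b c d =>
  induction A using tensor_induction_four with
  | add s t hs ht => simp only [add_mul, map_add, hs, ht]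
  | tmul a' b' c' d' =>
    simp [quadHom_tmul, deltaAux_tmul, gammaAux_tmul, alphaBeta_tmul, mul_assoc]

theorem S_Sinv (h : H) : Q.S (Q.Sinv h) = h := Q.antipode.apply_symm_apply h

theorem Sinv_S (h : H) : Q.Sinv (Q.S h) = h := Q.antipode.symm_apply_apply h

/-- Every element of H is S of something, so the intertwining properties of f and of f⁻¹ can be
applied one after the other. -/
theorem fInv_mul_f_comm (h : H) : Q.fInv * Q.f * Q.comul h = Q.comul h * (Q.fInv * Q.f) := by
  rw [← Q.S_Sinv h, mul_assoc, ← f_intertwine, ← mul_assoc, fInv_intertwine, mul_assoc]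

theorem gamma_form_eq (b c : H) : Q.coS b * Q.gamma * Q.comul c = Q.gammaAux
    (Q.asc (quadLeg₁ k H) (quadLeg₂ k H) (quadLeg₃ k H) *
    Q.ascInv (Q.conv (quadLeg₁ k H) (quadLeg₂ k H)) (quadLeg₃ k H) (quadLeg₄ k H) *
    (pairHom (quadLeg₁ k H) (quadLeg₂ k H) (Q.comul b) *
    pairHom (quadLeg₃ k H) (quadLeg₄ k H) (Q.comul c))) := by
  rw [gammaAux_mul, ← gamma_eq, coS_apply]

theorem delta_form_eq (a b : H) : Q.comul a * Q.delta * Q.coS b = Q.deltaAux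
    (pairHom (quadLeg₁ k H) (quadLeg₂ k H) (Q.comul a) *
      pairHom (quadLeg₃ k H) (quadLeg₄ k H) (Q.comul b) *
      (Q.asc (Q.conv (quadLeg₁ k H) (quadLeg₂ k H)) (quadLeg₃ k H) (quadLeg₄ k H) *
        Q.ascInv (quadLeg₁ k H) (quadLeg₂ k H) (quadLeg₃ k H))) := by
  rw [deltaAux_mul, ← delta_eq, coS_apply]

/-- Multiply f⁻¹f by Δ(X¹βS(X²)αX³) = 1. By `fInv_mul_f_comm` and the intertwining property of f⁻¹,
it can be brought between Δ(β) and Δ(α) with S(X²) in the middle; then Δ(β)f⁻¹ = δ and fΔ(α) = γ.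
The resulting word in δ and γ is the nested zigzag, whose value is the tensor square of X¹βS(X²)αX³
= 1. -/
theorem fInv_mul_f : Q.fInv * Q.f = 1 := by
  have key : ∀ t, Q.comul (Q.betaAlpha t) * (Q.fInv * Q.f) =
      TensorProduct.map Q.betaAlpha Q.betaAlpha
        (Q.asc (lowerLeg k H (leg₂ k H)) (upperLeg k H (leg₂ k H)) (upperLeg k H (leg₃ k H)) *
        (Q.ascInv (Q.conv (lowerLeg k H (leg₂ k H)) (upperLeg k H (leg₂ k H)))
          (upperLeg k H (leg₃ k H)) (lowerLeg k H (leg₃ k H)) *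
        (pairHom (Q.conv (upperLeg k H (leg₁ k H)) (lowerLeg k H (leg₁ k H)))
          (pairHom (Q.conv (lowerLeg k H (leg₂ k H)) (upperLeg k H (leg₂ k H)))
            (Q.conv (upperLeg k H (leg₃ k H)) (lowerLeg k H (leg₃ k H)))) t *
        (Q.asc (Q.conv (upperLeg k H (leg₁ k H)) (lowerLeg k H (leg₁ k H)))
          (lowerLeg k H (leg₂ k H)) (upperLeg k H (leg₂ k H)) *
        Q.ascInv (upperLeg k H (leg₁ k H)) (lowerLeg k H (leg₁ k H))
          (lowerLeg k H (leg₂ k H)))))) := by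
    intro t
    induction t using tensor_induction_three with
    | add s t hs ht => simp only [add_mul, mul_add, map_add, hs, ht]
    | tmul a b c =>
      have h3 : Q.comul (Q.betaAlpha (a ⊗ₜ (b ⊗ₜ c))) * (Q.fInv * Q.f) =
          (Q.comul a * Q.delta * Q.coS 1) * (Q.coS b * Q.gamma * Q.comul c) := by
        rw [← comul_beta_mul_fInv, ← f_mul_comul_alpha, betaAlpha_tmul, coS_one, mul_one]
        calc _ = Q.comul a * Q.comul Q.beta * (Q.comul (Q.S b) * (Q.comul (Q.alpha * c) *
              (Q.fInv * Q.f))) := by simp only [map_mul, mul_assoc]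
          _ = Q.comul a * Q.comul Q.beta * ((Q.comul (Q.S b) * Q.fInv) * Q.f *
              Q.comul (Q.alpha * c)) := by rw [← fInv_mul_f_comm]; simp only [mul_assoc]
          _ = _ := by rw [← fInv_intertwine]; simp only [map_mul, mul_assoc]
      rw [h3, gamma_form_eq, delta_form_eq, deltaAux_mul_gammaAux, quadHom_gamma_mul,
        quadHom_mul_delta, pairHom_tmul, pairHom_tmul, ← conv_apply, ← conv_apply, ← conv_apply,
        map_one, map_one, mul_one]
      -- The three coproducts are gathered into one factor, so that replacing the pure tensor by Φ
      -- yields a reassociator in product legs.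
      have h4 := (Commuting.comm (a := Q.conv (upperLeg k H (leg₁ k H)) (lowerLeg k H (leg₁ k H)))
          (b := pairHom (Q.conv (lowerLeg k H (leg₂ k H)) (upperLeg k H (leg₂ k H)))
            (Q.conv (upperLeg k H (leg₃ k H)) (lowerLeg k H (leg₃ k H)))) a (b ⊗ₜ c)).eq
      rw [pairHom_tmul] at h4
      rw [h4]
      simp only [mul_assoc]
  have h := key Q.Phi
  rw [betaAlpha_Phi, map_one, one_mul] at h
  rw [h]
  refine (Q.nested_zigzag_one (upperLeg k H (leg₁ k H)) (lowerLeg k H (leg₁ k H))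
    (lowerLeg k H (leg₂ k H)) (upperLeg k H (leg₂ k H)) (upperLeg k H (leg₃ k H))
    (lowerLeg k H (leg₃ k H)) (Q.leftEq_conv_comp_left Q.leftEq_betaAlpha _)
    (Q.leftEq_conv_comp_right Q.leftEq_betaAlpha _)
    (Q.rightEq_conv_comp_right Q.rightEq_betaAlpha _)
    (Q.rightEq_conv_comp_left Q.rightEq_betaAlpha _)).trans ?_
  rw [← map_asc, ← map_asc, asc_legs]
  change TensorProduct.map Q.betaAlpha Q.betaAlpha ((1 ⊗ₜ Q.Phi) * (Q.Phi ⊗ₜ 1)) = 1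
  rw [Algebra.TensorProduct.tmul_mul_tmul, one_mul, mul_one, TensorProduct.map_tmul, betaAlpha_Phi]
  rfl

/-- Here Δ(S(x¹)αx²βS(x³)) = 1 is inserted between f and f⁻¹. Since f and f⁻¹ already stand at the
ends, the intertwining properties alone turn the middle into γ and δ. -/
theorem f_mul_fInv : Q.f * Q.fInv = 1 := by
  have key : ∀ t, Q.f * Q.comul (Q.alphaBeta t) * Q.fInv =
      TensorProduct.map Q.alphaBeta Q.alphaBeta
        (Q.asc (lowerLeg k H (leg₁ k H)) (upperLeg k H (leg₁ k H)) (upperLeg k H (leg₂ k H)) *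
        (Q.ascInv (Q.conv (lowerLeg k H (leg₁ k H)) (upperLeg k H (leg₁ k H)))
          (upperLeg k H (leg₂ k H)) (lowerLeg k H (leg₂ k H)) *
        (pairHom (Q.conv (lowerLeg k H (leg₁ k H)) (upperLeg k H (leg₁ k H)))
          (pairHom (Q.conv (upperLeg k H (leg₂ k H)) (lowerLeg k H (leg₂ k H)))
            (Q.conv (lowerLeg k H (leg₃ k H)) (upperLeg k H (leg₃ k H)))) t *
        (Q.asc (Q.conv (upperLeg k H (leg₂ k H)) (lowerLeg k H (leg₂ k H)))
          (lowerLeg k H (leg₃ k H)) (upperLeg k H (leg₃ k H)) *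
        Q.ascInv (upperLeg k H (leg₂ k H)) (lowerLeg k H (leg₂ k H))
          (lowerLeg k H (leg₃ k H)))))) := by
    intro t
    induction t using tensor_induction_three with
    | add s t hs ht => simp only [add_mul, mul_add, map_add, hs, ht]
    | tmul a b c =>
      have h3 : Q.f * Q.comul (Q.alphaBeta (a ⊗ₜ (b ⊗ₜ c))) * Q.fInv =
          (Q.coS a * Q.gamma * Q.comul b) * (Q.comul 1 * Q.delta * Q.coS c) := by
        rw [← comul_beta_mul_fInv, ← f_mul_comul_alpha, alphaBeta_tmul, map_one, one_mul]
        calc _ = (Q.f * Q.comul (Q.S a)) * (Q.comul (Q.alpha * b * Q.beta) *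
              (Q.comul (Q.S c) * Q.fInv)) := by simp only [map_mul, mul_assoc]
          _ = _ := by
              rw [← fInv_intertwine, ← f_intertwine]; simp only [map_mul, mul_assoc]
      rw [h3, gamma_form_eq, delta_form_eq, gammaAux_mul_deltaAux, quadHom_gamma_mul,
        quadHom_mul_delta, pairHom_tmul, pairHom_tmul, ← conv_apply, ← conv_apply, ← conv_apply,
        ← conv_apply, map_one, one_mul]
      simp only [mul_assoc]
  have h := key Q.PhiInv
  rw [alphaBeta_PhiInv, map_one, mul_one] at h
  rw [h]
  refine (Q.nested_zigzag_two (lowerLeg k H (leg₁ k H)) (upperLeg k H (leg₁ k H))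
    (upperLeg k H (leg₂ k H)) (lowerLeg k H (leg₂ k H)) (lowerLeg k H (leg₃ k H))
    (upperLeg k H (leg₃ k H)) (Q.leftEq_conv_comp_left Q.leftEq_alphaBeta _)
    (Q.leftEq_conv_comp_right Q.leftEq_alphaBeta _)
    (Q.rightEq_conv_comp_right Q.rightEq_alphaBeta _)
    (Q.rightEq_conv_comp_left Q.rightEq_alphaBeta _)).trans ?_
  rw [← map_ascInv, ← map_ascInv, ascInv_legs]
  change TensorProduct.map Q.alphaBeta Q.alphaBeta ((1 ⊗ₜ Q.PhiInv) * (Q.PhiInv ⊗ₜ 1)) = 1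
  rw [Algebra.TensorProduct.tmul_mul_tmul, one_mul, mul_one, TensorProduct.map_tmul,
    alphaBeta_PhiInv]
  rfl

end QuasiHopfAlgebra

/-! ### Counit identities, and contractions of f and f⁻¹ with β and α. -/

namespace QuasiHopfAlgebra

variable {k H : Type*} [Field k] [Ring H] [Algebra k H] (Q : QuasiHopfAlgebra k H)

theorem counit_alpha_ne_zero : Q.counit Q.alpha ≠ 0 := by
  intro h0
  have h : ∀ t, Q.counit (Q.alphaBeta t) = 0 := by
    intro t
    induction t using tensor_induction_three with
    | add s t hs ht => simp only [map_add, hs, ht, add_zero]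
    | tmul a b c => simp [alphaBeta_tmul, h0]
  have := h Q.PhiInv
  rw [alphaBeta_PhiInv, map_one] at this
  exact one_ne_zero this

/-- Apply ε to the antipode axiom for α and cancel ε(α), which is nonzero because it divides ε(1) =
1. -/
theorem counit_S (h : H) : Q.counit (Q.S h) = Q.counit h := by
  have h1 : ∀ t, Q.counit (sandwichLeft Q.S Q.alpha t) = Q.counit (Q.S
      (TensorProduct.rid k H (TensorProduct.map LinearMap.id Q.counit.toLinearMap t))) *
        Q.counit Q.alpha := by
    intro t
    induction t using tensor_induction_two with
    | add s t hs ht => simp only [map_add, add_mul, hs, ht]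
    | tmul a b => simp [sandwichLeft_tmul, mul_comm, mul_left_comm]
  have h2 := h1 (Q.comul h)
  rw [sandwichLeft_comul, Q.comul_counit, map_smul, smul_eq_mul] at h2
  exact (mul_right_cancel₀ Q.counit_alpha_ne_zero h2).symm

theorem counit_alpha_mul_counit_beta : Q.counit Q.alpha * Q.counit Q.beta = 1 := by
  have h : ∀ t, Q.counit (Q.alphaBeta t) = Q.counit Q.alpha * Q.counit Q.beta *
      pairHom (Q.unitHom k) (pairHom (Q.unitHom k) (Q.unitHom k)) t := by
    intro t
    induction t using tensor_induction_three with
    | add s t hs ht => simp only [map_add, mul_add, hs, ht]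
    | tmul a b c => simp [alphaBeta_tmul, counit_S, unitHom_apply]; ring
  have h1 := h Q.PhiInv
  change _ = _ * Q.ascInv (Q.unitHom k) (Q.unitHom k) (Q.unitHom k) at h1
  rw [alphaBeta_PhiInv, map_one, ascInv_unit_left, mul_one] at h1
  exact h1.symm

theorem sandwichLeft_mul (c : H) (d t : H ⊗[k] H) :
    sandwichLeft Q.S c (d * t) = sandwichLeft Q.S (sandwichLeft Q.S c d) t := by
  induction t using tensor_induction_two with
  | add s t hs ht => simp only [mul_add, map_add, hs, ht]
  | tmul a b =>
    rw [sandwichLeft_tmul]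
    induction d using tensor_induction_two with
    | add s t hs ht => simp only [add_mul, mul_add, map_add, hs, ht]
    | tmul x y => simp [sandwichLeft_tmul, Q.S_mul, mul_assoc]

theorem sandwichRight_mul (c : H) (t d : H ⊗[k] H) :
    sandwichRight Q.S c (t * d) = sandwichRight Q.S (sandwichRight Q.S c d) t := by
  induction t using tensor_induction_two with
  | add s t hs ht => simp only [add_mul, map_add, hs, ht]
  | tmul a b =>
    rw [sandwichRight_tmul]
    induction d using tensor_induction_two with
    | add s t hs ht => simp only [add_mul, mul_add, map_add, hs, ht]
    | tmul x y => simp [sandwichRight_tmul, Q.S_mul, mul_assoc]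

theorem sandwichLeft_smul (r : k) (c : H) (t : H ⊗[k] H) :
    sandwichLeft Q.S (r • c) t = r • sandwichLeft Q.S c t := by
  induction t using tensor_induction_two with
  | add s t hs ht => simp only [map_add, smul_add, hs, ht]
  | tmul a b => simp [sandwichLeft_tmul]

theorem sandwichRight_smul (r : k) (c : H) (t : H ⊗[k] H) :
    sandwichRight Q.S (r • c) t = r • sandwichRight Q.S c t := by
  induction t using tensor_induction_two with
  | add s t hs ht => simp only [map_add, smul_add, hs, ht]
  | tmul a b => simp [sandwichRight_tmul]

/-- This is the image under S of the antipode axiom for β. -/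
theorem sandwichLeft_coS (h : H) :
    sandwichLeft Q.S (Q.S Q.beta) (Q.coS h) = Q.counit h • Q.S Q.beta := by
  have h1 : ∀ t, sandwichLeft Q.S (Q.S Q.beta) (Q.flipS t) = Q.S (sandwichRight Q.S Q.beta t) := by
    intro t
    induction t using tensor_induction_two with
    | add s t hs ht => simp only [map_add, hs, ht]
    | tmul a b => simp [sandwichLeft_tmul, sandwichRight_tmul, flipS_tmul, Q.S_mul, mul_assoc]
  rw [coS_apply, h1, sandwichRight_comul, map_smul]

theorem sandwichRight_coS (h : H) :
    sandwichRight Q.S (Q.S Q.alpha) (Q.coS h) = Q.counit h • Q.S Q.alpha := by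
  have h1 : ∀ t, sandwichRight Q.S (Q.S Q.alpha) (Q.flipS t) =
      Q.S (sandwichLeft Q.S Q.alpha t) := by
    intro t
    induction t using tensor_induction_two with
    | add s t hs ht => simp only [map_add, hs, ht]
    | tmul a b => simp [sandwichLeft_tmul, sandwichRight_tmul, flipS_tmul, Q.S_mul, mul_assoc]
  rw [coS_apply, h1, sandwichLeft_comul, map_smul]

/-- Inserting S(β) contracts legs 1 and 2 at the right end, which removes Φ⁻¹ from the definition of
γ. The remaining Φ contributes S(X¹βS(X²)αX³) = 1 in front of α. -/
theorem sandwichLeft_gamma : sandwichLeft Q.S (Q.S Q.beta) Q.gamma = Q.alpha := by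
  have hR : RightEq (sandwichLeft Q.S (Q.S Q.beta) ∘ₗ Q.gammaAux)
      (Q.conv (quadLeg₁ k H) (quadLeg₂ k H)) (Q.unitHom _) := by
    intro h y
    have := Q.gammaAux_mul y (Q.comul h) 1
    rw [map_one, mul_one, mul_one] at this
    rw [conv_apply, LinearMap.comp_apply, this, ← coS_apply, sandwichLeft_mul, sandwichLeft_coS,
      sandwichLeft_smul, unitHom_apply, ← Algebra.commutes, ← Algebra.smul_def, map_smul]
    rfl
  have h1 : ∀ t, (sandwichLeft Q.S (Q.S Q.beta) ∘ₗ Q.gammaAux)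
      (pairHom (quadLeg₁ k H) (pairHom (quadLeg₂ k H) (quadLeg₃ k H)) t) =
      Q.S (Q.betaAlpha t) * Q.alpha := by
    intro t
    induction t using tensor_induction_three with
    | add s t hs ht => simp only [map_add, add_mul, hs, ht]
    | tmul a b c =>
      simp [gammaAux_tmul, betaAlpha_tmul, sandwichLeft_tmul, Q.S_mul, mul_assoc]
  have h := Q.rightEq_ascInv_fst (quadLeg₃ k H) (quadLeg₄ k H) hR
    (Q.asc (quadLeg₁ k H) (quadLeg₂ k H) (quadLeg₃ k H))
  rw [ascInv_unit_left, mul_one, LinearMap.comp_apply, ← gamma_eq] at h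
  rw [h, asc, h1, betaAlpha_Phi, Q.S_one, one_mul]

/-- Inserting S(α) contracts legs 3 and 4 at the left end, while β contracts legs 2 and 3 at the
right end. So the word defining δ is a zigzag and collapses to a single Φ in legs 2, 3 and 4. -/
theorem sandwichRight_delta : sandwichRight Q.S (Q.S Q.alpha) Q.delta = Q.beta := by
  have hL : LeftEq (sandwichRight Q.S (Q.S Q.alpha) ∘ₗ Q.deltaAux)
      (Q.conv (quadLeg₃ k H) (quadLeg₄ k H)) (Q.unitHom _) := by
    intro h y
    have := Q.deltaAux_mul y 1 (Q.comul h)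
    rw [map_one, one_mul, one_mul] at this
    rw [conv_apply, LinearMap.comp_apply, this, ← coS_apply, sandwichRight_mul, sandwichRight_coS,
      sandwichRight_smul, unitHom_apply, ← Algebra.smul_def, map_smul]
    rfl
  have h := Q.zigzag_two (quadLeg₁ k H) (quadLeg₂ k H) (quadLeg₃ k H) (quadLeg₄ k H) hL
    (Q.rightEq_deltaAux_mid.postcomp (sandwichRight Q.S (Q.S Q.alpha)))
  have h1 : ∀ t, (sandwichRight Q.S (Q.S Q.alpha) ∘ₗ Q.deltaAux)
      (pairHom (quadLeg₂ k H) (pairHom (quadLeg₃ k H) (quadLeg₄ k H)) t) =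
      Q.beta * Q.S (Q.betaAlpha t) := by
    intro t
    induction t using tensor_induction_three with
    | add s t hs ht => simp only [map_add, mul_add, hs, ht]
    | tmul a b c =>
      simp [deltaAux_tmul, betaAlpha_tmul, sandwichRight_tmul, Q.S_mul, mul_assoc]
  rw [LinearMap.comp_apply, ← delta_eq] at h
  rw [h, asc, h1, betaAlpha_Phi, Q.S_one, mul_one]

/-- `S(β f¹) f² = ε(β) α` -/
theorem sandwichLeft_f : sandwichLeft Q.S (Q.S Q.beta) Q.f = Q.counit Q.beta • Q.alpha := by
  have h1 : ∀ t, sandwichLeft Q.S (Q.S Q.beta) (Q.gammaForm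
      (TensorProduct.map LinearMap.id (sandwichRight Q.S Q.beta) t)) =
      (pairHom (Q.unitHom k) (pairHom (Q.unitHom k) (Q.unitHom k)) t) •
        Q.counit Q.beta • Q.alpha := by
    intro t
    induction t using tensor_induction_three with
    | add s t hs ht => simp only [map_add, add_smul, hs, ht]
    | tmul a b c =>
      rw [TensorProduct.map_tmul, gammaForm_tmul, sandwichLeft_mul, sandwichLeft_mul,
        LinearMap.id_apply, sandwichLeft_coS, sandwichLeft_smul, sandwichLeft_smul,
        sandwichLeft_gamma, sandwichLeft_comul, sandwichRight_tmul]
      simp only [map_mul, counit_S, pairHom_tmul, unitHom_apply, smul_smul]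
      congr 1
      simp only [Algebra.algebraMap_self, RingHom.id_apply]
      ring
  rw [f_eq, pR, h1]
  change Q.ascInv (Q.unitHom k) (Q.unitHom k) (Q.unitHom k) • _ = _
  rw [ascInv_unit_left, one_smul]

/-- `g¹ S(g² α) = ε(α) β` -/
theorem sandwichRight_fInv :
    sandwichRight Q.S (Q.S Q.alpha) Q.fInv = Q.counit Q.alpha • Q.beta := by
  have h1 : ∀ t, sandwichRight Q.S (Q.S Q.alpha) (Q.deltaForm
      (TensorProduct.map (sandwichLeft Q.S Q.alpha) LinearMap.id
        ((TensorProduct.assoc k H H H).symm t))) =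
      (pairHom (Q.unitHom k) (pairHom (Q.unitHom k) (Q.unitHom k)) t) •
        Q.counit Q.alpha • Q.beta := by
    intro t
    induction t using tensor_induction_three with
    | add s t hs ht => simp only [map_add, add_smul, hs, ht]
    | tmul a b c =>
      rw [TensorProduct.assoc_symm_tmul, TensorProduct.map_tmul, deltaForm_tmul, sandwichRight_mul,
        LinearMap.id_apply, sandwichRight_coS, sandwichRight_smul, sandwichRight_mul,
        sandwichRight_delta, sandwichRight_comul, sandwichLeft_tmul]
      simp only [map_mul, counit_S, pairHom_tmul, unitHom_apply, smul_smul]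
      congr 1
      simp only [Algebra.algebraMap_self, RingHom.id_apply]
      ring
  rw [fInv_eq, qL, h1]
  change Q.ascInv (Q.unitHom k) (Q.unitHom k) (Q.unitHom k) • _ = _
  rw [ascInv_unit_left, one_smul]

end QuasiHopfAlgebra

/-! ### Coactions as elements R of H ⊗ E, and the Drinfeld element. -/

namespace QuasiHopfAlgebra

variable {k H : Type*} [Field k] [Ring H] [Algebra k H] (Q : QuasiHopfAlgebra k H)
variable {E : Type*} [Ring E] [Algebra k E]

section EndLegs

variable (k H E)

/-- The first leg of `H ⊗ H ⊗ E`. -/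
abbrev outLeg₁ : H →ₐ[k] H ⊗[k] (H ⊗[k] E) := legL k H _

/-- The second leg of `H ⊗ H ⊗ E`. -/
abbrev outLeg₂ : H →ₐ[k] H ⊗[k] (H ⊗[k] E) := (legR k H _).comp (legL k H E)

/-- The third leg of `H ⊗ H ⊗ E`. -/
abbrev outLeg₃ : E →ₐ[k] H ⊗[k] (H ⊗[k] E) := (legR k H _).comp (legR k H E)

end EndLegs

/-- For an algebra map `π : H → E`, the conditions on `R = R¹ ⊗ R²` in `H ⊗ E` which make
`m ↦ R¹ ⊗ R² m` a Yetter-Drinfeld coaction on every `E`-module. -/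
structure IsYDElement (π : H →ₐ[k] E) (R : H ⊗[k] E) : Prop where
  counit : pairHom (Q.unitHom E) (AlgHom.id k E) R = 1
  compat : ∀ h : H, Q.conv (legL k H E) ((legR k H E).comp π) h * R =
    R * Q.conv ((legR k H E).comp π) (legL k H E) h
  hexagon : pairHom (outLeg₂ k H E) (outLeg₃ k H E) R *
      Q.asc (outLeg₁ k H E) ((outLeg₃ k H E).comp π) (outLeg₂ k H E) *
        pairHom (outLeg₁ k H E) (outLeg₃ k H E) R =
    Q.asc (outLeg₁ k H E) (outLeg₂ k H E) ((outLeg₃ k H E).comp π) *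
      pairHom (Q.conv (outLeg₁ k H E) (outLeg₂ k H E)) (outLeg₃ k H E) R *
        Q.asc ((outLeg₃ k H E).comp π) (outLeg₁ k H E) (outLeg₂ k H E)

variable {Q} {π : H →ₐ[k] E} {R : H ⊗[k] E}

namespace IsYDElement

section

variable (hR : Q.IsYDElement π R)
variable {B : Type*} [Ring B] [Algebra k B] (a b : H →ₐ[k] B) (e : E →ₐ[k] B)
  [Commuting a b] [Commuting a e] [Commuting b e]

include hR

theorem pair_unit : pairHom (Q.unitHom B) e R = 1 := by
  have h := congrArg e hR.counit
  rw [map_pairHom] at h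
  simpa only [comp_unitHom, AlgHom.comp_id, map_one] using h

/-- The axioms on R are stated in universal legs; commuting legs in B define an algebra map which
carries them over. The same applies to the counit condition and to the hexagon. -/
theorem conv_mul (h : H) : Q.conv a (e.comp π) h * pairHom a e R =
    pairHom a e R * Q.conv (e.comp π) a h := by
  have h1 := congrArg (pairHom a e) (hR.compat h)
  rw [map_mul, map_mul] at h1
  have h2 : (pairHom a e).comp (Q.conv (legL k H E) ((legR k H E).comp π)) =
      Q.conv a (e.comp π) := by
    rw [comp_conv]; simp only [← AlgHom.comp_assoc, pairHom_comp_legL, pairHom_comp_legR]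
  have h3 : (pairHom a e).comp (Q.conv ((legR k H E).comp π) (legL k H E)) =
      Q.conv (e.comp π) a := by
    rw [comp_conv]; simp only [← AlgHom.comp_assoc, pairHom_comp_legL, pairHom_comp_legR]
  rw [← h2, ← h3]
  exact h1

theorem hexagon_mul : pairHom b e R * Q.asc a (e.comp π) b * pairHom a e R =
    Q.asc a b (e.comp π) * pairHom (Q.conv a b) e R * Q.asc (e.comp π) a b := by
  have h := congrArg (pairHom a (pairHom b e)) hR.hexagon
  have h1 : (pairHom a (pairHom b e)).comp (outLeg₁ k H E) = a := pairHom_comp_legL _ _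
  have h2 : (pairHom a (pairHom b e)).comp (outLeg₂ k H E) = b := by
    rw [outLeg₂, ← AlgHom.comp_assoc, pairHom_comp_legR, pairHom_comp_legL]
  have h3 : (pairHom a (pairHom b e)).comp (outLeg₃ k H E) = e := by
    rw [outLeg₃, ← AlgHom.comp_assoc, pairHom_comp_legR, pairHom_comp_legR]
  have h4 : (pairHom a (pairHom b e)).comp ((outLeg₃ k H E).comp π) = e.comp π := by
    rw [← AlgHom.comp_assoc, h3]
  rw [map_mul, map_mul, map_mul, map_mul, map_pairHom, map_pairHom, map_pairHom, map_asc, map_asc,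
    map_asc] at h
  simpa only [h1, h2, h3, h4, comp_conv] using h

end

end IsYDElement

variable (Q) (π) (R)

/-- The map `h ⊗ x ↦ S(h) α x`. -/
def alphaForm : H ⊗[k] E →ₗ[k] E :=
  LinearMap.mul' k E ∘ₗ
    TensorProduct.map (π.toLinearMap ∘ₗ LinearMap.mulRight k Q.alpha ∘ₗ Q.S) LinearMap.id

theorem alphaForm_tmul (h : H) (x : E) : Q.alphaForm π (h ⊗ₜ x) = π (Q.S h * Q.alpha) * x := by
  simp [alphaForm]

/-- The element `R¹ y ⊗ R² x` for `t = x ⊗ y`. -/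
def mulFlip (t : H ⊗[k] H) : H ⊗[k] E := R * pairHom ((legR k H E).comp π) (legL k H E) t

theorem mulFlip_tmul (h : H) (x : E) (a b : H) :
    mulFlip π (h ⊗ₜ x) (a ⊗ₜ b) = (h * b) ⊗ₜ (x * π a) := by simp [mulFlip]

/-- The element `S(R¹ p²) α R² p¹`. -/
def drinfeldElt : E := Q.alphaForm π (mulFlip π R Q.pR)

/-- The map `a ⊗ b ↦ (h ⊗ x ↦ S⁻²(a h) b x)`. -/
def drinfeldInvForm : H ⊗[k] H →ₗ[k] H ⊗[k] E →ₗ[k] E :=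
  TensorProduct.lift (LinearMap.mk₂ k (fun a b => LinearMap.mul' k E ∘ₗ
      TensorProduct.map (π.toLinearMap ∘ₗ LinearMap.mulRight k b ∘ₗ Q.Sinv ∘ₗ Q.Sinv ∘ₗ
        LinearMap.mulLeft k a) LinearMap.id)
    (by intros; ext; simp [add_mul])
    (by intros; ext; simp)
    (by intros; ext; simp [add_mul, mul_add])
    (by intros; ext; simp))

theorem drinfeldInvForm_tmul (a b h : H) (x : E) :
    Q.drinfeldInvForm π (a ⊗ₜ b) (h ⊗ₜ x) = π (Q.Sinv (Q.Sinv (a * h)) * b) * x := by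
  simp [drinfeldInvForm]

/-- The element `S⁻²(q¹ R¹ p²) q² R² p¹`. -/
def drinfeldInv : E := Q.drinfeldInvForm π Q.qR (mulFlip π R Q.pR)

/-- The map `a ⊗ b ↦ S(b) x a`. -/
def conjForm (x : E) : H ⊗[k] H →ₗ[k] E :=
  LinearMap.mul' k E ∘ₗ TensorProduct.map (π.toLinearMap ∘ₗ Q.S)
    (LinearMap.mulLeft k x ∘ₗ π.toLinearMap) ∘ₗ (TensorProduct.comm k H H).toLinearMap

theorem conjForm_tmul (x : E) (a b : H) : Q.conjForm π x (a ⊗ₜ b) = π (Q.S b) * (x * π a) := by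
  simp [conjForm]

theorem alphaForm_mulFlip (t : H ⊗[k] H) :
    Q.alphaForm π (mulFlip π R t) = Q.conjForm π (Q.alphaForm π R) t := by
  induction R using tensor_induction_two with
  | add r s hr hs =>
    have : ∀ x y : E, Q.conjForm π (x + y) = Q.conjForm π x + Q.conjForm π y := by
      intro x y; ext; simp [conjForm_tmul, add_mul, mul_add]
    rw [map_add, this, LinearMap.add_apply, ← hr, ← hs]
    simp only [mulFlip, add_mul, map_add]
  | tmul h x =>
    induction t using tensor_induction_two with
    | add r s hr hs => rw [map_add, ← hr, ← hs]; simp only [mulFlip, map_add, mul_add]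
    | tmul a b => simp [mulFlip_tmul, alphaForm_tmul, conjForm_tmul, Q.S_mul, mul_assoc]

theorem drinfeldElt_eq : Q.drinfeldElt π R = Q.conjForm π (Q.alphaForm π R) Q.pR :=
  Q.alphaForm_mulFlip π R _

theorem alphaForm_comul_mul (h : H) :
    Q.alphaForm π (Q.conv (legL k H E) ((legR k H E).comp π) h * R) =
      Q.counit h • Q.alphaForm π R := by
  induction R using tensor_induction_two with
  | add r s hr hs => simp only [mul_add, map_add, smul_add, hr, hs]
  | tmul a x =>
    have : ∀ t : H ⊗[k] H, Q.alphaForm π (pairHom (legL k H E) ((legR k H E).comp π) t * a ⊗ₜ x) =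
        π (Q.S a * sandwichLeft Q.S Q.alpha t) * x := by
      intro t
      induction t using tensor_induction_two with
      | add r s hr hs => simp only [add_mul, mul_add, map_add, hr, hs]
      | tmul b c => simp [alphaForm_tmul, sandwichLeft_tmul, Q.S_mul, mul_assoc]
    rw [conv_apply, this, sandwichLeft_comul, alphaForm_tmul]
    simp

variable {π R} (hR : Q.IsYDElement π R)

include hR

/-- The commutation axiom moves the coproduct from the right of R to its left, where α absorbs it.
Hence a ⊗ b ↦ S(b)S(R¹)αR²a is one of the forms to which the exchange rules for p_R apply. -/
theorem conjForm_comul (h : H) :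
    Q.conjForm π (Q.alphaForm π R) (Q.comul h) = Q.counit h • Q.alphaForm π R := by
  rw [← alphaForm_mulFlip, mulFlip, ← conv_apply, ← hR.compat, alphaForm_comul_mul]

omit hR in
theorem conjForm_mul (x : E) (s t : H ⊗[k] H) :
    Q.conjForm π x (s * t) = Q.conjForm π (Q.conjForm π x s) t := by
  induction t using tensor_induction_two with
  | add r s hr hs => simp only [mul_add, map_add, hr, hs]
  | tmul a b =>
    rw [conjForm_tmul]
    induction s using tensor_induction_two with
    | add r s hr hs => simp only [add_mul, mul_add, map_add, hr, hs]
    | tmul c d => simp [conjForm_tmul, Q.S_mul, mul_assoc]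

theorem leftEq_conjForm : LeftEq (Q.conjForm π (Q.alphaForm π R))
    (Q.conv (legL k H H) (legR k H H)) (Q.unitHom _) := by
  intro h y
  rw [conv_apply, pairHom_legL_legR, AlgHom.id_apply, unitHom_apply, ← Algebra.smul_def, map_smul,
    conjForm_mul, Q.conjForm_comul hR]
  induction y using tensor_induction_two with
  | add r s hr hs => simp only [map_add, smul_add, hr, hs]
  | tmul a b => simp [conjForm_tmul]

/-- The value of the conjugation form at p_R is the Drinfeld element. The rule that trades h in the
first component of p_R for S(h) in the second gives this relation, and the rule for p²α gives the
next one. -/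
theorem drinfeldElt_mul (h : H) :
    Q.drinfeldElt π R * π h = π (Q.S (Q.S h)) * Q.drinfeldElt π R := by
  have h1 := Q.pR_mul_left (Q.leftEq_conjForm hR) h
  rw [conjForm_mul, conjForm_mul, ← drinfeldElt_eq, conjForm_tmul, conjForm_tmul] at h1
  simpa [Q.S_one] using h1

theorem S_alpha_mul_drinfeldElt : π (Q.S Q.alpha) * Q.drinfeldElt π R = Q.alphaForm π R := by
  have h1 := Q.pR_mul_alpha (Q.leftEq_conjForm hR)
  rw [conjForm_mul, ← drinfeldElt_eq, Algebra.TensorProduct.one_def, conjForm_tmul,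
    conjForm_tmul] at h1
  simpa [Q.S_one] using h1

end QuasiHopfAlgebra

/-! ### Right invertibility of the Drinfeld element. -/

namespace QuasiHopfAlgebra

variable {k H : Type*} [Field k] [Ring H] [Algebra k H] (Q : QuasiHopfAlgebra k H)
variable {E : Type*} [Ring E] [Algebra k E] (π : H →ₐ[k] E) (R : H ⊗[k] E)

/-- The map `a ⊗ b ⊗ x ↦ a β S(b) α x`. -/
def betaAlphaForm : H ⊗[k] (H ⊗[k] E) →ₗ[k] E :=
  LinearMap.mul' k E ∘ₗ
    TensorProduct.map (π.toLinearMap ∘ₗ LinearMap.mulRight k Q.beta) (Q.alphaForm π)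

theorem betaAlphaForm_tmul (a b : H) (x : E) :
    Q.betaAlphaForm π (a ⊗ₜ (b ⊗ₜ x)) = π (a * Q.beta) * (π (Q.S b * Q.alpha) * x) := by
  simp [betaAlphaForm, alphaForm_tmul]

theorem rightEq_betaAlphaForm : RightEq (Q.betaAlphaForm π)
    (Q.conv (outLeg₁ k H E) (outLeg₂ k H E)) (Q.unitHom _) := by
  intro h y
  rw [unitHom_apply, ← Algebra.commutes, ← Algebra.smul_def, map_smul, conv_apply]
  induction y using tensor_induction_three with
  | add s t hs ht => simp only [add_mul, map_add, smul_add, hs, ht]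
  | tmul a b x =>
    have : ∀ d : H ⊗[k] H, Q.betaAlphaForm π
        (a ⊗ₜ (b ⊗ₜ x) * pairHom (outLeg₁ k H E) (outLeg₂ k H E) d) =
        π (a * sandwichRight Q.S Q.beta d * Q.S b * Q.alpha) * x := by
      intro d
      induction d using tensor_induction_two with
      | add s t hs ht => simp only [add_mul, mul_add, map_add, hs, ht]
      | tmul c d => simp [betaAlphaForm_tmul, sandwichRight_tmul, Q.S_mul, mul_assoc]
    rw [this, sandwichRight_comul, betaAlphaForm_tmul]
    simp [mul_assoc]

/-- The map `a ⊗ b ⊗ c ↦ (h ⊗ x ↦ a h S(c) y b x)`. -/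
def outerForm (y : E) : H ⊗[k] (H ⊗[k] H) →ₗ[k] H ⊗[k] E →ₗ[k] E :=
  TensorProduct.lift (LinearMap.mk₂ k (fun a t => LinearMap.mul' k E ∘ₗ
      TensorProduct.map (LinearMap.mulRight k (Q.conjForm π y t) ∘ₗ π.toLinearMap ∘ₗ
        LinearMap.mulLeft k a) LinearMap.id)
    (by intros; ext; simp [add_mul])
    (by intros; ext; simp)
    (by intros; ext; simp [add_mul, mul_add])
    (by intros; ext; simp))

theorem outerForm_tmul (y : E) (a b c h : H) (x : E) :
    Q.outerForm π y (a ⊗ₜ (b ⊗ₜ c)) (h ⊗ₜ x) = π (a * h) * (π (Q.S c) * (y * π b)) * x := by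
  simp [outerForm, conjForm_tmul, mul_assoc]

theorem outerForm_add (y y' : E) :
    Q.outerForm π (y + y') = Q.outerForm π y + Q.outerForm π y' := by
  refine LinearMap.ext fun t => ?_
  induction t using tensor_induction_three with
  | add r s hr hs => rw [map_add, hr, hs, map_add]
  | tmul a b c =>
    ext
    simp [outerForm_tmul, add_mul, mul_add]

variable {π R} (hR : Q.IsYDElement π R)

include hR

/-- The expression is the left side of the hexagon, multiplied by Φ⁻¹ and evaluated with a ⊗ b ⊗ x ↦
aβS(b)αx. On the right side the coproduct of R¹ in the first two legs is absorbed by β, the counit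
condition removes R, and X¹βS(X²)αX³ = 1 remains. -/
theorem outerForm_Phi : Q.outerForm π (Q.alphaForm π R) Q.Phi (mulFlip π R Q.pR) = 1 := by
  have key : ∀ (R' R : H ⊗[k] E) (t s : H ⊗[k] (H ⊗[k] H)), Q.betaAlphaForm π
      (pairHom (outLeg₂ k H E) (outLeg₃ k H E) R' *
        pairHom (outLeg₁ k H E) (pairHom ((outLeg₃ k H E).comp π) (outLeg₂ k H E)) t *
        pairHom (outLeg₁ k H E) (outLeg₃ k H E) R *
        pairHom ((outLeg₃ k H E).comp π) (pairHom (outLeg₁ k H E) (outLeg₂ k H E)) s) =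
      Q.outerForm π (Q.alphaForm π R') t
        (mulFlip π R (TensorProduct.map LinearMap.id (sandwichRight Q.S Q.beta) s)) := by
    intro R' R t s
    induction R' using tensor_induction_two with
    | add a b ha hb =>
      rw [map_add (Q.alphaForm π), outerForm_add]
      simp only [add_mul, map_add, LinearMap.add_apply, ha, hb]
    | tmul h' x' =>
    induction t using tensor_induction_three with
    | add a b ha hb => simp only [add_mul, mul_add, map_add, LinearMap.add_apply, ha, hb]
    | tmul t₁ t₂ t₃ =>
    induction R using tensor_induction_two with
    | add a b ha hb =>
      simp only [mulFlip, add_mul, mul_add, map_add] at ha hb ⊢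
      rw [ha, hb]
    | tmul h x =>
    induction s using tensor_induction_three with
    | add a b ha hb => simp only [mulFlip, mul_add, map_add] at ha hb ⊢; rw [ha, hb]
    | tmul s₁ s₂ s₃ =>
      simp [betaAlphaForm_tmul, mulFlip_tmul, outerForm_tmul, alphaForm_tmul, sandwichRight_tmul,
        Q.S_mul, mul_assoc]
  have h := key R R Q.Phi Q.PhiInv
  rw [pR, ← h]
  change Q.betaAlphaForm π (_ * Q.asc (outLeg₁ k H E) ((outLeg₃ k H E).comp π) (outLeg₂ k H E) *
    _ * Q.ascInv ((outLeg₃ k H E).comp π) (outLeg₁ k H E) (outLeg₂ k H E)) = 1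
  rw [hR.hexagon_mul, mul_assoc, asc_mul_ascInv, mul_one,
    (Q.rightEq_betaAlphaForm π).pair_left (outLeg₃ k H E), hR.pair_unit, mul_one]
  have h2 : ∀ t, Q.betaAlphaForm π
      (pairHom (outLeg₁ k H E) (pairHom (outLeg₂ k H E) ((outLeg₃ k H E).comp π)) t) =
      π (Q.betaAlpha t) := by
    intro t
    induction t using tensor_induction_three with
    | add a b ha hb => simp only [map_add, ha, hb]
    | tmul a b c => simp [betaAlphaForm_tmul, betaAlpha_tmul]
  rw [asc, h2, betaAlpha_Phi, map_one]

theorem drinfeldElt_mul_Sinv (h : H) :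
    Q.drinfeldElt π R * π (Q.Sinv (Q.Sinv h)) = π h * Q.drinfeldElt π R := by
  rw [Q.drinfeldElt_mul hR, S_Sinv, S_Sinv]

/-- Moving the Drinfeld element u to the right turns S⁻² into the identity and S⁻¹(αX³) into
S(X³)S(α). There S(α)u = S(R¹)αR² applies, and the product is the expression of `outerForm_Phi`. -/
theorem drinfeldElt_mul_drinfeldInv : Q.drinfeldElt π R * Q.drinfeldInv π R = 1 := by
  have key : ∀ (t : H ⊗[k] (H ⊗[k] H)) (z : H ⊗[k] E), Q.drinfeldElt π R *
      Q.drinfeldInvForm π (TensorProduct.map LinearMap.id Q.qRAux t) z =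
      Q.outerForm π (Q.alphaForm π R) t z := by
    intro t z
    induction t using tensor_induction_three with
    | add a b ha hb => simp only [map_add, LinearMap.add_apply, mul_add, ha, hb]
    | tmul a b c =>
    induction z using tensor_induction_two with
    | add a b ha hb => simp only [map_add, mul_add, ha, hb]
    | tmul h x =>
      rw [TensorProduct.map_tmul, drinfeldInvForm_tmul, outerForm_tmul, LinearMap.id_apply,
        qRAux_tmul, map_mul, ← mul_assoc, ← mul_assoc, Q.drinfeldElt_mul_Sinv hR, mul_assoc (π _),
        Q.drinfeldElt_mul hR, Q.S_mul, S_Sinv, Q.S_mul, Q.S_mul]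
      congr 1
      simp only [map_mul, mul_assoc]
      rw [← Q.drinfeldElt_mul hR, ← mul_assoc (π (Q.S Q.alpha)), S_alpha_mul_drinfeldElt _ hR]
  rw [drinfeldInv, qR, key, Q.outerForm_Phi hR]

end QuasiHopfAlgebra

/-! ### Braidings with dual legs: cancellation along evaluations. -/

namespace QuasiHopfAlgebra

variable {k H : Type*} [Field k] [Ring H] [Algebra k H] {Q : QuasiHopfAlgebra k H}
variable {E : Type*} [Ring E] [Algebra k E] {π : H →ₐ[k] E} {R : H ⊗[k] E}

namespace IsYDElement

variable {B W : Type*} [Ring B] [Algebra k B] [AddCommGroup W] [Module k W] {w : B →ₗ[k] W}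

section

variable (hR : Q.IsYDElement π R) (l d n : H →ₐ[k] B) (e : E →ₐ[k] B) {t : B}
  [Commuting l d] [Commuting l n] [Commuting l e] [Commuting d n] [Commuting d e] [Commuting n e]

include hR

/-- The dual braiding `t` cancels the braiding `R` along the evaluations `d (e ∘ π) → 1` and
`l n → 1`. -/
theorem dual_braiding_cancel (hln : LeftEq w (Q.conv l n) (Q.unitHom B))
    (hde : LeftEq w (Q.conv d (e.comp π)) (Q.unitHom B))
    (htn : ∀ h, t * n h = n h * t) (hte : ∀ x, t * e x = e x * t)
    (htl : ∀ h, t * Q.conv d l h = Q.conv l d h * t)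
    (hγ : ∀ y, w (Q.asc l d (e.comp π) * (Q.ascInv (Q.conv l d) (e.comp π) n * (t * y))) =
      w (Q.asc d l n * (Q.ascInv (Q.conv d l) n (e.comp π) * (pairHom n e R * y)))) (y : B) :
    w (Q.asc l d (e.comp π) * (t * (Q.ascInv d l (e.comp π) * (pairHom l e R * y)))) =
      w (Q.ascInv d (e.comp π) l * y) := by
  have htm : ∀ h, t * (e.comp π) h = (e.comp π) h * t := fun h => hte (π h)
  have h1 : t * Q.asc (Q.conv d l) (e.comp π) n = Q.asc (Q.conv l d) (e.comp π) n * t :=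
    Q.asc_intertwine htl htm htn
  have h2 : ∀ z, t * z = Q.ascInv (Q.conv l d) (e.comp π) n *
      (t * (Q.asc (Q.conv d l) (e.comp π) n * z)) := by
    intro z
    rw [← mul_assoc t, h1, mul_assoc, ascInv_mul_asc_mul]
  have h3 : pairHom n e R * Q.ascInv d l (Q.conv (e.comp π) n) =
      Q.ascInv d l (Q.conv n (e.comp π)) * pairHom n e R :=
    Q.ascInv_intertwine (fun x => (Commuting.comm (a := pairHom n e) (b := d) R x).eq)
      (fun x => (Commuting.comm (a := pairHom n e) (b := l) R x).eq)
      (fun x => (hR.conv_mul n e x).symm)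
  have h4 : pairHom l e R * Q.asc d (Q.conv (e.comp π) l) n =
      Q.asc d (Q.conv l (e.comp π)) n * pairHom l e R :=
    Q.asc_intertwine (fun x => (Commuting.comm (a := pairHom l e) (b := d) R x).eq)
      (fun x => (hR.conv_mul l e x).symm)
      (fun x => (Commuting.comm (a := pairHom l e) (b := n) R x).eq)
  have h5 : Q.asc d l n * (Q.ascInv (Q.conv d l) n (e.comp π) *
      Q.ascInv d l (Q.conv n (e.comp π))) =
      Q.ascInv d (Q.conv l n) (e.comp π) * Q.ascInv l n (e.comp π) := by
    rw [← pentagon_inv, asc_mul_ascInv_mul]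
  have h6 : Q.asc (Q.conv d l) (e.comp π) n * Q.ascInv d l (e.comp π) =
      Q.ascInv d l (Q.conv (e.comp π) n) * (Q.asc l (e.comp π) n *
        Q.asc d (Q.conv l (e.comp π)) n) := Q.pentagon_three d l (e.comp π) n
  have h7 : Q.asc (e.comp π) l n * Q.asc d (Q.conv (e.comp π) l) n =
      Q.asc d (e.comp π) (Q.conv l n) * (Q.asc (Q.conv d (e.comp π)) l n *
        Q.ascInv d (e.comp π) l) := by
    have := Q.pentagon d (e.comp π) l n
    calc _ = Q.asc (e.comp π) l n * Q.asc d (Q.conv (e.comp π) l) n * Q.asc d (e.comp π) l *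
          Q.ascInv d (e.comp π) l := by simp only [mul_assoc, asc_mul_ascInv, mul_one]
      _ = _ := by rw [this, mul_assoc]
  -- Under the evaluations, `hγ` replaces the dual braiding by the braiding of `n` with `e`. After
  -- rebracketing, the two braidings of `e`, with `n` and with `l`, are joined by the hexagon into
  -- one with the product of `l` and `n`. That product is contracted, so the counit condition
  -- removes the braiding.
  calc w (Q.asc l d (e.comp π) * (t * (Q.ascInv d l (e.comp π) * (pairHom l e R * y))))
      = w (Q.asc d l n * (Q.ascInv (Q.conv d l) n (e.comp π) * (pairHom n e R *
          ((Q.asc (Q.conv d l) (e.comp π) n * Q.ascInv d l (e.comp π)) *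
            (pairHom l e R * y))))) := by
        rw [h2 (Q.ascInv d l (e.comp π) * _), hγ]; simp only [mul_assoc]
    _ = w ((Q.asc d l n * (Q.ascInv (Q.conv d l) n (e.comp π) *
          Q.ascInv d l (Q.conv n (e.comp π)))) * (pairHom n e R * (Q.asc l (e.comp π) n *
            ((Q.asc d (Q.conv l (e.comp π)) n * pairHom l e R) * y)))) := by
        rw [h6, ← mul_assoc (pairHom n e R), ← mul_assoc (pairHom n e R), h3]
        simp only [mul_assoc]
    _ = w (Q.ascInv d (Q.conv l n) (e.comp π) * (Q.ascInv l n (e.comp π) *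
          ((pairHom n e R * Q.asc l (e.comp π) n * pairHom l e R) *
            (Q.asc d (Q.conv (e.comp π) l) n * y)))) := by
        rw [h5, ← h4]; simp only [mul_assoc]
    _ = w (pairHom (Q.conv l n) e R * ((Q.asc (e.comp π) l n *
            Q.asc d (Q.conv (e.comp π) l) n) * y)) := by
        rw [Q.leftEq_ascInv_snd d (e.comp π) hln, ascInv_unit_mid, one_mul, hR.hexagon_mul l n e]
        simp only [mul_assoc, ascInv_mul_asc_mul]
    _ = w (Q.asc d (e.comp π) (Q.conv l n) * (Q.asc (Q.conv d (e.comp π)) l n *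
        (Q.ascInv d (e.comp π) l * y))) := by
        rw [hln.pair_left e, hR.pair_unit, one_mul, h7]; simp only [mul_assoc]
    _ = _ := by
        rw [Q.leftEq_asc_trd d (e.comp π) hln, asc_unit_right, one_mul,
          Q.leftEq_asc_fst l n hde, asc_unit_left, one_mul]

/-- The factors of p in front of the word can be moved behind it. Those in `n` commute with
everything. A factor in `l` is completed to an iterated coproduct on `l`, `d` and `e`, which changes
nothing because `d` and `e` contract; both words intertwine this coproduct. With p = p_R this
removes α from the evaluation of `n` against `l`. -/
theorem dual_braiding_cancel_of_eq {w' : B →ₗ[k] W} {p : H ⊗[k] H}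
    (hw : ∀ z, w' z = w (pairHom l n p * z))
    (hde : LeftEq w (Q.conv d (e.comp π)) (Q.unitHom B))
    (htn : ∀ h, t * n h = n h * t) (hte : ∀ x, t * e x = e x * t)
    (htl : ∀ h, t * Q.conv d l h = Q.conv l d h * t)
    (h : ∀ y, w (Q.asc l d (e.comp π) * (t * (Q.ascInv d l (e.comp π) * (pairHom l e R * y)))) =
      w (Q.ascInv d (e.comp π) l * y)) (y : B) :
    w' (Q.asc l d (e.comp π) * (t * (Q.ascInv d l (e.comp π) * (pairHom l e R * y)))) =
      w' (Q.ascInv d (e.comp π) l * y) := by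
  have htm : ∀ h, t * (e.comp π) h = (e.comp π) h * t := fun h => hte (π h)
  set X := Q.asc l d (e.comp π) * (t * (Q.ascInv d l (e.comp π) * pairHom l e R)) with hX
  have hX' : ∀ z, Q.asc l d (e.comp π) * (t * (Q.ascInv d l (e.comp π) * (pairHom l e R * z))) =
      X * z := by intro z; simp only [hX, mul_assoc]
  simp only [hX'] at h ⊢
  have hXn : ∀ x, X * n x = n x * X := by
    intro x
    have h1 := (Commuting.comm (a := pairHom l e) (b := n) R x).eq
    rw [hX, mul_assoc, mul_assoc, mul_assoc, h1, ← mul_assoc (Q.ascInv _ _ _), Q.ascInv_comm n,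
      mul_assoc, ← mul_assoc t, htn, mul_assoc, ← mul_assoc (Q.asc _ _ _), Q.asc_comm n, mul_assoc]
  have hXl : ∀ x, Q.conv l (Q.conv d (e.comp π)) x * X = X * Q.conv d (Q.conv (e.comp π) l) x := by
    intro x
    have h1 : t * Q.conv (Q.conv d l) (e.comp π) x = Q.conv (Q.conv l d) (e.comp π) x * t :=
      Q.conv_intertwine htl htm x
    have h2 : pairHom l e R * Q.conv d (Q.conv (e.comp π) l) x =
        Q.conv d (Q.conv l (e.comp π)) x * pairHom l e R :=
      Q.conv_intertwine (fun x => (Commuting.comm (a := pairHom l e) (b := d) R x).eq)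
        (fun x => (hR.conv_mul l e x).symm) x
    rw [hX, ← mul_assoc, conv_asc, mul_assoc, ← mul_assoc _ t, ← h1, mul_assoc t,
      ← mul_assoc _ (Q.ascInv _ _ _), conv_ascInv, mul_assoc (Q.ascInv _ _ _), ← h2]
    simp only [mul_assoc]
  have hYn : ∀ x, Q.ascInv d (e.comp π) l * n x = n x * Q.ascInv d (e.comp π) l :=
    Q.ascInv_comm n
  have hl1 : ∀ x z, w (l x * z) = w (Q.conv l (Q.conv d (e.comp π)) x * z) :=
    fun x z => (Q.leftEq_conv_unit_right l hde x z).symm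
  have hl2 : ∀ x z, w (l x * z) = w (Q.conv (Q.conv d (e.comp π)) l x * z) :=
    fun x z => (Q.leftEq_conv_unit_left l hde x z).symm
  clear_value X
  rw [hw, hw]
  clear hw
  induction p using tensor_induction_two with
  | add s t hs ht => simp only [map_add, add_mul, hs, ht]
  | tmul a b =>
    rw [pairHom_tmul, mul_assoc, mul_assoc, ← mul_assoc (n b), ← hXn, ← mul_assoc (n b), ← hYn, hl1,
      hl2, mul_assoc, mul_assoc, ← mul_assoc _ X, hXl, mul_assoc X, h,
      ← mul_assoc _ (Q.ascInv _ _ _),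
      conv_ascInv, mul_assoc]

end

section

variable (hR : Q.IsYDElement π R) (l d : H →ₐ[k] B) (e : E →ₐ[k] B) {t : B}
  [Commuting l d] [Commuting l e] [Commuting d e]

include hR

/-- The hexagon joins the two braidings of `e` into one with the product of `l` and `d`. There `t`
may pass, exchanging the order of the product, and a second hexagon separates the braidings again.
-/
theorem dual_braiding_cancel_braided (hte : ∀ x, t * e x = e x * t)
    (htl : ∀ h, t * Q.conv d l h = Q.conv l d h * t)
    (h : ∀ y, w (Q.asc l d (e.comp π) * (t * (Q.ascInv d l (e.comp π) * (pairHom l e R * y)))) =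
      w (Q.ascInv d (e.comp π) l * y)) (y : B) :
    w (pairHom d e R * (Q.asc l (e.comp π) d * (pairHom l e R * (Q.ascInv (e.comp π) l d *
      (t * y))))) = w (pairHom d e R * (Q.ascInv (e.comp π) d l * y)) := by
  have h1 := hR.hexagon_mul l d e
  have h2 := hR.hexagon_mul d l e
  have h3 : t * pairHom (Q.conv d l) e R = pairHom (Q.conv l d) e R * t :=
    pairHom_intertwine htl hte R
  have h4 : pairHom (Q.conv d l) e R = Q.ascInv d l (e.comp π) * (pairHom l e R *
      (Q.asc d (e.comp π) l * (pairHom d e R * Q.ascInv (e.comp π) d l))) := by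
    calc _ = Q.ascInv d l (e.comp π) * (Q.asc d l (e.comp π) * pairHom (Q.conv d l) e R *
          Q.asc (e.comp π) d l) * Q.ascInv (e.comp π) d l := by
          simp only [mul_assoc, asc_mul_ascInv, mul_one, ascInv_mul_asc_mul]
      _ = _ := by rw [← h2]; simp only [mul_assoc]
  calc _ = w ((pairHom d e R * Q.asc l (e.comp π) d * pairHom l e R) *
        (Q.ascInv (e.comp π) l d * (t * y))) := by simp only [mul_assoc]
    _ = w (Q.asc l d (e.comp π) * ((pairHom (Q.conv l d) e R * t) * y)) := by
        rw [h1]; simp only [mul_assoc, asc_mul_ascInv_mul]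
    _ = w (Q.asc l d (e.comp π) * (t * (Q.ascInv d l (e.comp π) * (pairHom l e R *
      (Q.asc d (e.comp π) l * (pairHom d e R * (Q.ascInv (e.comp π) d l * y))))))) := by
        rw [← h3, h4]; simp only [mul_assoc]
    _ = _ := by rw [h, ascInv_mul_asc_mul]

end

section

variable (hR : Q.IsYDElement π R) (n l d : H →ₐ[k] B) (e : E →ₐ[k] B) {t : B}
  [Commuting l d] [Commuting n l] [Commuting l e] [Commuting n d] [Commuting d e] [Commuting n e]

include hR

theorem braiding_through_evaluation (hnl : LeftEq w (Q.conv n l) (Q.unitHom B))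
    (hed : LeftEq w (Q.conv (e.comp π) d) (Q.unitHom B))
    (htn : ∀ h, t * n h = n h * t) (hte : ∀ x, t * e x = e x * t)
    (htl : ∀ h, t * Q.conv d l h = Q.conv l d h * t)
    (h : ∀ y, w (Q.asc l (e.comp π) d * (pairHom l e R * (Q.ascInv (e.comp π) l d *
      (t * y)))) = w (Q.ascInv (e.comp π) d l * y)) (y : B) :
    w (Q.asc (e.comp π) n l * (Q.ascInv (Q.conv (e.comp π) n) l d * (t * y))) =
      w (Q.asc n (e.comp π) d * (Q.ascInv (Q.conv n (e.comp π)) d l * (pairHom n e R * y))) := by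
  have htm : ∀ h, t * (e.comp π) h = (e.comp π) h * t := fun h => hte (π h)
  have h1 := hR.hexagon_mul n l e
  have h2 : pairHom (Q.conv n l) e R * Q.asc (e.comp π) n l = Q.ascInv n l (e.comp π) *
      (pairHom l e R * (Q.asc n (e.comp π) l * pairHom n e R)) := by
    rw [← mul_assoc (pairHom l e R), h1]; simp only [mul_assoc, ascInv_mul_asc_mul]
  have h3 : pairHom n e R * Q.ascInv (Q.conv (e.comp π) n) l d =
      Q.ascInv (Q.conv n (e.comp π)) l d * pairHom n e R :=
    Q.ascInv_intertwine (fun x => (hR.conv_mul n e x).symm)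
      (fun x => (Commuting.comm (a := pairHom n e) (b := l) R x).eq)
      (fun x => (Commuting.comm (a := pairHom n e) (b := d) R x).eq)
  have h4 : t * pairHom n e R = pairHom n e R * t := pairHom_intertwine htn hte R
  have h5 : pairHom l e R * Q.ascInv n (Q.conv (e.comp π) l) d =
      Q.ascInv n (Q.conv l (e.comp π)) d * pairHom l e R :=
    Q.ascInv_intertwine (fun x => (Commuting.comm (a := pairHom l e) (b := n) R x).eq)
      (fun x => (hR.conv_mul l e x).symm)
      (fun x => (Commuting.comm (a := pairHom l e) (b := d) R x).eq)
  have h6 : t * Q.asc n (e.comp π) (Q.conv d l) = Q.asc n (e.comp π) (Q.conv l d) * t :=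
    Q.asc_intertwine htn htm htl
  have h7 : Q.ascInv n l (e.comp π) * Q.ascInv n (Q.conv l (e.comp π)) d =
      Q.ascInv (Q.conv n l) (e.comp π) d * (Q.ascInv n l (Q.conv (e.comp π) d) *
        Q.asc l (e.comp π) d) := by
    rw [← mul_assoc, ← pentagon_inv]; simp only [mul_assoc, ascInv_mul_asc, mul_one]
  -- The braiding of `e` with the contracted product of `n` and `l` is inserted for free. Its
  -- hexagon yields one braiding with `n`, which is kept, and one with `l`, which `h` cancels
  -- against `t`.
  calc _ = w (pairHom (Q.conv n l) e R * (Q.asc (e.comp π) n l *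
        (Q.ascInv (Q.conv (e.comp π) n) l d * (t * y)))) := by
        rw [hnl.pair_left e, hR.pair_unit, one_mul]
    _ = w (Q.ascInv n l (e.comp π) * (pairHom l e R * (Q.asc n (e.comp π) l *
        ((pairHom n e R * Q.ascInv (Q.conv (e.comp π) n) l d) * (t * y))))) := by
        rw [← mul_assoc (pairHom (Q.conv n l) e R), h2]; simp only [mul_assoc]
    _ = w (Q.ascInv n l (e.comp π) * (pairHom l e R * ((Q.asc n (e.comp π) l *
        Q.ascInv (Q.conv n (e.comp π)) l d) * (t * (pairHom n e R * y))))) := by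
        rw [h3, mul_assoc, ← mul_assoc _ t y, ← h4]; simp only [mul_assoc]
    _ = w (Q.ascInv n l (e.comp π) * ((pairHom l e R * Q.ascInv n (Q.conv (e.comp π) l) d) *
        (Q.ascInv (e.comp π) l d * ((Q.asc n (e.comp π) (Q.conv l d) * t) *
          (pairHom n e R * y))))) := by
        rw [Q.pentagon_four n (e.comp π) l d]; simp only [mul_assoc]
    _ = w ((Q.ascInv n l (e.comp π) * Q.ascInv n (Q.conv l (e.comp π)) d) * (pairHom l e R *
        (Q.ascInv (e.comp π) l d * (t * (Q.asc n (e.comp π) (Q.conv d l) *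
          (pairHom n e R * y)))))) := by
        rw [h5, ← h6]; simp only [mul_assoc]
    _ = w (Q.asc l (e.comp π) d * (pairHom l e R *
        (Q.ascInv (e.comp π) l d * (t * (Q.asc n (e.comp π) (Q.conv d l) *
          (pairHom n e R * y)))))) := by
        rw [h7, mul_assoc, mul_assoc, Q.leftEq_ascInv_fst (e.comp π) d hnl, ascInv_unit_left,
          one_mul, Q.leftEq_ascInv_trd n l hed, ascInv_unit_right, one_mul]
    _ = w (Q.asc n (Q.conv (e.comp π) d) l * ((Q.asc n (e.comp π) d *
          Q.ascInv (Q.conv n (e.comp π)) d l) * (pairHom n e R * y))) := by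
        rw [h, ← mul_assoc, Q.pentagon_two n (e.comp π) d l]; simp only [mul_assoc]
    _ = _ := by
        rw [Q.leftEq_asc_snd n l hed, asc_unit_mid, one_mul]; simp only [mul_assoc]

end

end IsYDElement

end QuasiHopfAlgebra

/-! ### The twisted element f¹R¹g² ⊗ f²R²g¹, and conjugation of R by 𝓕. -/

section Multiplications

variable {k A A' H W : Type*} [Field k] [Ring A] [Algebra k A] [Ring A'] [Algebra k A'] [Ring H]
  [Algebra k H]

/-- Right multiplication as an algebra map to the opposite of the endomorphism algebra. -/
def rightMulHom (k A : Type*) [Field k] [Ring A] [Algebra k A] :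
    A →ₐ[k] (Module.End k A)ᵐᵒᵖ :=
  AlgHom.ofLinearMap ((MulOpposite.opLinearEquiv k).toLinearMap ∘ₗ (LinearMap.mul k A).flip)
    (by
      apply MulOpposite.unop_injective
      ext; simp)
    (by
      intro x y
      apply MulOpposite.unop_injective
      ext; simp [mul_assoc])

/-- Left multiplication by the values of an antihomomorphism. -/
def leftMulHom (s : H →ₗ[k] A) (h1 : s 1 = 1) (hm : ∀ x y, s (x * y) = s y * s x) :
    H →ₐ[k] (Module.End k A)ᵐᵒᵖ :=
  AlgHom.ofLinearMap ((MulOpposite.opLinearEquiv k).toLinearMap ∘ₗ LinearMap.mul k A ∘ₗ s)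
    (by
      apply MulOpposite.unop_injective
      ext; simp [h1])
    (by
      intro x y
      apply MulOpposite.unop_injective
      ext; simp [hm, mul_assoc])

@[simp] theorem unop_rightMulHom_apply (a c : A) :
    (rightMulHom k A a).unop c = c * a := by simp [rightMulHom]

@[simp] theorem unop_leftMulHom_apply (s : H →ₗ[k] A) (h1 : s 1 = 1)
    (hm : ∀ x y, s (x * y) = s y * s x) (h : H) (c : A) :
    (leftMulHom s h1 hm h).unop c = s h * c := by simp [leftMulHom]

instance (s : H →ₗ[k] A) (h1 : s 1 = 1) (hm : ∀ x y, s (x * y) = s y * s x) (g : A' →ₐ[k] A) :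
    Commuting (leftMulHom s h1 hm) ((rightMulHom k A).comp g) := by
  refine ⟨fun x y => ?_⟩
  apply MulOpposite.unop_injective
  ext c
  simp [mul_assoc]

/-- Evaluation of opposite endomorphisms at `c`. -/
def evalAt (c : A) : (Module.End k A)ᵐᵒᵖ →ₗ[k] A :=
  LinearMap.applyₗ c ∘ₗ (MulOpposite.opLinearEquiv k).symm.toLinearMap

theorem evalAt_apply (c : A) (x : (Module.End k A)ᵐᵒᵖ) : evalAt c x = x.unop c := rfl

end Multiplications

namespace QuasiHopfAlgebra

variable {k H : Type*} [Field k] [Ring H] [Algebra k H] (Q : QuasiHopfAlgebra k H)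
variable {E : Type*} [Ring E] [Algebra k E] (π : H →ₐ[k] E) (R : H ⊗[k] E)

/-- The square of the antipode. -/
def SS : H →ₐ[k] H := AlgHom.ofLinearMap (Q.S ∘ₗ Q.S) (by simp [Q.S_one]) (by simp [Q.S_mul])

@[simp] theorem SS_apply (h : H) : Q.SS h = Q.S (Q.S h) := rfl

/-- The map `h ↦ S(h) ⊗ 1`, as a family of left multiplications of `H ⊗ E`. -/
def leftS (E : Type*) [Ring E] [Algebra k E] : H →ₐ[k] (Module.End k (H ⊗[k] E))ᵐᵒᵖ :=
  leftMulHom ((legL k H E).toLinearMap ∘ₗ Q.S) (by simp [Q.S_one, Algebra.TensorProduct.one_def])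
    (by simp [Q.S_mul])

/-- The map `h ↦ 1 ⊗ S(h)`, as a family of left multiplications of `H ⊗ E`. -/
def leftS' : H →ₐ[k] (Module.End k (H ⊗[k] E))ᵐᵒᵖ :=
  leftMulHom ((legR k H E).toLinearMap ∘ₗ π.toLinearMap ∘ₗ Q.S)
    (by simp [Q.S_one, Algebra.TensorProduct.one_def]) (by simp [Q.S_mul])

/-- Right multiplications of `H ⊗ E` by elements of `H`. -/
abbrev rightH (k H E : Type*) [Field k] [Ring H] [Algebra k H] [Ring E] [Algebra k E] :
    H →ₐ[k] (Module.End k (H ⊗[k] E))ᵐᵒᵖ := (rightMulHom k (H ⊗[k] E)).comp (legL k H E)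

/-- Right multiplications of `H ⊗ E` by elements of `E`. -/
abbrev rightE (k H E : Type*) [Field k] [Ring H] [Algebra k H] [Ring E] [Algebra k E] :
    E →ₐ[k] (Module.End k (H ⊗[k] E))ᵐᵒᵖ := (rightMulHom k (H ⊗[k] E)).comp (legR k H E)

@[simp] theorem unop_leftS_tmul (h a : H) (x : E) :
    (Q.leftS E h).unop (a ⊗ₜ x) = (Q.S h * a) ⊗ₜ x := by simp [leftS]

@[simp] theorem unop_leftS'_tmul (h a : H) (x : E) :
    (Q.leftS' π h).unop (a ⊗ₜ x) = a ⊗ₜ (π (Q.S h) * x) := by simp [leftS']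

instance : Commuting (Q.leftS E) (Q.leftS' π) := by
  refine ⟨fun x y => ?_⟩
  apply MulOpposite.unop_injective
  refine LinearMap.ext fun c => ?_
  induction c using tensor_induction_two with
  | add s t hs ht => rw [map_add, hs, ht, map_add]
  | tmul a b => simp

instance {A : Type*} [Ring A] [Algebra k A] (g : A →ₐ[k] H ⊗[k] E) :
    Commuting (Q.leftS E) ((rightMulHom k (H ⊗[k] E)).comp g) := by
  unfold leftS; infer_instance

instance {A : Type*} [Ring A] [Algebra k A] (g : A →ₐ[k] H ⊗[k] E) :
    Commuting (Q.leftS' π) ((rightMulHom k (H ⊗[k] E)).comp g) := by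
  unfold leftS'; infer_instance

/-- The map `a ⊗ b ↦ a ⊗ b` from `H ⊗ H` to `H ⊗ E`. -/
abbrev incl : H ⊗[k] H →ₐ[k] H ⊗[k] E := pairHom (legL k H E) ((legR k H E).comp π)

/-- The map `a ⊗ b ↦ b ⊗ a` from `H ⊗ H` to `H ⊗ E`. -/
abbrev inclFlip : H ⊗[k] H →ₐ[k] H ⊗[k] E := pairHom ((legR k H E).comp π) (legL k H E)

/-- The element `f¹ R¹ g² ⊗ f² R² g¹`. -/
def twistElt : H ⊗[k] E := incl π Q.f * R * inclFlip π Q.fInv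

/-- The map `a ⊗ b ↦ S(a) ⊗ S(b)`. -/
def mapS : H ⊗[k] H →ₗ[k] H ⊗[k] H := TensorProduct.map Q.S Q.S

theorem mapS_tmul (a b : H) : Q.mapS (a ⊗ₜ b) = Q.S a ⊗ₜ Q.S b := by simp [mapS]

theorem mapS_mul (s t : H ⊗[k] H) : Q.mapS (s * t) = Q.mapS t * Q.mapS s := by
  induction s using tensor_induction_two with
  | add s t hs ht => simp only [add_mul, mul_add, map_add, hs, ht]
  | tmul x y =>
    induction t using tensor_induction_two with
    | add s t hs ht => simp only [add_mul, mul_add, map_add, hs, ht]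
    | tmul a b => simp [mapS_tmul, Q.S_mul]

theorem inclFlip_flipS (t : H ⊗[k] H) : inclFlip π (Q.flipS t) = incl π (Q.mapS t) := by
  induction t using tensor_induction_two with
  | add s t hs ht => simp only [map_add, hs, ht]
  | tmul a b => simp [mapS_tmul, flipS_tmul]

variable {π R} (hR : Q.IsYDElement π R)

include hR

/-- The commutation axiom for R at S(h), conjugated with the twist: f exchanges Δ(S(h)) with S(h₂) ⊗
S(h₁). -/
theorem twistElt_mul_inclFlip_coS (h : H) :
    Q.twistElt π R * inclFlip π (Q.coS h) = incl π (Q.coS h) * Q.twistElt π R := by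
  have h1 := hR.compat (Q.S h)
  rw [conv_apply, conv_apply] at h1
  rw [twistElt, mul_assoc, ← map_mul, fInv_intertwine, map_mul, mul_assoc, ← mul_assoc R, ← h1,
    ← mul_assoc, ← mul_assoc, ← mul_assoc, ← mul_assoc, ← map_mul, ← map_mul, f_intertwine]

/-- γ encodes the evaluation of a tensor product against the duals of its factors, so this says that
the twisted element is the transpose of R. It is the commutation axiom at α, since fΔ(α) = γ. -/
theorem twistElt_mul_inclFlip_gamma :
    Q.twistElt π R * inclFlip π Q.gamma = incl π Q.gamma * R := by
  have h1 := hR.compat Q.alpha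
  rw [conv_apply, conv_apply] at h1
  have h2 : Q.fInv * Q.gamma = Q.comul Q.alpha := by
    rw [← f_mul_comul_alpha, ← mul_assoc, fInv_mul_f, one_mul]
  rw [twistElt, mul_assoc, ← map_mul, h2, mul_assoc, ← h1, ← mul_assoc, ← map_mul,
    f_mul_comul_alpha]

end QuasiHopfAlgebra

theorem evalAt_mul_unop {k A : Type*} [Field k] [Ring A] [Algebra k A] (c : A)
    (x y : (Module.End k A)ᵐᵒᵖ) : evalAt c (x * y) = evalAt (x.unop c) y := rfl

/-- In the opposite of the endomorphism algebra the leftmost factor acts first, so a contraction at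
the left end only has to be checked on the vector `c`. -/
theorem leftEq_evalAt {k A H : Type*} [Field k] [Ring A] [Algebra k A] [Ring H] [Algebra k H]
    (Q : QuasiHopfAlgebra k H) {c : A} {a : H →ₐ[k] (Module.End k A)ᵐᵒᵖ}
    (h : ∀ x, (a x).unop c = Q.counit x • c) : LeftEq (evalAt c) a (Q.unitHom _) := by
  intro x y
  rw [evalAt_mul_unop, h, QuasiHopfAlgebra.unitHom_apply, ← Algebra.smul_def, map_smul]
  simp [evalAt_apply]

namespace QuasiHopfAlgebra

variable {k H : Type*} [Field k] [Ring H] [Algebra k H] (Q : QuasiHopfAlgebra k H)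
variable {E : Type*} [Ring E] [Algebra k E] (π : H →ₐ[k] E) (R : H ⊗[k] E)

theorem sandwichLeft_pR : sandwichLeft Q.S Q.alpha Q.pR = 1 := Q.alphaBeta_PhiInv

theorem unop_pairHom_leftS_rightH (t : H ⊗[k] H) (a : H) (x : E) :
    (pairHom (Q.leftS E) (rightH k H E) t).unop (a ⊗ₜ x) = sandwichLeft Q.S a t ⊗ₜ x := by
  induction t using tensor_induction_two with
  | add s t hs ht => simp only [map_add, MulOpposite.unop_add, LinearMap.add_apply, hs, ht,
      TensorProduct.add_tmul]
  | tmul b c => simp [sandwichLeft_tmul, mul_assoc]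

theorem unop_pairHom_leftS'_rightE (t : H ⊗[k] H) (a b : H) :
    (pairHom (Q.leftS' π) ((rightE k H E).comp π) t).unop (a ⊗ₜ π b) =
      a ⊗ₜ π (sandwichLeft Q.S b t) := by
  induction t using tensor_induction_two with
  | add s t hs ht => simp only [map_add, MulOpposite.unop_add, LinearMap.add_apply, hs, ht,
      TensorProduct.tmul_add]
  | tmul b c => simp [sandwichLeft_tmul, mul_assoc]

theorem unop_pairHom_leftS'_rightE_alpha (a : H) :
    (pairHom (Q.leftS' π) (rightE k H E) R).unop (a ⊗ₜ π Q.alpha) = a ⊗ₜ Q.alphaForm π R := by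
  induction R using tensor_induction_two with
  | add s t hs ht => simp only [map_add, MulOpposite.unop_add, LinearMap.add_apply, hs, ht,
      TensorProduct.tmul_add]
  | tmul b c => simp [alphaForm_tmul]

theorem unop_pairHom_rightE_leftS' (t : H ⊗[k] H) (a : H) (x : E) :
    (pairHom ((rightE k H E).comp π) (Q.leftS' π) t).unop (a ⊗ₜ x) = a ⊗ₜ Q.conjForm π x t := by
  induction t using tensor_induction_two with
  | add s t hs ht => simp only [map_add, MulOpposite.unop_add, LinearMap.add_apply, hs, ht,
      TensorProduct.tmul_add]
  | tmul b c => simp [conjForm_tmul]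

theorem unop_pairHom_rightH_leftS (t : H ⊗[k] H) (x : E) :
    (pairHom ((rightH k H E).comp Q.SS) (Q.leftS E) t).unop (Q.S Q.alpha ⊗ₜ x) =
      Q.S (sandwichLeft Q.S Q.alpha t) ⊗ₜ x := by
  induction t using tensor_induction_two with
  | add s t hs ht => simp only [map_add, MulOpposite.unop_add, LinearMap.add_apply, hs, ht,
      TensorProduct.add_tmul]
  | tmul b c => simp [sandwichLeft_tmul, Q.S_mul, mul_assoc]

theorem unop_pairHom_leftS'_leftS (t : H ⊗[k] H) (c : H ⊗[k] E) :
    (pairHom (Q.leftS' π) (Q.leftS E) t).unop c = incl π (Q.flipS t) * c := by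
  induction t using tensor_induction_two with
  | add s t hs ht => simp only [map_add, MulOpposite.unop_add, LinearMap.add_apply, hs, ht,
      add_mul]
  | tmul a b =>
    induction c using tensor_induction_two with
    | add s t hs ht => simp only [map_add, mul_add, hs, ht]
    | tmul x y => simp [flipS_tmul]

theorem unop_pairHom_leftS_leftS' (t : H ⊗[k] H) (c : H ⊗[k] E) :
    (pairHom (Q.leftS E) (Q.leftS' π) t).unop c = inclFlip π (Q.flipS t) * c := by
  induction t using tensor_induction_two with
  | add s t hs ht => simp only [map_add, MulOpposite.unop_add, LinearMap.add_apply, hs, ht,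
      add_mul]
  | tmul a b =>
    induction c using tensor_induction_two with
    | add s t hs ht => simp only [map_add, mul_add, hs, ht]
    | tmul x y => simp [flipS_tmul]

/-- The map `S² ⊗ id` on `H ⊗ E`. -/
def mapSS (E : Type*) [Ring E] [Algebra k E] : H ⊗[k] E →ₐ[k] H ⊗[k] E :=
  Algebra.TensorProduct.map Q.SS (AlgHom.id k E)

theorem mapSS_tmul (h : H) (x : E) : Q.mapSS E (h ⊗ₜ x) = Q.S (Q.S h) ⊗ₜ x := by simp [mapSS]

theorem unop_pairHom_rightH_rightE (c : H ⊗[k] E) :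
    (pairHom ((rightH k H E).comp Q.SS) (rightE k H E) R).unop c = c * Q.mapSS E R := by
  induction R using tensor_induction_two with
  | add s t hs ht => simp only [map_add, MulOpposite.unop_add, LinearMap.add_apply, hs, ht,
      mul_add]
  | tmul a b => simp [mapSS_tmul, mul_assoc]

theorem unop_pairHom_rightH_rightE' (c : H ⊗[k] E) :
    (pairHom (rightH k H E) (rightE k H E) R).unop c = c * R := by
  induction R using tensor_induction_two with
  | add s t hs ht => simp only [map_add, MulOpposite.unop_add, LinearMap.add_apply, hs, ht,
      mul_add]
  | tmul a b => simp [mul_assoc]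

theorem unop_quadHom_inclFlip_gammaAux (z : H ⊗[k] (H ⊗[k] (H ⊗[k] H))) :
    (quadHom (Q.leftS E) (Q.leftS' π) ((rightE k H E).comp π) (rightH k H E) z).unop
      (Q.alpha ⊗ₜ π Q.alpha) = inclFlip π (Q.gammaAux z) := by
  induction z using tensor_induction_four with
  | add s t hs ht => simp only [map_add, MulOpposite.unop_add, LinearMap.add_apply, hs, ht]
  | tmul a b c d => simp [quadHom_tmul, gammaAux_tmul, mul_assoc]

theorem unop_quadHom_incl_gammaAux (z : H ⊗[k] (H ⊗[k] (H ⊗[k] H))) :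
    (quadHom (Q.leftS' π) (Q.leftS E) (rightH k H E) ((rightE k H E).comp π) z).unop
      (Q.alpha ⊗ₜ π Q.alpha) = incl π (Q.gammaAux z) := by
  induction z using tensor_induction_four with
  | add s t hs ht => simp only [map_add, MulOpposite.unop_add, LinearMap.add_apply, hs, ht]
  | tmul a b c d => simp [quadHom_tmul, gammaAux_tmul, mul_assoc]

theorem quadHom_gamma {B : Type*} [Ring B] [Algebra k B] (a b c d : H →ₐ[k] B) [Commuting a b]
    [Commuting a c] [Commuting a d] [Commuting b c] [Commuting b d] [Commuting c d] :
    Q.asc a b c * Q.ascInv (Q.conv a b) c d =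
    quadHom a b c d (Q.asc (quadLeg₁ k H) (quadLeg₂ k H) (quadLeg₃ k H) *
      Q.ascInv (Q.conv (quadLeg₁ k H) (quadLeg₂ k H)) (quadLeg₃ k H) (quadLeg₄ k H)) := by
  simpa only [map_one, mul_one] using (Q.quadHom_gamma_mul a b c d 1 1).symm

variable {π R} (hR : Q.IsYDElement π R)

include hR

theorem unop_quadHom_mapS_gammaAux (z : H ⊗[k] (H ⊗[k] (H ⊗[k] H))) :
    (quadHom ((rightE k H E).comp π) ((rightH k H E).comp Q.SS) (Q.leftS E) (Q.leftS' π) z).unop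
      (Q.S Q.alpha ⊗ₜ Q.alphaForm π R) =
      incl π (Q.mapS (Q.gammaAux z)) * (1 ⊗ₜ Q.drinfeldElt π R) := by
  rw [← Q.S_alpha_mul_drinfeldElt hR]
  induction z using tensor_induction_four with
  | add s t hs ht =>
    simp only [map_add, MulOpposite.unop_add, LinearMap.add_apply, hs, ht, add_mul]
  | tmul a b c d =>
    simp [quadHom_tmul, gammaAux_tmul, mapS_tmul, Q.S_mul, mul_assoc, Q.drinfeldElt_mul hR]

theorem unop_quadHom_flipS_gammaAux (z : H ⊗[k] (H ⊗[k] (H ⊗[k] H))) :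
    (quadHom ((rightH k H E).comp Q.SS) ((rightE k H E).comp π) (Q.leftS' π) (Q.leftS E) z).unop
      (Q.S Q.alpha ⊗ₜ Q.alphaForm π R) =
      incl π (Q.flipS (Q.gammaAux z)) * (1 ⊗ₜ Q.drinfeldElt π R) := by
  rw [← Q.S_alpha_mul_drinfeldElt hR]
  induction z using tensor_induction_four with
  | add s t hs ht =>
    simp only [map_add, MulOpposite.unop_add, LinearMap.add_apply, hs, ht, add_mul]
  | tmul a b c d =>
    simp [quadHom_tmul, gammaAux_tmul, flipS_tmul, Q.S_mul, mul_assoc, Q.drinfeldElt_mul hR]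

/-- The elements of H ⊗ E are acted on by left multiplications through S, namely `l` and `d`, and by
right multiplications `n` and `e`; these are two modules together with their duals. The twisted
element is the braiding `t` of the duals. Transposing R once relates it to `t`; transposing `t` with
the pairing of the duals with the double duals relates it to R twisted by S², and the Drinfeld
element appears as the evaluation vector of the second pairing. -/
theorem twistElt_mul_mapS_gamma :
    Q.twistElt π R * (incl π (Q.mapS Q.gamma) * (1 ⊗ₜ Q.drinfeldElt π R)) =
      incl π (Q.flipS Q.gamma) * (1 ⊗ₜ Q.drinfeldElt π R) * Q.mapSS E R := by
  set l := Q.leftS E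
  set d := Q.leftS' π
  set n := rightH k H E
  set e := rightE k H E
  set t : (Module.End k (H ⊗[k] E))ᵐᵒᵖ := MulOpposite.op (LinearMap.mulLeft k (Q.twistElt π R))
    with ht
  have htn : ∀ h, t * n h = n h * t := by
    intro h
    apply MulOpposite.unop_injective
    refine LinearMap.ext fun c => ?_
    simp [ht, n, mul_assoc]
  have hte : ∀ x, t * e x = e x * t := by
    intro h
    apply MulOpposite.unop_injective
    refine LinearMap.ext fun c => ?_
    simp [ht, e, mul_assoc]
  have htl : ∀ h, t * Q.conv d l h = Q.conv l d h * t := by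
    intro h
    apply MulOpposite.unop_injective
    refine LinearMap.ext fun c => ?_
    simp only [MulOpposite.unop_mul, Module.End.mul_apply, ht, MulOpposite.unop_op,
      LinearMap.mulLeft_apply]
    rw [conv_apply, conv_apply, unop_pairHom_leftS'_leftS, unop_pairHom_leftS_leftS', ← coS_apply,
      ← mul_assoc, ← mul_assoc, Q.twistElt_mul_inclFlip_coS hR]
  have hln : LeftEq (evalAt (Q.alpha ⊗ₜ[k] π Q.alpha)) (Q.conv l n) (Q.unitHom _) := by
    refine leftEq_evalAt Q fun x => ?_
    rw [conv_apply, unop_pairHom_leftS_rightH, sandwichLeft_comul, TensorProduct.smul_tmul']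
  have hde : LeftEq (evalAt (Q.alpha ⊗ₜ[k] π Q.alpha)) (Q.conv d (e.comp π)) (Q.unitHom _) := by
    refine leftEq_evalAt Q fun x => ?_
    rw [conv_apply, unop_pairHom_leftS'_rightE, sandwichLeft_comul, map_smul,
      TensorProduct.tmul_smul]
  -- Both words evaluate to γ, once with flipped legs, so this is `twistElt_mul_inclFlip_gamma`.
  have hγ : ∀ y, evalAt (Q.alpha ⊗ₜ[k] π Q.alpha)
      (Q.asc l d (e.comp π) * (Q.ascInv (Q.conv l d) (e.comp π) n * (t * y))) =
      evalAt (Q.alpha ⊗ₜ[k] π Q.alpha)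
      (Q.asc d l n * (Q.ascInv (Q.conv d l) n (e.comp π) * (pairHom n e R * y))) := by
    intro y
    rw [← mul_assoc, ← mul_assoc (Q.asc d l n), quadHom_gamma Q l d, quadHom_gamma Q d l,
      evalAt_mul_unop,
      evalAt_mul_unop, evalAt_mul_unop, evalAt_mul_unop, unop_quadHom_inclFlip_gammaAux,
      unop_quadHom_incl_gammaAux, ← gamma_eq, unop_pairHom_rightH_rightE',
      ← Q.twistElt_mul_inclFlip_gamma hR]
    rfl
  have h1 := hR.dual_braiding_cancel l d n e hln hde htn hte htl hγ
  -- Since S(p¹)αp² = 1, applying p_R to the first component replaces the vector α ⊗ α by 1 ⊗ α.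
  have h2 := hR.dual_braiding_cancel_of_eq (w' := evalAt ((1 : H) ⊗ₜ[k] π Q.alpha)) (p := Q.pR)
    l d n e (fun z => by
      rw [evalAt_mul_unop, unop_pairHom_leftS_rightH,
        sandwichLeft_pR]) hde htn hte htl h1
  have h3 := hR.dual_braiding_cancel_braided l d e hte htl h2
  -- The braiding applied to the evaluation vector α gives S(R¹)αR², which pairs `e` with `d` in the
  -- opposite order.
  have h4 : ∀ z, evalAt ((1 : H) ⊗ₜ[k] π Q.alpha) (pairHom d e R * z) =
      evalAt ((1 : H) ⊗ₜ[k] Q.alphaForm π R) z := by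
    intro z
    rw [evalAt_mul_unop, unop_pairHom_leftS'_rightE_alpha]
  simp only [h4] at h3
  -- S(α) is put back in the first component: it is the vector against which `n` composed with S²
  -- contracts with `l` from the other side.
  have h5 : ∀ z, evalAt (Q.S Q.alpha ⊗ₜ[k] Q.alphaForm π R) z =
      evalAt ((1 : H) ⊗ₜ[k] Q.alphaForm π R) (n (Q.S Q.alpha) * z) := by
    intro z
    rw [evalAt_mul_unop]
    simp [n]
  have h6 : ∀ y, evalAt (Q.S Q.alpha ⊗ₜ[k] Q.alphaForm π R) (Q.asc l (e.comp π) d *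
      (pairHom l e R * (Q.ascInv (e.comp π) l d * (t * y)))) =
      evalAt (Q.S Q.alpha ⊗ₜ[k] Q.alphaForm π R) (Q.ascInv (e.comp π) d l * y) := by
    intro y
    have h7 := (Commuting.comm (a := pairHom l e) (b := n) R (Q.S Q.alpha)).eq
    rw [h5, h5, ← mul_assoc (n _), ← Q.asc_comm n, mul_assoc, ← mul_assoc (n _), ← h7, mul_assoc,
      ← mul_assoc (n _), ← Q.ascInv_comm n, mul_assoc, ← mul_assoc (n _), ← htn, mul_assoc, h3,
      ← mul_assoc (n _), ← Q.ascInv_comm n, mul_assoc]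
  have hnl : LeftEq (evalAt (Q.S Q.alpha ⊗ₜ[k] Q.alphaForm π R)) (Q.conv (n.comp Q.SS) l)
      (Q.unitHom _) := by
    refine leftEq_evalAt Q fun x => ?_
    rw [conv_apply, unop_pairHom_rightH_leftS, sandwichLeft_comul, map_smul,
      TensorProduct.smul_tmul']
  have hed : LeftEq (evalAt (Q.S Q.alpha ⊗ₜ[k] Q.alphaForm π R)) (Q.conv (e.comp π) d)
      (Q.unitHom _) := by
    refine leftEq_evalAt Q fun x => ?_
    rw [conv_apply, unop_pairHom_rightE_leftS', conjForm_comul _ hR, TensorProduct.tmul_smul]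
  have h8 := hR.braiding_through_evaluation (n.comp Q.SS) l d e hnl hed (fun h => htn (Q.SS h)) hte
    htl h6 1
  rw [← mul_assoc, ← mul_assoc (Q.asc (n.comp Q.SS) _ _), quadHom_gamma Q (e.comp π),
    quadHom_gamma Q (n.comp Q.SS), evalAt_mul_unop, evalAt_mul_unop, evalAt_mul_unop,
    evalAt_mul_unop, unop_quadHom_mapS_gammaAux _ hR, unop_quadHom_flipS_gammaAux _ hR, ← gamma_eq,
    unop_pairHom_rightH_rightE] at h8
  exact h8

/-- As γ = fΔ(α), the preceding identity is this one multiplied on the left by the image of α under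
h ↦ S(h₂) ⊗ S(h₁). Both sides intertwine the same actions of H, so α may be replaced by S(p¹)αp² =
1. -/
theorem twistElt_mul_mapS_f :
    Q.twistElt π R * (incl π (Q.mapS Q.f) * (1 ⊗ₜ Q.drinfeldElt π R)) =
      incl π (Q.flipS Q.f) * (1 ⊗ₜ Q.drinfeldElt π R) * Q.mapSS E R := by
  set x := Q.twistElt π R * (incl π (Q.mapS Q.f) * (1 ⊗ₜ Q.drinfeldElt π R)) with hx
  set x' := incl π (Q.flipS Q.f) * (1 ⊗ₜ Q.drinfeldElt π R) * Q.mapSS E R with hx'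
  have h1 : incl π (Q.coS Q.alpha) * x = incl π (Q.coS Q.alpha) * x' := by
    have h := Q.twistElt_mul_mapS_gamma hR
    rw [← f_mul_comul_alpha, mapS_mul, flipS_mul, map_mul, ← inclFlip_flipS, ← coS_apply,
      mul_assoc (inclFlip π _), ← mul_assoc, Q.twistElt_mul_inclFlip_coS hR, map_mul] at h
    rw [hx, hx']
    simpa only [mul_assoc] using h
  have h2 : ∀ t : H ⊗[k] H, incl π (Q.mapS (Q.flipS t)) * (1 ⊗ₜ Q.drinfeldElt π R) =
      (1 ⊗ₜ Q.drinfeldElt π R) * Q.mapSS E (inclFlip π t) := by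
    intro t
    induction t using tensor_induction_two with
    | add s t hs ht => simp only [map_add, add_mul, mul_add, hs, ht]
    | tmul a b => simp [flipS_tmul, mapS_tmul, mapSS_tmul, Q.drinfeldElt_mul hR]
  have h3 : ∀ t : H ⊗[k] H, incl π (Q.flipS (Q.flipS t)) * (1 ⊗ₜ Q.drinfeldElt π R) =
      (1 ⊗ₜ Q.drinfeldElt π R) * Q.mapSS E (incl π t) := by
    intro t
    induction t using tensor_induction_two with
    | add s t hs ht => simp only [map_add, add_mul, mul_add, hs, ht]
    | tmul a b => simp [flipS_tmul, mapSS_tmul, Q.drinfeldElt_mul hR]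
  have h4 : ∀ h, incl π (Q.coS (Q.S h)) * x = x * Q.mapSS E (inclFlip π (Q.comul h)) := by
    intro h
    rw [hx, ← mul_assoc, ← Q.twistElt_mul_inclFlip_coS hR, mul_assoc, coS_apply, inclFlip_flipS,
      ← mul_assoc (incl π _), ← map_mul, ← mapS_mul, ← f_intertwine, mapS_mul, coS_apply, map_mul,
      mul_assoc (incl π _), h2]
    simp only [mul_assoc]
  have h5 : ∀ h, incl π (Q.coS (Q.S h)) * x' = x' * Q.mapSS E (inclFlip π (Q.comul h)) := by
    intro h
    have h6 := hR.compat h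
    rw [conv_apply, conv_apply] at h6
    rw [hx', ← mul_assoc, ← mul_assoc, ← map_mul, coS_apply, ← flipS_mul, ← f_intertwine, flipS_mul,
      coS_apply, map_mul, mul_assoc (incl π _), h3, mul_assoc, mul_assoc, mul_assoc, ← map_mul,
      ← map_mul, ← h6, mul_assoc]
  have h7 : ∀ p, incl π (Q.coS (sandwichLeft Q.S Q.alpha p)) * x =
      incl π (Q.coS (sandwichLeft Q.S Q.alpha p)) * x' := by
    intro p
    induction p using tensor_induction_two with
    | add s t hs ht =>
      have h8 : ∀ a b, Q.coS (a + b) = Q.coS a + Q.coS b := by simp [coS_apply]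
      simp only [map_add, h8, add_mul, hs, ht]
    | tmul a b =>
      rw [sandwichLeft_tmul, coS_mul, coS_mul, map_mul, map_mul, mul_assoc, mul_assoc, mul_assoc,
        mul_assoc, h4, h5, ← mul_assoc (incl π _) x, ← mul_assoc (incl π _) x', h1]
  simpa [sandwichLeft_pR, coS_one] using h7 Q.pR

/-- Conjugation by the twist `𝓕` is conjugation by the Drinfeld element, up to `S² ⊗ id`. -/
theorem calF_conj_mul : incl π Q.calF * R * inclFlip π (Q.fInv * Q.flipS Q.f) *
    (1 ⊗ₜ Q.drinfeldElt π R) = (1 ⊗ₜ Q.drinfeldElt π R) * Q.mapSS E R := by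
  have h1 := congrArg (incl π (Q.flipS Q.fInv) * ·) (Q.twistElt_mul_mapS_f hR)
  simp only [← mul_assoc, ← map_mul, ← flipS_mul, f_mul_fInv, flipS_one, map_one, one_mul] at h1
  rw [← h1, calF, twistElt, ← inclFlip_flipS]
  simp only [map_mul, mul_assoc]

end QuasiHopfAlgebra

/-! ### The word of the inverse braiding and its value. -/

namespace QuasiHopfAlgebra

variable {k H : Type*} [Field k] [Ring H] [Algebra k H] {Q : QuasiHopfAlgebra k H}
variable {E : Type*} [Ring E] [Algebra k E] {π : H →ₐ[k] E} {R : H ⊗[k] E}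

/-- The word describing the inverse braiding of a dual with a dual, after cancellations. -/
theorem IsYDElement.inverse_braiding_word (hR : Q.IsYDElement π R) {B W : Type*} [Ring B]
    [Algebra k B] [AddCommGroup W] [Module k W] {w : B →ₗ[k] W} (a b c d : H →ₐ[k] B)
    (e : E →ₐ[k] B) [Commuting a b] [Commuting a c] [Commuting a d] [Commuting a e] [Commuting b c]
    [Commuting b d] [Commuting b e] [Commuting c d] [Commuting c e] [Commuting d e]
    (hbc : LeftEq w (Q.conv b c) (Q.unitHom B)) (hab : RightEq w (Q.conv a b) (Q.unitHom B))
    (hcd : RightEq w (Q.conv c d) (Q.unitHom B)) :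
    w (Q.ascInv a (e.comp π) d * (Q.ascInv b c (Q.conv (e.comp π) d) * (Q.asc c (e.comp π) d *
      (pairHom c e R * (Q.ascInv (e.comp π) c d * Q.asc a b (e.comp π)))))) =
      w (Q.asc a b c * (pairHom c e R * Q.ascInv (e.comp π) c d)) := by
  set m := e.comp π with hm
  -- The braided core of the word: it commutes with `a` and `b`, and it carries the coproduct on
  -- `m`, `c`, `d` to the one on `c`, `m`, `d`.
  set z := Q.asc c m d * (pairHom c e R * Q.ascInv m c d) with hz
  have hza : ∀ x, Commute z (a x) := by
    intro x
    exact Commute.mul_left (Q.asc_comm a x)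
      ((Commuting.comm (a := pairHom c e) (b := a) R x).mul_left (Q.ascInv_comm a x))
  have hzb : ∀ x, Commute z (b x) := by
    intro x
    exact Commute.mul_left (Q.asc_comm b x)
      ((Commuting.comm (a := pairHom c e) (b := b) R x).mul_left (Q.ascInv_comm b x))
  have hzm : ∀ x, z * Q.conv m (Q.conv c d) x = Q.conv c (Q.conv m d) x * z := by
    intro x
    have h2 : pairHom c e R * Q.conv (Q.conv m c) d x = Q.conv (Q.conv c m) d x * pairHom c e R :=
      Q.conv_intertwine (fun x => (hR.conv_mul c e x).symm)
        (fun x => (Commuting.comm (a := pairHom c e) (b := d) R x).eq) x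
    rw [hz, mul_assoc, mul_assoc, ← conv_ascInv, ← mul_assoc _ _ (Q.ascInv _ _ _), h2, mul_assoc,
      ← mul_assoc (Q.asc _ _ _), ← conv_asc]
    simp only [mul_assoc]
  have h1 : z * Q.asc a b (Q.conv m (Q.conv c d)) = Q.asc a b (Q.conv c (Q.conv m d)) * z :=
    Q.asc_intertwine hza hzb hzm
  have h2 : Q.ascInv b c (Q.conv m d) * Q.asc a b (Q.conv c (Q.conv m d)) =
      Q.asc a (Q.conv b c) (Q.conv m d) * (Q.asc a b c * Q.ascInv (Q.conv a b) c (Q.conv m d)) := by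
    have := Q.pentagon a b c (Q.conv m d)
    calc _ = Q.ascInv b c (Q.conv m d) * (Q.asc a b (Q.conv c (Q.conv m d)) *
          Q.asc (Q.conv a b) c (Q.conv m d)) * Q.ascInv (Q.conv a b) c (Q.conv m d) := by
          simp only [mul_assoc, asc_mul_ascInv, mul_one]
      _ = _ := by rw [← this]; simp only [mul_assoc, ascInv_mul_asc_mul]
  have hcd' : RightEq w (Q.conv m (Q.conv c d)) m := Q.rightEq_conv_unit_right m hcd
  have hzab : ∀ x, Commute z (Q.conv a b x) := fun x => Q.conv_intertwine hza hzb x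
  have h3 : RightEq (w ∘ₗ LinearMap.mulRight k z) (Q.conv a b) (Q.unitHom B) :=
    hab.mulRight hzab (fun x => (Commuting.comm (a := Q.unitHom B) (b := AlgHom.id k B) x z).symm)
  have h4 : LeftEq (w ∘ₗ LinearMap.mulLeft k (Q.ascInv a m d)) (Q.conv b c) (Q.unitHom B) :=
    hbc.mulLeft (fun x => Q.ascInv_comm (Q.conv b c) x)
      (fun x => (Commuting.comm (a := Q.unitHom B) (b := AlgHom.id k B) x _).symm)
  have h5 : ∀ y, w (Q.ascInv a m d * y) = w (Q.ascInv (Q.conv a (Q.conv b c)) m d * y) := by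
    intro y
    have h : LeftEq w (Q.conv a (Q.conv b c)) a := Q.leftEq_conv_unit_right a hbc
    exact (Q.leftEq_ascInv_fst m d h y).symm
  have h6 : Q.ascInv (Q.conv a (Q.conv b c)) m d * Q.asc a b c =
      Q.asc a b c * Q.ascInv (Q.conv (Q.conv a b) c) m d :=
    (Q.ascInv_intertwine (fun x => (Q.conv_asc a b c x).symm) (fun x => Q.asc_comm m x)
      (fun x => Q.asc_comm d x)).symm
  have h7 : RightEq (w ∘ₗ LinearMap.mulRight k z) (Q.conv (Q.conv a b) c) c :=
    Q.rightEq_conv_unit_left c h3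
  have h8 := fun y => Q.rightEq_ascInv_fst m d h7 y
  have h9 := fun y => Q.rightEq_ascInv_fst c (Q.conv m d) h3 y
  have h10 := fun y => Q.leftEq_asc_snd a (Q.conv m d) h4 y
  simp only [LinearMap.comp_apply, LinearMap.mulRight_apply, LinearMap.mulLeft_apply] at h8 h9 h10
  calc _ = w (Q.ascInv a m d * (Q.ascInv b c (Q.conv m d) * z) * Q.asc a b m) := by
        simp only [hz, mul_assoc]; rfl
    _ = w (Q.ascInv a m d * ((Q.ascInv b c (Q.conv m d) * Q.asc a b (Q.conv c (Q.conv m d))) *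
          z)) := by
        -- Because `c` and `d` contract at the right end, the leg `m` of the last reassociator may
        -- be enlarged to the product of `m`, `c` and `d`, and then it passes through `z`.
        rw [← Q.rightEq_asc_trd a b hcd', mul_assoc, mul_assoc, h1, mul_assoc]
    _ = w (Q.ascInv a m d * Q.asc a b c * Q.ascInv (Q.conv a b) c (Q.conv m d) * z) := by
        rw [h2, mul_assoc, h10, asc_unit_mid, one_mul]; simp only [mul_assoc]
    _ = w (Q.asc a b c * Q.ascInv (Q.conv (Q.conv a b) c) m d * z) := by
        rw [h9, ascInv_unit_left, mul_one, mul_assoc, h5, ← mul_assoc, h6]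
    _ = _ := by
        rw [h8, hz, mul_assoc, ascInv_mul_asc_mul]

section

variable (Q π)

/-- The map `h ⊗ (b ⊗ x) ↦ S(h β S(b)) α x`. -/
def alphaSandwichForm : H ⊗[k] (H ⊗[k] E) →ₗ[k] E :=
  Q.alphaForm π ∘ₗ (TensorProduct.map (sandwichRight Q.S Q.beta) LinearMap.id ∘ₗ
    (TensorProduct.assoc k H H E).symm.toLinearMap)

/-- The map `(t ⊗ (b ⊗ x)) ↦ S(t¹ β S(t²) α t³ β S(b)) α x`. -/
def inverseBraidingForm : (H ⊗[k] (H ⊗[k] H)) ⊗[k] (H ⊗[k] E) →ₗ[k] E :=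
  Q.alphaSandwichForm π ∘ₗ TensorProduct.map Q.betaAlpha LinearMap.id

theorem inverseBraidingForm_tmul (t : H ⊗[k] (H ⊗[k] H)) (b : H) (x : E) :
    Q.inverseBraidingForm π (t ⊗ₜ (b ⊗ₜ x)) =
      π (Q.S (Q.betaAlpha t * Q.beta * Q.S b) * Q.alpha) * x := by
  simp [inverseBraidingForm, alphaSandwichForm, alphaForm_tmul, sandwichRight_tmul]

variable (k H E)

/-- The first leg of `(H ⊗ H ⊗ H) ⊗ (H ⊗ E)`. -/
abbrev wordLeg₁ : H →ₐ[k] (H ⊗[k] (H ⊗[k] H)) ⊗[k] (H ⊗[k] E) := (legL k _ _).comp (leg₁ k H)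

/-- The second leg of `(H ⊗ H ⊗ H) ⊗ (H ⊗ E)`. -/
abbrev wordLeg₂ : H →ₐ[k] (H ⊗[k] (H ⊗[k] H)) ⊗[k] (H ⊗[k] E) := (legL k _ _).comp (leg₂ k H)

/-- The third leg of `(H ⊗ H ⊗ H) ⊗ (H ⊗ E)`. -/
abbrev wordLeg₃ : H →ₐ[k] (H ⊗[k] (H ⊗[k] H)) ⊗[k] (H ⊗[k] E) := (legL k _ _).comp (leg₃ k H)

/-- The fourth leg of `(H ⊗ H ⊗ H) ⊗ (H ⊗ E)`. -/
abbrev wordLeg₄ : H →ₐ[k] (H ⊗[k] (H ⊗[k] H)) ⊗[k] (H ⊗[k] E) := (legR k _ _).comp (legL k H E)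

/-- The last leg of `(H ⊗ H ⊗ H) ⊗ (H ⊗ E)`. -/
abbrev wordLeg₅ : E →ₐ[k] (H ⊗[k] (H ⊗[k] H)) ⊗[k] (H ⊗[k] E) := (legR k _ _).comp (legR k H E)

end

theorem leftEq_inverseBraidingForm : LeftEq (Q.inverseBraidingForm π)
    (Q.conv (wordLeg₂ k H E) (wordLeg₃ k H E)) (Q.unitHom _) :=
by
  have h := (Q.leftEq_conv_comp_left (B' := H ⊗[k] E) Q.leftEq_betaAlpha
    (LinearMap.id : H ⊗[k] E →ₗ[k] H ⊗[k] E))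
  intro x y
  exact congrArg (Q.alphaSandwichForm π) (h x y)

theorem rightEq_inverseBraidingForm : RightEq (Q.inverseBraidingForm π)
    (Q.conv (wordLeg₁ k H E) (wordLeg₂ k H E)) (Q.unitHom _) :=
by
  have h := (Q.rightEq_conv_comp_left (B' := H ⊗[k] E) Q.rightEq_betaAlpha
    (LinearMap.id : H ⊗[k] E →ₗ[k] H ⊗[k] E))
  intro x y
  exact congrArg (Q.alphaSandwichForm π) (h x y)

theorem rightEq_inverseBraidingForm' : RightEq (Q.inverseBraidingForm π)
    (Q.conv (wordLeg₃ k H E) (wordLeg₄ k H E)) (Q.unitHom _) := by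
  have key : ∀ (s : H ⊗[k] H) (t : H ⊗[k] (H ⊗[k] H)) (b : H) (x : E), Q.inverseBraidingForm π
      (t ⊗ₜ (b ⊗ₜ x) * pairHom (wordLeg₃ k H E) (wordLeg₄ k H E) s) =
      π (Q.S (Q.betaAlpha t * sandwichRight Q.S Q.beta s * Q.S b) * Q.alpha) * x := by
    intro s t b x
    induction s using tensor_induction_two with
    | add r s hr hs => simp only [map_add, mul_add, add_mul, hr, hs]
    | tmul c d =>
      simp only [pairHom_tmul, AlgHom.comp_apply, Algebra.TensorProduct.includeLeft_apply,
        Algebra.TensorProduct.includeRight_apply, Algebra.TensorProduct.tmul_mul_tmul, mul_one,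
        one_mul]
      rw [inverseBraidingForm_tmul]
      have := Q.betaAlpha_mul_leg₃ c t
      simp only [AlgHom.comp_apply, Algebra.TensorProduct.includeRight_apply] at this
      rw [this, sandwichRight_tmul]
      simp only [Q.S_mul, mul_assoc]
  intro h y
  rw [unitHom_apply, ← Algebra.commutes, ← Algebra.smul_def, map_smul, conv_apply]
  induction y using tensor_induction_two with
  | add s t hs ht => simp only [add_mul, map_add, smul_add, hs, ht]
  | tmul t y =>
    induction y using tensor_induction_two with
    | add r s hr hs => simp only [TensorProduct.tmul_add, add_mul, map_add, smul_add, hr, hs]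
    | tmul b x =>
      rw [key, sandwichRight_comul, inverseBraidingForm_tmul]
      simp

/-- After the collapse, Φ occurs only through X¹βS(X²)αX³ = 1, and the surviving Φ⁻¹ forms p_R. What
is left is S(R¹p²)αR²p¹. -/
theorem inverseBraidingForm_word (hR : Q.IsYDElement π R) : Q.inverseBraidingForm π
    (Q.ascInv (wordLeg₁ k H E) ((wordLeg₅ k H E).comp π) (wordLeg₄ k H E) *
    (Q.ascInv (wordLeg₂ k H E) (wordLeg₃ k H E)
      (Q.conv ((wordLeg₅ k H E).comp π) (wordLeg₄ k H E)) *
    (Q.asc (wordLeg₃ k H E) ((wordLeg₅ k H E).comp π) (wordLeg₄ k H E) *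
    (pairHom (wordLeg₃ k H E) (wordLeg₅ k H E) R *
    (Q.ascInv ((wordLeg₅ k H E).comp π) (wordLeg₃ k H E) (wordLeg₄ k H E) *
      Q.asc (wordLeg₁ k H E) (wordLeg₂ k H E) ((wordLeg₅ k H E).comp π)))))) =
    Q.drinfeldElt π R := by
  rw [hR.inverse_braiding_word _ _ _ _ _ leftEq_inverseBraidingForm rightEq_inverseBraidingForm
    rightEq_inverseBraidingForm', ← map_asc (φ := legL k (H ⊗[k] (H ⊗[k] H)) (H ⊗[k] E)), asc_legs]
  have key : ∀ (t s : H ⊗[k] (H ⊗[k] H)), Q.inverseBraidingForm π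
      (legL k (H ⊗[k] (H ⊗[k] H)) (H ⊗[k] E) t * (pairHom (wordLeg₃ k H E) (wordLeg₅ k H E) R *
        pairHom ((wordLeg₅ k H E).comp π) (pairHom (wordLeg₃ k H E) (wordLeg₄ k H E)) s)) =
      Q.alphaForm π (legL k H E (Q.betaAlpha t) * mulFlip π R
        (TensorProduct.map LinearMap.id (sandwichRight Q.S Q.beta) s)) := by
    intro t s
    induction s using tensor_induction_three with
    | add r s hr hs => simp only [map_add, mul_add, mulFlip, hr, hs]
    | tmul p q r =>
      clear hR
      induction R using tensor_induction_two with
      | add r s hr hs =>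
        simp only [map_add, mul_add, add_mul, mulFlip] at hr hs ⊢
        rw [hr, hs]
      | tmul h x =>
        rw [TensorProduct.map_tmul, mulFlip_tmul, sandwichRight_tmul]
        simp only [pairHom_tmul, AlgHom.comp_apply, Algebra.TensorProduct.includeLeft_apply,
          Algebra.TensorProduct.includeRight_apply, Algebra.TensorProduct.tmul_mul_tmul, mul_one,
          one_mul]
        rw [inverseBraidingForm_tmul, alphaForm_tmul]
        have := Q.betaAlpha_mul_leg₃ (h * q) t
        simp only [AlgHom.comp_apply, Algebra.TensorProduct.includeRight_apply] at this
        rw [this]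
        simp [mul_assoc]
  rw [ascInv, key, betaAlpha_Phi, map_one, one_mul]
  rfl

end QuasiHopfAlgebra

/-! ### Maps M → P ⊗ M as elements of P ⊗ End(M). -/

section EvalOp

variable {k : Type*} [Field k] {M : Type*} [AddCommGroup M] [Module k M]

/-- The map `p ⊗ x ↦ p ⊗ x m`. -/
def evalOp (P : Type*) [AddCommGroup P] [Module k P] (m : M) :
    P ⊗[k] Module.End k M →ₗ[k] P ⊗[k] M :=
  TensorProduct.map LinearMap.id (LinearMap.applyₗ m)

variable {P : Type*} [AddCommGroup P] [Module k P]

@[simp] theorem evalOp_tmul (m : M) (p : P) (x : Module.End k M) :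
    evalOp P m (p ⊗ₜ x) = p ⊗ₜ x m := by simp [evalOp]

theorem lTensorHomToHomLTensor_eq_evalOp (t : P ⊗[k] Module.End k M) (m : M) :
    TensorProduct.lTensorHomToHomLTensor (.id k) M P M t m = evalOp P m t := by
  induction t using tensor_induction_two with
  | add s t hs ht => simp only [map_add, LinearMap.add_apply, hs, ht]
  | tmul p x => simp

variable [Module.Finite k M]

theorem evalOp_ext {s t : P ⊗[k] Module.End k M} (h : ∀ m : M, evalOp P m s = evalOp P m t) :
    s = t := by
  apply (lTensorHomEquivHomLTensor k M P M).injective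
  ext m
  simp [lTensorHomToHomLTensor_eq_evalOp, h]

/-- For finite-dimensional M the canonical map from P ⊗ End(M) to Hom(M, P ⊗ M) is bijective.
Surjectivity produces R from the coaction; injectivity, used in `evalOp_ext`, turns identities at
every vector into identities of tensors. -/
theorem exists_evalOp_eq (f : M →ₗ[k] P ⊗[k] M) : ∃ t : P ⊗[k] Module.End k M,
    ∀ m, f m = evalOp P m t := by
  refine ⟨(lTensorHomEquivHomLTensor k M P M).symm f, fun m => ?_⟩
  rw [← lTensorHomToHomLTensor_eq_evalOp, ← lTensorHomEquivHomLTensor_apply]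
  simp

theorem map_evalOp_ext {s t : P ⊗[k] (P ⊗[k] Module.End k M)}
    (h : ∀ m : M, TensorProduct.map LinearMap.id (evalOp P m) s =
      TensorProduct.map LinearMap.id (evalOp P m) t) : s = t := by
  have h1 : ∀ (m : M) (s : P ⊗[k] (P ⊗[k] Module.End k M)),
      evalOp (P ⊗[k] P) m ((TensorProduct.assoc k P P _).symm s) =
      (TensorProduct.assoc k P P M).symm (TensorProduct.map LinearMap.id (evalOp P m) s) := by
    intro m s
    induction s using tensor_induction_three with
    | add s t hs ht => simp only [map_add, hs, ht]
    | tmul x y z => simp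
  apply (TensorProduct.assoc k P P _).symm.injective
  refine evalOp_ext fun m => ?_
  rw [h1, h1, h]

end EvalOp

namespace YDData

open QuasiHopfAlgebra

variable {k H : Type*} [Field k] [Ring H] [Algebra k H] (Q : QuasiHopfAlgebra k H)
variable {M : Type*} [AddCommGroup M] [Module k M]

variable {V : YDData k H M} {R : H ⊗[k] Module.End k M} (hR : ∀ m, V.coact m = evalOp H m R)

theorem coactMul_tmul (a b : H) (m : M) : V.coactMul (a ⊗ₜ b) m =
    TensorProduct.map (LinearMap.mulRight k b) LinearMap.id (V.coact (V.act a m)) := by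
  simp [coactMul]

theorem coactTwice_tmul (a b c : H) (m : M) : V.coactTwice (a ⊗ₜ (b ⊗ₜ c)) m =
    TensorProduct.map (LinearMap.mulLeft k a) (V.coactMul (b ⊗ₜ c)) (V.coact m) := by
  simp [coactTwice]

theorem coactComul_tmul (Δ : H →ₐ[k] H ⊗[k] H) (a : H) (t : H ⊗[k] H) (m : M) :
    V.coactComul Δ (a ⊗ₜ t) m = TensorProduct.assoc k H H M
      (TensorProduct.map (LinearMap.mulRight k t ∘ₗ Δ.toLinearMap) LinearMap.id
        (V.coact (V.act a m))) := by
  simp [coactComul]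

theorem tensorAct_lmul_evalOp (t : H ⊗[k] H) (s : H ⊗[k] Module.End k M) (m : M) :
    tensorAct (Algebra.lmul k H) V.act t (evalOp H m s) = evalOp H m (incl V.act t * s) := by
  induction t using tensor_induction_two with
  | add s t hs ht => simp only [map_add, LinearMap.add_apply, add_mul, hs, ht]
  | tmul a b =>
    induction s using tensor_induction_two with
    | add s t hs ht => simp only [map_add, mul_add, hs, ht]
    | tmul x y => simp [tensorAct_tmul]

theorem tensorAct_lmul_lmul_evalOp (t : H ⊗[k] (H ⊗[k] H))
    (s : H ⊗[k] (H ⊗[k] Module.End k M)) (m : M) :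
    tensorAct (Algebra.lmul k H) (tensorAct (Algebra.lmul k H) V.act) t
      (TensorProduct.map LinearMap.id (evalOp H m) s) =
    TensorProduct.map LinearMap.id (evalOp H m) (pairHom (outLeg₁ k H _)
      (pairHom (outLeg₂ k H _) ((outLeg₃ k H _).comp V.act)) t * s) := by
  induction t using tensor_induction_three with
  | add s t hs ht => simp only [map_add, LinearMap.add_apply, add_mul, hs, ht]
  | tmul a b c =>
    induction s using tensor_induction_three with
    | add s t hs ht => simp only [map_add, mul_add, hs, ht]
    | tmul x y z => simp [tensorAct_tmul]

include hR

theorem coactMul_eq (t : H ⊗[k] H) (m : M) :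
    V.coactMul t m = evalOp H m (R * inclFlip V.act t) := by
  induction t using tensor_induction_two with
  | add s t hs ht => simp only [map_add, LinearMap.add_apply, mul_add, hs, ht]
  | tmul a b =>
    rw [coactMul_tmul, hR]
    clear hR
    induction R using tensor_induction_two with
    | add s t hs ht => simp only [map_add, add_mul, hs, ht]
    | tmul x y => simp

theorem coactTwice_eq (t : H ⊗[k] (H ⊗[k] H)) (m : M) :
    V.coactTwice t m = TensorProduct.map LinearMap.id (evalOp H m)
      (pairHom (outLeg₂ k H _) (outLeg₃ k H _) R * pairHom (outLeg₁ k H _)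
        (pairHom ((outLeg₃ k H _).comp V.act) (outLeg₂ k H _)) t *
          pairHom (outLeg₁ k H _) (outLeg₃ k H _) R) := by
  induction t using tensor_induction_three with
  | add s t hs ht => simp only [map_add, LinearMap.add_apply, mul_add, add_mul, hs, ht]
  | tmul a b c =>
    rw [coactTwice_tmul, hR]
    have h1 : ∀ s : H ⊗[k] Module.End k M, TensorProduct.map (LinearMap.mulLeft k a)
        (V.coactMul (b ⊗ₜ[k] c)) (evalOp H m s) = TensorProduct.map LinearMap.id (evalOp H m)
        (pairHom (outLeg₂ k H _) (outLeg₃ k H _) R * pairHom (outLeg₁ k H _)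
        (pairHom ((outLeg₃ k H _).comp V.act) (outLeg₂ k H _)) (a ⊗ₜ (b ⊗ₜ c)) *
          pairHom (outLeg₁ k H _) (outLeg₃ k H _) s) := by
      intro s
      induction s using tensor_induction_two with
      | add s t hs ht => simp only [map_add, mul_add, hs, ht]
      | tmul x y =>
        rw [evalOp_tmul, TensorProduct.map_tmul, coactMul_eq hR]
        clear hR
        induction R using tensor_induction_two with
        | add s t hs ht => simp only [map_add, add_mul, TensorProduct.tmul_add, hs, ht]
        | tmul p q => simp
    exact h1 R

theorem coactComul_eq (t : H ⊗[k] (H ⊗[k] H)) (m : M) :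
    V.coactComul Q.comul t m = TensorProduct.map LinearMap.id (evalOp H m)
      (pairHom (Q.conv (outLeg₁ k H _) (outLeg₂ k H _)) (outLeg₃ k H _) R *
        pairHom ((outLeg₃ k H _).comp V.act) (pairHom (outLeg₁ k H _) (outLeg₂ k H _)) t) := by
  induction t using TensorProduct.induction_on with
  | zero => simp
  | add s t hs ht => simp only [map_add, LinearMap.add_apply, mul_add, hs, ht]
  | tmul a t =>
    rw [coactComul_tmul, hR]
    clear hR
    induction R using tensor_induction_two with
    | add s t hs ht => simp only [map_add, add_mul, hs, ht]
    | tmul x y =>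
      have h1 : ∀ s : H ⊗[k] H, TensorProduct.assoc k H H M ((s * t) ⊗ₜ y (V.act a m)) =
          TensorProduct.map LinearMap.id (evalOp H m)
          (pairHom (outLeg₁ k H _) (outLeg₂ k H _) s * outLeg₃ k H _ y *
            pairHom ((outLeg₃ k H _).comp V.act) (pairHom (outLeg₁ k H _) (outLeg₂ k H _))
              (a ⊗ₜ t)) := by
        intro s
        induction s using tensor_induction_two with
        | add s t hs ht => simp only [map_add, add_mul, TensorProduct.add_tmul, hs, ht]
        | tmul p q =>
          induction t using tensor_induction_two with
          | add s t hs ht =>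
            simp only [map_add, mul_add, TensorProduct.add_tmul, TensorProduct.tmul_add, hs, ht]
          | tmul b c => simp
      simpa [conv_apply] using h1 (Q.comul x)

/-- Evaluated at a vector, the three conditions on R are the three Yetter-Drinfeld axioms. The
converse below needs in addition that vectors separate tensors. -/
theorem isYetterDrinfeld_of_isYDElement (h : Q.IsYDElement V.act R) :
    V.IsYetterDrinfeld Q.toQuasiBialgebra := by
  refine ⟨fun m => ?_, fun m => ?_, fun x m => ?_⟩
  · have h1 := coactTwice_eq hR Q.Phi m
    have h2 := coactComul_eq Q hR Q.Phi m
    change V.coactTwice Q.Phi m = tensorAct (Algebra.lmul k H) _ Q.Phi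
      (V.coactComul Q.comul Q.Phi m)
    rw [h1, h2, tensorAct_lmul_lmul_evalOp]
    have h3 := h.hexagon
    simp only [asc] at h3
    rw [h3, mul_assoc]
  · have h1 : ∀ s : H ⊗[k] Module.End k M, TensorProduct.lid k M
        (TensorProduct.map Q.counit.toLinearMap LinearMap.id (evalOp H m s)) =
        pairHom (Q.unitHom _) (AlgHom.id k _) s m := by
      intro s
      induction s using tensor_induction_two with
      | add s t hs ht => simp only [map_add, LinearMap.add_apply, hs, ht]
      | tmul x y => simp [unitHom_apply, Algebra.algebraMap_eq_smul_one]
    rw [hR, h1, h.counit, Module.End.one_apply]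
  · rw [coactMul_eq hR, hR, tensorAct_lmul_evalOp]
    have := h.compat x
    rw [conv_apply, conv_apply] at this
    rw [this]

theorem isYDElement_of_isYetterDrinfeld [Module.Finite k M]
    (h : V.IsYetterDrinfeld Q.toQuasiBialgebra) : Q.IsYDElement V.act R := by
  refine ⟨?_, fun x => ?_, ?_⟩
  · ext m
    have h1 : ∀ s : H ⊗[k] Module.End k M, TensorProduct.lid k M
        (TensorProduct.map Q.counit.toLinearMap LinearMap.id (evalOp H m s)) =
        pairHom (Q.unitHom _) (AlgHom.id k _) s m := by
      intro s
      induction s using tensor_induction_two with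
      | add s t hs ht => simp only [map_add, LinearMap.add_apply, hs, ht]
      | tmul x y => simp [unitHom_apply, Algebra.algebraMap_eq_smul_one]
    rw [← h1, ← hR, h.counit, Module.End.one_apply]
  · refine evalOp_ext fun m => ?_
    rw [conv_apply, conv_apply, ← coactMul_eq hR, ← tensorAct_lmul_evalOp, ← hR, h.compat]
  · refine map_evalOp_ext fun m => ?_
    have h1 := coactTwice_eq hR Q.Phi m
    have h2 := coactComul_eq Q hR Q.Phi m
    have h3 := h.coassoc m
    change V.coactTwice Q.Phi m = tensorAct (Algebra.lmul k H) _ Q.Phi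
      (V.coactComul Q.comul Q.Phi m) at h3
    rw [h1, h2, tensorAct_lmul_lmul_evalOp] at h3
    rw [asc, asc, asc, h3, mul_assoc]

end YDData

/-! ### Transport of R and of the Drinfeld element along algebra maps. -/

namespace QuasiHopfAlgebra

variable {k H : Type*} [Field k] [Ring H] [Algebra k H] {Q : QuasiHopfAlgebra k H}
variable {E E' : Type*} [Ring E] [Algebra k E] [Ring E'] [Algebra k E'] {π : H →ₐ[k] E}
variable {R : H ⊗[k] E} (φ : E →ₐ[k] E')

theorem pairHom_comp_algHom {A B : Type*} [Ring A] [Algebra k A] [Ring B] [Algebra k B]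
    (a : A →ₐ[k] B) (b : E' →ₐ[k] B) [Commuting a b] (t : A ⊗[k] E) :
    pairHom a b (Algebra.TensorProduct.map (AlgHom.id k A) φ t) = pairHom a (b.comp φ) t := by
  rw [pairHom_map]; rfl

theorem IsYDElement.map (hR : Q.IsYDElement π R) :
    Q.IsYDElement (φ.comp π) (Algebra.TensorProduct.map (AlgHom.id k H) φ R) := by
  refine ⟨?_, fun h => ?_, ?_⟩
  · rw [pairHom_comp_algHom]
    exact hR.pair_unit ((AlgHom.id k E').comp φ)
  · have h1 := hR.conv_mul (legL k H E') ((legR k H E').comp φ) h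
    rw [← pairHom_comp_algHom, pairHom_legL_legR] at h1
    exact h1
  · have h1 := hR.hexagon_mul (outLeg₁ k H E') (outLeg₂ k H E') ((outLeg₃ k H E').comp φ)
    rw [← pairHom_comp_algHom φ (outLeg₂ k H E') (outLeg₃ k H E'),
      ← pairHom_comp_algHom φ (outLeg₁ k H E') (outLeg₃ k H E'),
      ← pairHom_comp_algHom φ (Q.conv (outLeg₁ k H E') (outLeg₂ k H E')) (outLeg₃ k H E')] at h1
    exact h1

theorem drinfeldElt_map (R : H ⊗[k] E) : Q.drinfeldElt (φ.comp π)
    (Algebra.TensorProduct.map (AlgHom.id k H) φ R) = φ (Q.drinfeldElt π R) := by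
  have h1 : ∀ s, Q.alphaForm (φ.comp π) (Algebra.TensorProduct.map (AlgHom.id k H) φ s) =
      φ (Q.alphaForm π s) := by
    intro s
    induction s using tensor_induction_two with
    | add s t hs ht => simp only [map_add, hs, ht]
    | tmul a b => simp [alphaForm_tmul]
  have h2 : ∀ s, mulFlip (φ.comp π) (Algebra.TensorProduct.map (AlgHom.id k H) φ R) s =
      Algebra.TensorProduct.map (AlgHom.id k H) φ (mulFlip π R s) := by
    intro s
    rw [mulFlip, mulFlip, map_mul]
    congr 1
    induction s using tensor_induction_two with
    | add s t hs ht => simp only [map_add, hs, ht]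
    | tmul a b => simp
  rw [drinfeldElt, h2, h1, drinfeldElt]

end QuasiHopfAlgebra

section ConjHom

variable {k : Type*} [Field k] {M N : Type*} [AddCommGroup M] [Module k M] [AddCommGroup N]
  [Module k N]

/-- The algebra map `x ↦ e⁻¹ x e`. -/
def conjHom (e : N ≃ₗ[k] M) : Module.End k M →ₐ[k] Module.End k N :=
  AlgHom.ofLinearMap e.symm.conj.toLinearMap (by ext; simp [LinearEquiv.conj_apply])
    (by intros; ext; simp [LinearEquiv.conj_apply])

@[simp] theorem conjHom_apply (e : N ≃ₗ[k] M) (x : Module.End k M) (n : N) :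
    conjHom e x n = e.symm (x (e n)) := by simp [conjHom, LinearEquiv.conj_apply]

end ConjHom

/-! ### Transported modules, and the coactions of the two duals in terms of R. -/

namespace YDData

open QuasiHopfAlgebra

variable {k H : Type*} [Field k] [Ring H] [Algebra k H] (Q : QuasiHopfAlgebra k H)
variable {M : Type*} [AddCommGroup M] [Module k M] {N : Type*} [AddCommGroup N] [Module k N]
variable {V : YDData k H M} {W : YDData k H N} {R : H ⊗[k] Module.End k M}

/-- If action and coaction on N are those of M conjugated by e, the axioms on N follow from those on
M, and e preserves both structures by construction. -/
theorem isYDIso_of_conjHom [Module.Finite k M] (hV : V.IsYetterDrinfeld Q.toQuasiBialgebra)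
    (hR : ∀ m, V.coact m = evalOp H m R) (e : N ≃ₗ[k] M) (hact : W.act = (conjHom e).comp V.act)
    (hcoact : ∀ n, W.coact n = evalOp H n
      (Algebra.TensorProduct.map (AlgHom.id k H) (conjHom e) R)) :
    IsYDIso Q.toQuasiBialgebra W V e where
  source := by
    refine isYetterDrinfeld_of_isYDElement Q hcoact ?_
    rw [hact]
    exact (isYDElement_of_isYetterDrinfeld Q hR hV).map _
  target := hV
  map_act h n := by simp [hact]
  map_coact n := by
    rw [hcoact, hR]
    clear hR hcoact
    induction R using tensor_induction_two with
    | add s t hs ht => simp only [map_add, ← hs, ← ht]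
    | tmul x y => simp

section Dual

variable [Module.Finite k M] (V)

/-- The transpose, as a linear map. -/
abbrev transp (k M : Type*) [Field k] [AddCommGroup M] [Module k M] :
    Module.End k M →ₗ[k] Module.End k (Module.Dual k M) := Module.Dual.transpose

omit [Module.Finite k M] in
theorem transp_mul (x y : Module.End k M) : transp k M (x * y) = transp k M y * transp k M x := rfl

theorem transp_transp (x : Module.End k M) : transp k _ (transp k M x) =
    conjHom (Module.evalEquiv k M).symm x := by
  ext φ ψ
  obtain ⟨m, rfl⟩ := (Module.evalEquiv k M).surjective φ
  rw [conjHom_apply, LinearEquiv.symm_symm, LinearEquiv.symm_apply_apply]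
  rfl

/-- Summing over dual bases expands the transposed operator applied to ψ. So the coactions on the
duals are obtained from R by twisting and transposing its second component. -/
theorem dualSum_contract {T : H ⊗[k] Module.End k M} {F : M →ₗ[k] H ⊗[k] M}
    (hF : ∀ m, F m = evalOp H m T) (g : H →ₗ[k] H) (ψ : Module.Dual k M) :
    dualSum k M H (g ∘ₗ contract ψ ∘ₗ F) =
      evalOp H ψ (TensorProduct.map g (transp k M) T) := by
  have h1 : dualSum k M H (g ∘ₗ contract ψ ∘ₗ F) =
      ∑ i : Fin (Module.finrank k M), g (contract ψ (evalOp H (Module.finBasis k M i) T)) ⊗ₜ[k]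
        (Module.finBasis k M).coord i := by
    simp only [← hF]
    rfl
  rw [h1]
  clear hF h1
  induction T using tensor_induction_two with
  | add s t hs ht =>
    simp only [map_add, TensorProduct.add_tmul, Finset.sum_add_distrib, hs, ht]
  | tmul h x =>
    simp only [evalOp_tmul, contract, LinearMap.comp_apply, TensorProduct.map_tmul,
      LinearMap.id_apply, LinearEquiv.coe_coe, TensorProduct.rid_tmul, map_smul]
    have : transp k M x ψ = ∑ i, ψ (x (Module.finBasis k M i)) • (Module.finBasis k M).coord i := by
      exact ((Module.finBasis k M).sum_dual_apply_smul_coord (ψ ∘ₗ x)).symm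
    rw [this, TensorProduct.tmul_sum]
    simp [TensorProduct.smul_tmul]

variable {V}

theorem leftDual_act (h : H) : (V.leftDual Q).act h = transp k M (V.act (Q.S h)) := rfl

theorem rightDual_act (h : H) : (V.rightDual Q).act h = transp k M (V.act (Q.Sinv h)) := rfl

theorem leftDual_coact (hR : ∀ m, V.coact m = evalOp H m R) (ψ : Module.Dual k M) :
    (V.leftDual Q).coact ψ =
      evalOp H ψ (TensorProduct.map Q.Sinv (transp k M) (Q.twistElt V.act R)) := by
  refine dualSum_contract (fun m => ?_) Q.Sinv ψ
  rw [twistCoactAux, LinearMap.comp_apply, coactMul_eq hR, tensorAct_lmul_evalOp, twistElt,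
    mul_assoc]

/-- For linear maps `s` and `t` with values in an algebra, the map `a ⊗ b ↦ (x ↦ s(a) x t(b))`. -/
def outerMul {A : Type*} [Ring A] [Algebra k A] (s t : H →ₗ[k] A) : H ⊗[k] H →ₗ[k] A →ₗ[k] A :=
  TensorProduct.lift (LinearMap.mk₂ k
    (fun a b => LinearMap.mulLeft k (s a) ∘ₗ LinearMap.mulRight k (t b))
    (by intros; ext; simp [add_mul])
    (by intros; ext; simp)
    (by intros; ext; simp [mul_add])
    (by intros; ext; simp))

@[simp] theorem outerMul_tmul {A : Type*} [Ring A] [Algebra k A] (s t : H →ₗ[k] A) (a b : H)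
    (x : A) : outerMul s t (a ⊗ₜ b) x = s a * (x * t b) := by simp [outerMul]

/-- The map `f¹ ⊗ f² ↦ (g¹ ⊗ g² ↦ (h ⊗ x ↦ g¹ S(h) f² ⊗ S⁻¹(f¹) x S⁻¹(g²)))`. -/
def rightTwist {E : Type*} [Ring E] [Algebra k E] (π : H →ₐ[k] E) (s t : H ⊗[k] H)
    (R : H ⊗[k] E) : H ⊗[k] E :=
  outerMul ((legR k H E).toLinearMap ∘ₗ π.toLinearMap ∘ₗ Q.Sinv) (legL k H E).toLinearMap s
    (outerMul (legL k H E).toLinearMap ((legR k H E).toLinearMap ∘ₗ π.toLinearMap ∘ₗ Q.Sinv) t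
      (TensorProduct.map Q.S LinearMap.id R))

theorem rightTwist_tmul {E : Type*} [Ring E] [Algebra k E] (π : H →ₐ[k] E) (a b c d h : H)
    (x : E) : rightTwist Q π (a ⊗ₜ b) (c ⊗ₜ d) (h ⊗ₜ x) =
      (c * Q.S h * b) ⊗ₜ (π (Q.Sinv a) * x * π (Q.Sinv d)) := by
  simp [rightTwist, mul_assoc]

theorem rightDual_coact (hR : ∀ m, V.coact m = evalOp H m R) (ψ : Module.Dual k M) :
    (V.rightDual Q).coact ψ =
      evalOp H ψ (TensorProduct.map LinearMap.id (transp k M)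
        (rightTwist Q V.act Q.f Q.fInv R)) := by
  refine dualSum_contract (F := V.rightDualF Q Q.f ∘ₗ V.rightDualG Q Q.fInv) (fun m => ?_)
    LinearMap.id ψ
  have h1 : ∀ (t : H ⊗[k] H) (m : M), V.rightDualG Q t m = evalOp H m
      (outerMul (legL k H _).toLinearMap ((legR k H _).toLinearMap ∘ₗ V.act.toLinearMap ∘ₗ Q.Sinv) t
      (TensorProduct.map Q.S LinearMap.id R)) := by
    intro t m
    induction t using tensor_induction_two with
    | add s t hs ht => simp only [map_add, LinearMap.add_apply, hs, ht]
    | tmul a b =>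
      simp only [rightDualG, TensorProduct.lift.tmul, LinearMap.mk₂_apply, LinearMap.comp_apply, hR]
      clear hR
      induction R using tensor_induction_two with
      | add s t hs ht => simp only [map_add, hs, ht]
      | tmul x y => simp
  have h2 : ∀ (t : H ⊗[k] H) (X : H ⊗[k] Module.End k M), V.rightDualF Q t (evalOp H m X) =
      evalOp H m (outerMul ((legR k H _).toLinearMap ∘ₗ V.act.toLinearMap ∘ₗ Q.Sinv)
        (legL k H _).toLinearMap t X) := by
    intro t X
    induction t using tensor_induction_two with
    | add s t hs ht => simp only [map_add, LinearMap.add_apply, hs, ht]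
    | tmul a b =>
      induction X using tensor_induction_two with
      | add s t hs ht => simp only [map_add, hs, ht]
      | tmul x y => simp [rightDualF]
  rw [LinearMap.comp_apply, h1, h2]
  rfl

end Dual

end YDData

/-! ### The four double duals as transports of M. -/

namespace YDData

open QuasiHopfAlgebra

variable {k H : Type*} [Field k] [Ring H] [Algebra k H] {Q : QuasiHopfAlgebra k H}
variable {M : Type*} [AddCommGroup M] [Module k M] [Module.Finite k M]
variable {V : YDData k H M} {R : H ⊗[k] Module.End k M}

section Twist

variable {E : Type*} [Ring E] [Algebra k E] {π : H →ₐ[k] E} {R : H ⊗[k] E}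

theorem calF_mul_inv : Q.calF * (Q.fInv * Q.flipS Q.f) = 1 := by
  rw [calF, mul_assoc, ← mul_assoc Q.f, f_mul_fInv, one_mul, ← flipS_mul, f_mul_fInv, flipS_one]

theorem inv_mul_calF : Q.fInv * Q.flipS Q.f * Q.calF = 1 := by
  rw [calF, mul_assoc, ← mul_assoc (Q.flipS Q.f), ← flipS_mul, fInv_mul_f, flipS_one, one_mul,
    fInv_mul_f]

/-- `Ring.inverse` is zero on non-units; the two preceding identities exhibit 𝓕 as a unit and name
its inverse. -/
theorem ringInverse_calF : Ring.inverse Q.calF = Q.fInv * Q.flipS Q.f :=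
  (Ring.inverse_unit ⟨Q.calF, _, calF_mul_inv, inv_mul_calF⟩ :)

theorem calF_conj (hR : Q.IsYDElement π R) :
    incl π Q.calF * R * inclFlip π (Q.fInv * Q.flipS Q.f) =
      (1 ⊗ₜ Q.drinfeldElt π R) * Q.mapSS E R * (1 ⊗ₜ Q.drinfeldInv π R) := by
  have h1 : ((1 : H) ⊗ₜ[k] Q.drinfeldElt π R) * (1 ⊗ₜ[k] Q.drinfeldInv π R) = 1 := by
    rw [Algebra.TensorProduct.tmul_mul_tmul, Q.drinfeldElt_mul_drinfeldInv hR, mul_one,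
      Algebra.TensorProduct.one_def]
  rw [← Q.calF_conj_mul hR, mul_assoc (_ * _ * _), h1, mul_one]

end Twist

/-- One-sided inverses of endomorphisms of a finite-dimensional space are two-sided. -/
theorem drinfeldInv_mul_drinfeldElt (hY : Q.IsYDElement V.act R) :
    Q.drinfeldInv V.act R * Q.drinfeldElt V.act R = 1 :=
  mul_eq_one_comm.1 (Q.drinfeldElt_mul_drinfeldInv hY)

/-- The Drinfeld element as a bijection. -/
def drinfeldEquiv (hY : Q.IsYDElement V.act R) : M ≃ₗ[k] M :=
  LinearEquiv.ofLinearMap (Q.drinfeldElt V.act R) (Q.drinfeldInv V.act R)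
    (Q.drinfeldElt_mul_drinfeldInv hY) (drinfeldInv_mul_drinfeldElt hY)

/-- The bijection from the double dual to `M` given by the inverse of the Drinfeld element. -/
def leftEquiv (hY : Q.IsYDElement V.act R) : Module.Dual k (Module.Dual k M) ≃ₗ[k] M :=
  (Module.evalEquiv k M).symm ≪≫ₗ (drinfeldEquiv hY).symm

/-- The bijection from the double dual to `M` given by the Drinfeld element. -/
def rightEquiv (hY : Q.IsYDElement V.act R) : Module.Dual k (Module.Dual k M) ≃ₗ[k] M :=
  (Module.evalEquiv k M).symm ≪≫ₗ drinfeldEquiv hY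

theorem conjHom_leftEquiv (hY : Q.IsYDElement V.act R) (x : Module.End k M) :
    conjHom (leftEquiv hY) x = conjHom (Module.evalEquiv k M).symm
      (Q.drinfeldElt V.act R * x * Q.drinfeldInv V.act R) := rfl

theorem conjHom_rightEquiv (hY : Q.IsYDElement V.act R) (x : Module.End k M) :
    conjHom (rightEquiv hY) x = conjHom (Module.evalEquiv k M).symm
      (Q.drinfeldInv V.act R * x * Q.drinfeldElt V.act R) := rfl

omit [Module.Finite k M] in
theorem drinfeldElt_conj (hY : Q.IsYDElement V.act R) (h : H) :
    Q.drinfeldElt V.act R * V.act h * Q.drinfeldInv V.act R = V.act (Q.S (Q.S h)) := by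
  rw [Q.drinfeldElt_mul hY, mul_assoc, Q.drinfeldElt_mul_drinfeldInv hY, mul_one]

theorem drinfeldInv_conj (hY : Q.IsYDElement V.act R) (h : H) :
    Q.drinfeldInv V.act R * V.act h * Q.drinfeldElt V.act R = V.act (Q.Sinv (Q.Sinv h)) := by
  rw [mul_assoc, ← Q.drinfeldElt_mul_Sinv hY, ← mul_assoc, drinfeldInv_mul_drinfeldElt hY, one_mul]

theorem leftDual_leftDual_act (hY : Q.IsYDElement V.act R) :
    ((V.leftDual Q).leftDual Q).act = (conjHom (leftEquiv hY)).comp V.act := by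
  refine AlgHom.ext fun h => ?_
  rw [leftDual_act, leftDual_act, transp_transp, AlgHom.comp_apply, conjHom_leftEquiv,
    drinfeldElt_conj hY]

theorem rightDual_rightDual_act (hY : Q.IsYDElement V.act R) :
    ((V.rightDual Q).rightDual Q).act = (conjHom (rightEquiv hY)).comp V.act := by
  refine AlgHom.ext fun h => ?_
  rw [rightDual_act, rightDual_act, transp_transp, AlgHom.comp_apply, conjHom_rightEquiv,
    drinfeldInv_conj hY]

theorem rightDual_leftDual_act :
    ((V.leftDual Q).rightDual Q).act = (conjHom (Module.evalEquiv k M).symm).comp V.act := by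
  refine AlgHom.ext fun h => ?_
  rw [rightDual_act, leftDual_act, transp_transp, AlgHom.comp_apply, S_Sinv]

theorem leftDual_rightDual_act :
    ((V.rightDual Q).leftDual Q).act = (conjHom (Module.evalEquiv k M).symm).comp V.act := by
  refine AlgHom.ext fun h => ?_
  rw [leftDual_act, rightDual_act, transp_transp, AlgHom.comp_apply, Sinv_S]

/-- Two transpositions give conjugation by the canonical map and S⁻² on the first component. The
twists of the two stages combine to conjugation by 𝓕, which by `calF_conj` is S² on the first
component followed by conjugation with the Drinfeld element. The powers of S cancel. -/
theorem leftDual_leftDual_coact (hR : ∀ m, V.coact m = evalOp H m R)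
    (hY : Q.IsYDElement V.act R) (φ : Module.Dual k (Module.Dual k M)) :
    ((V.leftDual Q).leftDual Q).coact φ = evalOp H φ
      (Algebra.TensorProduct.map (AlgHom.id k H) (conjHom (leftEquiv hY)) R) := by
  rw [leftDual_coact Q (leftDual_coact Q hR)]
  congr 1
  have h1 : ∀ (s t : H ⊗[k] H) (X : H ⊗[k] Module.End k M),
      TensorProduct.map Q.Sinv (transp k _) (incl (V.leftDual Q).act s *
        TensorProduct.map Q.Sinv (transp k M) X * inclFlip (V.leftDual Q).act t) =
      TensorProduct.map (Q.Sinv ∘ₗ Q.Sinv) (conjHom (Module.evalEquiv k M).symm).toLinearMap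
        (incl V.act (Q.flipS t) * X * incl V.act (Q.mapS s)) := by
    intro s t X
    induction s using tensor_induction_two with
    | add s t hs ht => simp only [map_add, add_mul, mul_add, hs, ht]
    | tmul a b =>
      induction t using tensor_induction_two with
      | add s t hs ht => simp only [map_add, add_mul, mul_add, hs, ht]
      | tmul c d =>
        induction X using tensor_induction_two with
        | add s t hs ht => simp only [map_add, add_mul, mul_add, hs, ht]
        | tmul h x =>
          simp only [pairHom_tmul, AlgHom.comp_apply, Algebra.TensorProduct.includeLeft_apply,
            Algebra.TensorProduct.includeRight_apply, Algebra.TensorProduct.tmul_mul_tmul, mul_one,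
            one_mul, TensorProduct.map_tmul, leftDual_act, ← transp_mul, transp_transp, flipS_tmul,
            mapS_tmul, LinearMap.comp_apply, Q.Sinv_mul, Sinv_S, AlgHom.toLinearMap_apply,
            mul_assoc]
  -- The inner twists f and f⁻¹ come from M^*; the outer ones were transposed and pass through S on
  -- their way inside. On the left they form 𝓕, on the right its inverse.
  have h2 : incl V.act (Q.flipS Q.fInv) * Q.twistElt V.act R * incl V.act (Q.mapS Q.f) =
      incl V.act Q.calF * R * inclFlip V.act (Q.fInv * Q.flipS Q.f) := by
    rw [calF, twistElt, ← inclFlip_flipS]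
    simp only [map_mul, mul_assoc]
  rw [twistElt, h1, h2, calF_conj hY]
  have h3 : ∀ X : H ⊗[k] Module.End k M, TensorProduct.map (Q.Sinv ∘ₗ Q.Sinv)
      (conjHom (Module.evalEquiv k M).symm).toLinearMap ((1 ⊗ₜ Q.drinfeldElt V.act R) *
        Q.mapSS _ X * (1 ⊗ₜ Q.drinfeldInv V.act R)) =
      Algebra.TensorProduct.map (AlgHom.id k H) (conjHom (leftEquiv hY)) X := by
    intro X
    induction X using tensor_induction_two with
    | add s t hs ht => simp only [map_add, add_mul, mul_add, hs, ht]
    | tmul h x =>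
      rw [mapSS_tmul]
      simp only [Algebra.TensorProduct.tmul_mul_tmul, mul_one, one_mul, TensorProduct.map_tmul,
        LinearMap.comp_apply, Sinv_S, AlgHom.toLinearMap_apply, Algebra.TensorProduct.map_tmul,
        AlgHom.id_apply, conjHom_leftEquiv]
  rw [h3]

/-- In a double right dual the action carries S⁻². By uh = S²(h)u this is conjugation by the
Drinfeld element, which can be pulled out of the whole expression. -/
theorem rightTwist_transp (s t s' t' : H ⊗[k] H) (X : H ⊗[k] Module.End k M)
    (hY : Q.IsYDElement V.act R) :
    TensorProduct.map LinearMap.id (transp k _) (rightTwist Q (V.rightDual Q).act s t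
      (TensorProduct.map LinearMap.id (transp k M) (rightTwist Q V.act s' t' X))) =
    TensorProduct.map LinearMap.id (conjHom (rightEquiv hY)).toLinearMap
      (incl V.act (t * Q.flipS s') * ((1 ⊗ₜ Q.drinfeldElt V.act R) *
        Q.mapSS _ X * (1 ⊗ₜ Q.drinfeldInv V.act R)) * inclFlip V.act (Q.flipS t' * s)) := by
  have h0 : ∀ (h h' : H) (x : Module.End k M), V.act (Q.Sinv (Q.Sinv h)) * x *
      V.act (Q.Sinv (Q.Sinv h')) = Q.drinfeldInv V.act R * (V.act h * (Q.drinfeldElt V.act R * x *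
        Q.drinfeldInv V.act R) * V.act h') * Q.drinfeldElt V.act R := by
    intro h h' x
    rw [← drinfeldInv_conj hY, ← drinfeldInv_conj hY]
    simp only [mul_assoc]
  induction s using tensor_induction_two with
  | add s t hs ht =>
    simp only [rightTwist, map_add, LinearMap.add_apply, mul_add] at hs ht ⊢
    rw [hs, ht]
  | tmul a b =>
    induction t using tensor_induction_two with
    | add s t hs ht =>
      simp only [rightTwist, map_add, LinearMap.add_apply, add_mul] at hs ht ⊢
      rw [hs, ht]
    | tmul c d =>
      induction s' using tensor_induction_two with
      | add s t hs ht =>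
        simp only [rightTwist, map_add, LinearMap.add_apply, mul_add, add_mul] at hs ht ⊢
        rw [hs, ht]
      | tmul a' b' =>
        induction t' using tensor_induction_two with
        | add s t hs ht =>
        simp only [rightTwist, map_add, LinearMap.add_apply, mul_add, add_mul] at hs ht ⊢
        rw [hs, ht]
        | tmul c' d' =>
          induction X using tensor_induction_two with
          | add s t hs ht =>
            simp only [rightTwist, map_add, mul_add, add_mul] at hs ht ⊢
            rw [hs, ht]
          | tmul h x =>
            have h1 := h0 (d * Q.S a') (Q.S d' * a) x
            simp only [Q.Sinv_mul, Sinv_S, map_mul, mul_assoc] at h1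
            simp only [rightTwist_tmul, TensorProduct.map_tmul, flipS_tmul, mapSS_tmul,
              Algebra.TensorProduct.tmul_mul_tmul, pairHom_tmul, AlgHom.comp_apply,
              Algebra.TensorProduct.includeLeft_apply, Algebra.TensorProduct.includeRight_apply,
              mul_one, one_mul, LinearMap.id_apply, rightDual_act, ← transp_mul, transp_transp,
              AlgHom.toLinearMap_apply, conjHom_rightEquiv, Q.S_mul, mul_assoc,
              map_mul V.act, h1]

/-- The twists of the two stages combine to conjugation by the inverse of 𝓕. It undoes the
conjugation by 𝓕 that `calF_conj` substitutes for the Drinfeld element and S², so R itself remains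
inside the transport. -/
theorem rightDual_rightDual_coact (hR : ∀ m, V.coact m = evalOp H m R)
    (hY : Q.IsYDElement V.act R) (φ : Module.Dual k (Module.Dual k M)) :
    ((V.rightDual Q).rightDual Q).coact φ = evalOp H φ
      (Algebra.TensorProduct.map (AlgHom.id k H) (conjHom (rightEquiv hY)) R) := by
  rw [rightDual_coact Q (rightDual_coact Q hR), rightTwist_transp _ _ _ _ _ hY, ← calF_conj hY]
  congr 1
  have h : incl V.act (Q.fInv * Q.flipS Q.f) * (incl V.act Q.calF * R *
      inclFlip V.act (Q.fInv * Q.flipS Q.f)) * inclFlip V.act (Q.flipS Q.fInv * Q.f) = R := by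
    rw [mul_assoc, mul_assoc, mul_assoc, ← map_mul (inclFlip V.act), ← calF, inv_mul_calF, map_one,
      mul_one, ← mul_assoc, ← map_mul, inv_mul_calF, map_one, one_mul]
  rw [h]
  rfl

/-- In the mixed double duals S meets S⁻¹ and f meets f⁻¹, so only the canonical map remains. -/
theorem rightDual_leftDual_coact (hR : ∀ m, V.coact m = evalOp H m R)
    (φ : Module.Dual k (Module.Dual k M)) :
    ((V.leftDual Q).rightDual Q).coact φ = evalOp H φ
      (Algebra.TensorProduct.map (AlgHom.id k H) (conjHom (Module.evalEquiv k M).symm) R) := by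
  rw [rightDual_coact Q (leftDual_coact Q hR)]
  congr 1
  have h1 : ∀ (s t : H ⊗[k] H) (X : H ⊗[k] Module.End k M),
      TensorProduct.map LinearMap.id (transp k _) (rightTwist Q (V.leftDual Q).act s t
        (TensorProduct.map Q.Sinv (transp k M) X)) =
      Algebra.TensorProduct.map (AlgHom.id k H) (conjHom (Module.evalEquiv k M).symm)
        (incl V.act t * X * inclFlip V.act s) := by
    intro s t X
    induction s using tensor_induction_two with
    | add s t hs ht =>
      simp only [rightTwist, map_add, LinearMap.add_apply, mul_add] at hs ht ⊢; rw [hs, ht]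
    | tmul a b =>
      induction t using tensor_induction_two with
      | add s t hs ht =>
        simp only [rightTwist, map_add, LinearMap.add_apply, add_mul] at hs ht ⊢
        rw [hs, ht]
      | tmul c d =>
        induction X using tensor_induction_two with
        | add s t hs ht =>
          simp only [rightTwist, map_add, mul_add, add_mul] at hs ht ⊢
          rw [hs, ht]
        | tmul h x =>
          simp only [pairHom_tmul, AlgHom.comp_apply, Algebra.TensorProduct.includeLeft_apply,
            Algebra.TensorProduct.includeRight_apply, Algebra.TensorProduct.tmul_mul_tmul, mul_one,
            one_mul, TensorProduct.map_tmul, leftDual_act, ← transp_mul, transp_transp,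
            rightTwist_tmul, S_Sinv, LinearMap.id_apply, Algebra.TensorProduct.map_tmul,
            AlgHom.id_apply, mul_assoc]
  rw [h1, twistElt]
  congr 1
  rw [mul_assoc, mul_assoc, ← map_mul (inclFlip V.act), fInv_mul_f, map_one, mul_one, ← mul_assoc,
    ← map_mul, fInv_mul_f, map_one, one_mul]

theorem leftDual_rightDual_coact (hR : ∀ m, V.coact m = evalOp H m R)
    (φ : Module.Dual k (Module.Dual k M)) :
    ((V.rightDual Q).leftDual Q).coact φ = evalOp H φ
      (Algebra.TensorProduct.map (AlgHom.id k H) (conjHom (Module.evalEquiv k M).symm) R) := by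
  rw [leftDual_coact Q (rightDual_coact Q hR)]
  congr 1
  have h1 : ∀ (s t s' t' : H ⊗[k] H) (X : H ⊗[k] Module.End k M),
      incl (V.rightDual Q).act s * TensorProduct.map LinearMap.id (transp k M)
        (rightTwist Q V.act s' t' X) * inclFlip (V.rightDual Q).act t =
      TensorProduct.map LinearMap.id (transp k M)
        (rightTwist Q V.act (s' * t) (s * t') X) := by
    intro s t s' t' X
    induction s using tensor_induction_two with
    | add s t hs ht =>
      simp only [rightTwist, map_add, LinearMap.add_apply, add_mul] at hs ht ⊢
      rw [hs, ht]
    | tmul a b =>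
      induction t using tensor_induction_two with
      | add s t hs ht =>
        simp only [rightTwist, map_add, LinearMap.add_apply, mul_add] at hs ht ⊢
        rw [hs, ht]
      | tmul c d =>
        induction s' using tensor_induction_two with
        | add s t hs ht =>
          simp only [rightTwist, map_add, LinearMap.add_apply, mul_add, add_mul] at hs ht ⊢
          rw [hs, ht]
        | tmul a' b' =>
          induction t' using tensor_induction_two with
          | add s t hs ht =>
            simp only [rightTwist, map_add, LinearMap.add_apply, mul_add, add_mul] at hs ht ⊢
            rw [hs, ht]
          | tmul c' d' =>
            induction X using tensor_induction_two with
            | add s t hs ht =>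
              simp only [rightTwist, map_add, mul_add, add_mul] at hs ht ⊢
              rw [hs, ht]
            | tmul h x =>
              simp only [pairHom_tmul, AlgHom.comp_apply, Algebra.TensorProduct.includeLeft_apply,
                Algebra.TensorProduct.includeRight_apply, Algebra.TensorProduct.tmul_mul_tmul,
                mul_one, one_mul, TensorProduct.map_tmul, rightDual_act, ← transp_mul,
                rightTwist_tmul, Q.Sinv_mul, map_mul, LinearMap.id_apply, mul_assoc]
  rw [twistElt, h1, f_mul_fInv]
  have h2 : TensorProduct.map Q.Sinv (transp k _) (TensorProduct.map LinearMap.id (transp k M)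
      (rightTwist Q V.act 1 1 R)) =
      Algebra.TensorProduct.map (AlgHom.id k H) (conjHom (Module.evalEquiv k M).symm) R := by
    clear hR
    induction R using tensor_induction_two with
    | add s t hs ht =>
      simp only [rightTwist, map_add] at hs ht ⊢
      rw [hs, ht]
    | tmul h x =>
      rw [Algebra.TensorProduct.one_def, rightTwist_tmul]
      simp [Q.Sinv_one, Sinv_S, transp_transp]
  rw [h2]

end YDData

/-! ### The maps θ and θ' are the canonical map to the double dual. -/

namespace YDData

open QuasiHopfAlgebra

variable {k H : Type*} [Field k] [Ring H] [Algebra k H] (Q : QuasiHopfAlgebra k H)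
variable {M : Type*} [AddCommGroup M] [Module k M] [Module.Finite k M]
variable (V : YDData k H M)

theorem dualSum_apply {X : Type*} [AddCommGroup X] [Module k X] (T : M →ₗ[k] X) :
    dualSum k M X T = ∑ i : Fin (Module.finrank k M),
      T (Module.finBasis k M i) ⊗ₜ[k] (Module.finBasis k M).coord i := rfl

theorem sum_coord_smul {X : Type*} [AddCommGroup X] [Module k X] (T : M →ₗ[k] X) (m : M) :
    ∑ i : Fin (Module.finrank k M),
      (Module.finBasis k M).coord i m • T (Module.finBasis k M i) = T m := by
  conv_rhs => rw [← (Module.finBasis k M).sum_repr m, map_sum]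
  simp only [map_smul]
  rfl

theorem sum_smul_coord {X : Type*} [AddCommGroup X] [Module k X] (ψ : Module.Dual k M)
    (T : Module.Dual k M →ₗ[k] X) : ∑ i : Fin (Module.finrank k M),
      ψ (Module.finBasis k M i) • T ((Module.finBasis k M).coord i) = T ψ := by
  conv_rhs => rw [← (Module.finBasis k M).sum_dual_apply_smul_coord ψ, map_sum]
  simp only [map_smul]

omit [Module.Finite k M] in
theorem eval_comp_transp (m : M) (x : Module.End k M) :
    Module.Dual.eval k M m ∘ₗ transp k M x = Module.Dual.eval k M (x m) := rfl

theorem conjHom_eval (x : Module.End k M) (m : M) : conjHom (Module.evalEquiv k M).symm x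
    (Module.Dual.eval k M m) = Module.Dual.eval k M (x m) := by
  rw [conjHom_apply, LinearEquiv.symm_symm, ← Module.evalEquiv_toLinearMap,
    LinearEquiv.coe_coe, LinearEquiv.symm_apply_apply]

/-- Contracting the dual bases leaves the action of S⁻¹(S(x¹)αx²βS(x³)) = 1. For θ' the element that
remains is X¹βS(X²)αX³ = 1. -/
theorem theta_eq : V.theta Q = Module.Dual.eval k M := by
  have key : ∀ (t : H ⊗[k] (H ⊗[k] H)) (m : M),
      (TensorProduct.lid k _) (TensorProduct.map (V.ev' Q) LinearMap.id
        ((TensorProduct.assoc k M _ _).symm (tensorAct V.act (tensorAct (V.rightDual Q).act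
          ((V.rightDual Q).leftDual Q).act) t (m ⊗ₜ (V.rightDual Q).coev Q)))) =
      Module.Dual.eval k M (V.act (Q.Sinv (Q.alphaBeta t)) m) := by
    intro t m
    induction t using tensor_induction_three with
    | add s t hs ht => simp only [map_add, LinearMap.add_apply, hs, ht]
    | tmul x y z =>
      rw [coev, dualSum_apply, TensorProduct.tmul_sum, map_sum, map_sum, map_sum, map_sum]
      simp only [tensorAct_tmul, TensorProduct.assoc_symm_tmul, TensorProduct.map_tmul,
        TensorProduct.lid_tmul, LinearMap.id_apply, leftDual_rightDual_act, rightDual_act, ev',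
        LinearMap.comp_apply, contractRight_apply, AlgHom.comp_apply]
      refine (sum_smul_coord (Module.Dual.eval k M (V.act (Q.Sinv Q.alpha) (V.act x m)) ∘ₗ
        transp k M (V.act (Q.Sinv y)) ∘ₗ transp k M (V.act (Q.Sinv Q.beta)))
        (conjHom (Module.evalEquiv k M).symm (V.act z))).trans ?_
      rw [← LinearMap.comp_assoc, eval_comp_transp, eval_comp_transp, conjHom_eval, alphaBeta_tmul]
      simp only [Q.Sinv_mul, Sinv_S, map_mul, Module.End.mul_apply]
  refine LinearMap.ext fun m => ?_
  have h := key Q.PhiInv m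
  rw [alphaBeta_PhiInv, Q.Sinv_one, map_one, Module.End.one_apply] at h
  exact h

theorem theta'_eq : V.theta' Q = Module.Dual.eval k M := by
  have key : ∀ (t : H ⊗[k] (H ⊗[k] H)) (m : M),
      (TensorProduct.rid k _) (TensorProduct.map LinearMap.id (V.ev Q)
        (tensorAct ((V.leftDual Q).rightDual Q).act (tensorAct (V.leftDual Q).act V.act) t
          (TensorProduct.assoc k _ _ _ ((V.leftDual Q).coev' Q ⊗ₜ m)))) =
      Module.Dual.eval k M (V.act (Q.betaAlpha t) m) := by
    intro t m
    induction t using tensor_induction_three with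
    | add s t hs ht => simp only [map_add, LinearMap.add_apply, hs, ht]
    | tmul x y z =>
      rw [coev', dualSum_apply, map_sum, TensorProduct.sum_tmul, map_sum, map_sum, map_sum, map_sum]
      simp only [tensorAct_tmul, TensorProduct.assoc_tmul, TensorProduct.map_tmul,
        TensorProduct.comm_tmul,
        TensorProduct.rid_tmul, LinearMap.id_apply, rightDual_leftDual_act, leftDual_act, ev,
        LinearMap.comp_apply, contractLeft_apply, AlgHom.comp_apply, S_Sinv]
      refine (sum_smul_coord (Module.Dual.eval k M (V.act Q.alpha (V.act z m)) ∘ₗ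
        transp k M (V.act (Q.S y)) ∘ₗ transp k M (V.act Q.beta))
        (conjHom (Module.evalEquiv k M).symm (V.act x))).trans ?_
      rw [← LinearMap.comp_assoc, eval_comp_transp, eval_comp_transp, conjHom_eval, betaAlpha_tmul]
      simp only [map_mul, Module.End.mul_apply]
  refine LinearMap.ext fun m => ?_
  have h := key Q.Phi m
  rw [betaAlpha_Phi, map_one, Module.End.one_apply] at h
  exact h

theorem thetaInv_eval (m : M) : V.thetaInv Q (Module.Dual.eval k M m) = m := by
  have key : ∀ (t : H ⊗[k] (H ⊗[k] H)),
      (TensorProduct.lid k _) (TensorProduct.map ((V.rightDual Q).ev Q) LinearMap.id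
        ((TensorProduct.assoc k _ _ _).symm (tensorAct ((V.rightDual Q).leftDual Q).act
          (tensorAct (V.rightDual Q).act V.act) t (Module.Dual.eval k M m ⊗ₜ V.coev' Q)))) =
      V.act (Q.Sinv (Q.alphaBeta t)) m := by
    intro t
    induction t using tensor_induction_three with
    | add s t hs ht => simp only [map_add, LinearMap.add_apply, hs, ht]
    | tmul x y z =>
      rw [coev', dualSum_apply, map_sum, TensorProduct.tmul_sum, map_sum, map_sum, map_sum, map_sum]
      simp only [tensorAct_tmul, TensorProduct.assoc_symm_tmul, TensorProduct.map_tmul,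
        TensorProduct.comm_tmul,
        TensorProduct.lid_tmul, LinearMap.id_apply, leftDual_rightDual_act, rightDual_act, ev,
        LinearMap.comp_apply, contractLeft_apply, AlgHom.comp_apply, conjHom_eval]
      refine (sum_coord_smul (V.act z * V.act (Q.Sinv Q.beta))
        (V.act (Q.Sinv y) (V.act (Q.Sinv Q.alpha) (V.act x m)))).trans ?_
      rw [alphaBeta_tmul]
      simp only [Q.Sinv_mul, Sinv_S, map_mul, Module.End.mul_apply]
  have h := key Q.PhiInv
  rw [alphaBeta_PhiInv, Q.Sinv_one, map_one, Module.End.one_apply] at h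
  exact h

theorem thetaInv'_eval (m : M) : V.thetaInv' Q (Module.Dual.eval k M m) = m := by
  have key : ∀ (t : H ⊗[k] (H ⊗[k] H)),
      (TensorProduct.rid k _) (TensorProduct.map LinearMap.id ((V.leftDual Q).ev' Q)
        (tensorAct V.act (tensorAct (V.leftDual Q).act ((V.leftDual Q).rightDual Q).act) t
          (TensorProduct.assoc k _ _ _ (V.coev Q ⊗ₜ Module.Dual.eval k M m)))) =
      V.act (Q.betaAlpha t) m := by
    intro t
    induction t using tensor_induction_three with
    | add s t hs ht => simp only [map_add, LinearMap.add_apply, hs, ht]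
    | tmul x y z =>
      rw [coev, dualSum_apply, TensorProduct.sum_tmul, map_sum, map_sum, map_sum, map_sum]
      simp only [tensorAct_tmul, TensorProduct.assoc_tmul, TensorProduct.map_tmul,
        TensorProduct.rid_tmul, LinearMap.id_apply, rightDual_leftDual_act, leftDual_act, ev',
        LinearMap.comp_apply, contractRight_apply, AlgHom.comp_apply, conjHom_eval, S_Sinv]
      refine (sum_coord_smul (V.act x * V.act Q.beta)
        (V.act (Q.S y) (V.act Q.alpha (V.act z m)))).trans ?_
      rw [betaAlpha_tmul]
      simp only [map_mul, Module.End.mul_apply]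
  have h := key Q.Phi
  rw [betaAlpha_Phi, map_one, Module.End.one_apply] at h
  exact h

theorem thetaInv_eq : V.thetaInv Q = (Module.evalEquiv k M).symm.toLinearMap := by
  refine LinearMap.ext fun φ => ?_
  obtain ⟨m, rfl⟩ := (Module.evalEquiv k M).surjective φ
  exact (V.thetaInv_eval Q m).trans ((Module.evalEquiv k M).symm_apply_apply m).symm

theorem thetaInv'_eq : V.thetaInv' Q = (Module.evalEquiv k M).symm.toLinearMap := by
  refine LinearMap.ext fun φ => ?_
  obtain ⟨m, rfl⟩ := (Module.evalEquiv k M).surjective φ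
  exact (V.thetaInv'_eval Q m).trans ((Module.evalEquiv k M).symm_apply_apply m).symm

theorem areInverse_theta : AreInverse (V.theta Q) (V.thetaInv Q) := by
  rw [theta_eq, thetaInv_eq, ← Module.evalEquiv_toLinearMap]
  exact ⟨LinearMap.ext (Module.evalEquiv k M).symm_apply_apply,
    LinearMap.ext (Module.evalEquiv k M).apply_symm_apply⟩

theorem areInverse_theta' : AreInverse (V.theta' Q) (V.thetaInv' Q) := by
  rw [theta'_eq, thetaInv'_eq, ← Module.evalEquiv_toLinearMap]
  exact ⟨LinearMap.ext (Module.evalEquiv k M).symm_apply_apply,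
    LinearMap.ext (Module.evalEquiv k M).apply_symm_apply⟩

/-! ### The explicit formulas are the Drinfeld element and its inverse. -/

section Formulas

variable {V} {R : H ⊗[k] Module.End k M} (hR : ∀ m, V.coact m = evalOp H m R)

omit [Module.Finite k M]

theorem actVia_evalOp (φ : H →ₗ[k] H) (X : H ⊗[k] Module.End k M) (m : M) :
    V.actVia φ (evalOp H m X) = (LinearMap.mul' k _ (TensorProduct.map
      (V.act.toLinearMap ∘ₗ φ) LinearMap.id X)) m := by
  induction X using tensor_induction_two with
  | add s t hs ht => simp only [map_add, LinearMap.add_apply, hs, ht]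
  | tmul x y => simp [actVia]

include hR

theorem rGammaInvFormula_eq : V.rGammaInvFormula Q = Q.drinfeldElt V.act R := by
  refine LinearMap.ext fun m => ?_
  rw [rGammaInvFormula, LinearMap.comp_apply, coactMul_eq hR, actVia_evalOp]
  rfl

theorem lGammaInvFormula_eq : V.lGammaInvFormula Q = Q.drinfeldInv V.act R := by
  refine LinearMap.ext fun m => ?_
  rw [lGammaInvFormula, LinearMap.comp_apply, coactMul_eq hR]
  have key : ∀ (t : H ⊗[k] H) X, V.lGammaInvAux Q t (evalOp H m X) =
      Q.drinfeldInvForm V.act t X m := by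
    intro t X
    induction t using tensor_induction_two with
    | add s t hs ht => simp only [map_add, LinearMap.add_apply, hs, ht]
    | tmul a b =>
      induction X using tensor_induction_two with
      | add s t hs ht => simp only [map_add, LinearMap.add_apply, hs, ht]
      | tmul x y => simp [lGammaInvAux, actVia, drinfeldInvForm_tmul]
  rw [key]
  rfl

/-- Since S(R¹)αR² = S(α)u and uS⁻¹(b) = S(b)u, the map given by a ⊗ b is aS(α)S(b)u. It remains to
see that V¹g¹S(α)S(V²g²) = 1. -/
theorem lGammaFormula_eq (hY : Q.IsYDElement V.act R) :
    V.lGammaFormula Q = Q.drinfeldElt V.act R := by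
  have h1 : ∀ t : H ⊗[k] H, V.lGammaAux Q t =
      V.act (sandwichRight Q.S (Q.S Q.alpha) t) * Q.drinfeldElt V.act R := by
    intro t
    induction t using tensor_induction_two with
    | add s t hs ht => simp only [map_add, add_mul, hs, ht]
    | tmul a b =>
      have h2 : ∀ m, V.actVia (LinearMap.mulRight k Q.alpha ∘ₗ LinearMap.mulLeft k a ∘ₗ Q.S)
          (V.coact m) = V.act a (Q.alphaForm V.act R m) := by
        intro m
        rw [hR, actVia_evalOp]
        clear hY hR
        induction R using tensor_induction_two with
        | add s t hs ht => simp only [map_add, LinearMap.add_apply, hs, ht]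
        | tmul x y => simp [alphaForm_tmul]
      refine LinearMap.ext fun m => ?_
      simp only [lGammaAux, TensorProduct.lift.tmul, LinearMap.mk₂_apply, LinearMap.comp_apply, h2]
      have h3 := Q.drinfeldElt_mul hY (Q.Sinv b)
      rw [S_Sinv] at h3
      rw [← Q.S_alpha_mul_drinfeldElt hY, sandwichRight_tmul, map_mul, map_mul, mul_assoc, ← h3]
      rfl
  have h2 : ∀ s t : H ⊗[k] H, Q.S (sandwichRight Q.S (Q.S Q.alpha)
      (TensorProduct.map Q.Sinv Q.Sinv (TensorProduct.comm k H H s) * t)) =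
      sandwichLeft Q.S (Q.S (sandwichRight Q.S (Q.S Q.alpha) t)) s := by
    intro s t
    induction s using tensor_induction_two with
    | add s t hs ht => simp only [map_add, add_mul, hs, ht]
    | tmul a b =>
      induction t using tensor_induction_two with
      | add s t hs ht =>
        have h3 : ∀ x y : H, sandwichLeft Q.S (x + y) (a ⊗ₜ[k] b) =
            sandwichLeft Q.S x (a ⊗ₜ[k] b) + sandwichLeft Q.S y (a ⊗ₜ[k] b) := by
          simp [sandwichLeft_tmul, mul_add, add_mul]
        simp only [map_add, mul_add, hs, ht, h3]
      | tmul c d => simp [sandwichLeft_tmul, sandwichRight_tmul, Q.S_mul, S_Sinv, mul_assoc]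
  -- S is applied to undo the S⁻¹ in V. Contracting f⁻¹ gives ε(α)β, contracting f with that β gives
  -- ε(β)α, and p_R contributes S(p¹)αp² = 1; finally ε(α)ε(β) = 1.
  have h3 : sandwichRight Q.S (Q.S Q.alpha) (Q.V * Q.fInv) = 1 := by
    apply Q.antipode.injective
    have h4 := h2 (Q.f * Q.pR) Q.fInv
    have h5 : sandwichLeft Q.S (Q.S (Q.counit Q.alpha • Q.beta)) (Q.f * Q.pR) =
        Q.counit Q.alpha • sandwichLeft Q.S (Q.S Q.beta) (Q.f * Q.pR) := by
      induction Q.f * Q.pR using tensor_induction_two with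
      | add s t hs ht => simp only [map_add, smul_add, hs, ht]
      | tmul a b => simp [sandwichLeft_tmul]
    have h6 : sandwichLeft Q.S (Q.counit Q.beta • Q.alpha) Q.pR =
        Q.counit Q.beta • sandwichLeft Q.S Q.alpha Q.pR := by
      induction Q.pR using tensor_induction_two with
      | add s t hs ht => simp only [map_add, smul_add, hs, ht]
      | tmul a b => simp [sandwichLeft_tmul]
    rw [sandwichRight_fInv, h5, sandwichLeft_mul, sandwichLeft_f, h6, sandwichLeft_pR, smul_smul,
      counit_alpha_mul_counit_beta, one_smul] at h4
    rw [Q.antipode_one]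
    exact h4
  rw [lGammaFormula, h1, h3, map_one, one_mul]

end Formulas

section Formulas

variable {V} {R : H ⊗[k] Module.End k M} (hR : ∀ m, V.coact m = evalOp H m R)

include hR

/-- The coaction twisted by 𝓕 is given by uS²(R)v, so S⁻² restores R¹, and the S² on p¹ and q²
disappears when these elements pass v and u. The rest is `outerForm_Phi` followed by v. -/
theorem rGammaFormula_eq (hY : Q.IsYDElement V.act R) :
    V.rGammaFormula Q = Q.drinfeldInv V.act R := by
  have hc : ∀ m, V.twistCoact Q.calF m = evalOp H m ((1 ⊗ₜ Q.drinfeldElt V.act R) *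
      Q.mapSS _ R * (1 ⊗ₜ Q.drinfeldInv V.act R)) := by
    intro m
    rw [twistCoact, twistCoactAux, LinearMap.comp_apply, coactMul_eq hR, tensorAct_lmul_evalOp,
      ringInverse_calF, ← mul_assoc, calF_conj hY]
  have hv : ∀ h, Q.drinfeldInv V.act R * V.act (Q.S (Q.S h)) =
      V.act h * Q.drinfeldInv V.act R := by
    intro h
    rw [← drinfeldElt_conj hY, ← mul_assoc, ← mul_assoc, drinfeldInv_mul_drinfeldElt hY, one_mul]
  have hP : ∀ t m, V.rGammaP Q t m = evalOp H m ((1 ⊗ₜ Q.drinfeldElt V.act R) *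
      mulFlip V.act R t * (1 ⊗ₜ Q.drinfeldInv V.act R)) := by
    intro t m
    induction t using tensor_induction_two with
    | add s t hs ht =>
      simp only [map_add, LinearMap.add_apply, hs, ht, mulFlip, mul_add, add_mul]
    | tmul a b =>
      simp only [rGammaP, TensorProduct.lift.tmul, LinearMap.mk₂_apply, LinearMap.comp_apply, hc]
      have h1 : ∀ (X : H ⊗[k] Module.End k M) (y : Module.End k M), TensorProduct.map
          (LinearMap.mulRight k b ∘ₗ Q.Sinv ∘ₗ Q.Sinv) LinearMap.id
          (evalOp H (V.act (Q.S (Q.S a)) m) ((1 ⊗ₜ y) * Q.mapSS _ X *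
            (1 ⊗ₜ Q.drinfeldInv V.act R))) =
          evalOp H m ((1 ⊗ₜ y) * mulFlip V.act X (a ⊗ₜ b) * (1 ⊗ₜ Q.drinfeldInv V.act R)) := by
        intro X y
        induction X using tensor_induction_two with
        | add s t hs ht => simp only [map_add, mulFlip, mul_add, add_mul] at hs ht ⊢; rw [hs, ht]
        | tmul h x =>
          have h2 := LinearMap.congr_fun (hv a) m
          simp only [Module.End.mul_apply] at h2
          simp only [mapSS_tmul, mulFlip_tmul, Algebra.TensorProduct.tmul_mul_tmul, one_mul,
            mul_one,
            evalOp_tmul, TensorProduct.map_tmul, LinearMap.comp_apply, Sinv_S, LinearMap.id_apply,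
            LinearMap.mulRight_apply, Module.End.mul_apply, h2]
      exact h1 R _
  have hQ : ∀ (t : H ⊗[k] (H ⊗[k] H)) (X : H ⊗[k] Module.End k M) (m : M),
      V.rGammaQ Q (TensorProduct.map LinearMap.id Q.qRAux t) (evalOp H m
        ((1 ⊗ₜ Q.drinfeldElt V.act R) * X * (1 ⊗ₜ Q.drinfeldInv V.act R))) =
      (Q.outerForm V.act (Q.alphaForm V.act R) t X * Q.drinfeldInv V.act R) m := by
    intro t X m
    rw [← Q.S_alpha_mul_drinfeldElt hY]
    induction t using tensor_induction_three with
    | add s t hs ht => simp only [map_add, LinearMap.add_apply, add_mul, hs, ht]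
    | tmul a b c =>
      induction X using tensor_induction_two with
      | add s t hs ht => simp only [map_add, LinearMap.add_apply, mul_add, add_mul, hs, ht]
      | tmul h x =>
        rw [outerForm_tmul, TensorProduct.map_tmul, qRAux_tmul]
        simp only [rGammaQ, TensorProduct.lift.tmul, LinearMap.mk₂_apply, actVia,
          Algebra.TensorProduct.tmul_mul_tmul, one_mul, mul_one, evalOp_tmul, LinearMap.comp_apply,
          LinearMap.mulRight_apply, LinearMap.mulLeft_apply, AlgHom.toLinearMap_apply,
          LinearMap.id_apply]
        rw [mul_assoc (V.act (Q.S Q.alpha)), Q.drinfeldElt_mul hY, Q.S_mul, S_Sinv]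
        simp only [← Module.End.mul_apply, Q.S_mul, map_mul, mul_assoc]
  refine LinearMap.ext fun m => ?_
  rw [rGammaFormula, LinearMap.comp_apply, hP, qR, hQ, Q.outerForm_Phi hY, one_mul]

end Formulas

end YDData

/-! ### The map Θ for the left and the right dual. -/

namespace QuasiHopfAlgebra

variable {k H : Type*} [Field k] [Ring H] [Algebra k H] (Q : QuasiHopfAlgebra k H)
variable {E E' : Type*} [Ring E] [Algebra k E] [Ring E'] [Algebra k E']

/-- The map `a ⊗ b ⊗ c ↦ (h ⊗ x ↦ ρ(a h S(α c)) λ(b) x)`. -/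
def dualBraidingForm (ρ l : H →ₐ[k] E) : H ⊗[k] (H ⊗[k] H) →ₗ[k] H ⊗[k] E →ₗ[k] E :=
  TensorProduct.lift (LinearMap.mk₂ k (fun a t => LinearMap.mul' k E ∘ₗ
      TensorProduct.map (LinearMap.mulRight k (LinearMap.mul' k E (TensorProduct.map
        (ρ.toLinearMap ∘ₗ Q.S ∘ₗ LinearMap.mulLeft k Q.alpha) l.toLinearMap
          (TensorProduct.comm k H H t))) ∘ₗ ρ.toLinearMap ∘ₗ LinearMap.mulLeft k a) LinearMap.id)
    (by intros; ext; simp [add_mul])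
    (by intros; ext; simp)
    (by intros; ext; simp [mul_add, add_mul])
    (by intros; ext; simp))

theorem dualBraidingForm_tmul (ρ l : H →ₐ[k] E) (a b c h : H) (x : E) :
    Q.dualBraidingForm ρ l (a ⊗ₜ (b ⊗ₜ c)) (h ⊗ₜ x) =
      ρ (a * h) * (ρ (Q.S (Q.alpha * c)) * l b) * x := by
  simp [dualBraidingForm, mul_assoc]

theorem mulFlip_map (φ : E →ₐ[k] E') (l : H →ₐ[k] E) (X : H ⊗[k] E) (s : H ⊗[k] H) :
    mulFlip (φ.comp l) (Algebra.TensorProduct.map (AlgHom.id k H) φ X) s =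
      Algebra.TensorProduct.map (AlgHom.id k H) φ (mulFlip l X s) := by
  rw [mulFlip, mulFlip, map_mul]
  congr 1
  induction s using tensor_induction_two with
  | add s t hs ht => simp only [map_add, hs, ht]
  | tmul a b => simp

end QuasiHopfAlgebra

namespace YDData

open QuasiHopfAlgebra

variable {k H : Type*} [Field k] [Ring H] [Algebra k H] {Q : QuasiHopfAlgebra k H}
variable {M : Type*} [AddCommGroup M] [Module k M] [Module.Finite k M]
variable {V : YDData k H M}

/-- The inverse associator together with β from the coevaluation produces p_R. Summation over the
basis moves the operators on M to their transposes on the dual, which accounts for S(αX³). -/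
theorem Theta_apply {X : H ⊗[k] Module.End k (Module.Dual k M)}
    (hX : ∀ ψ, (V.leftDual Q).coact ψ = evalOp H ψ X) (ψ : Module.Dual k M) :
    V.Theta Q ψ = Q.dualBraidingForm (V.rightDual Q).act (V.leftDual Q).act Q.Phi
      (mulFlip (V.leftDual Q).act X Q.pR) ψ := by
  have key : ∀ t s : H ⊗[k] (H ⊗[k] H),
      (TensorProduct.rid k _) (TensorProduct.map LinearMap.id (V.ev Q)
        (tensorAct (V.rightDual Q).act (tensorAct (V.leftDual Q).act V.act) s
          (TensorProduct.assoc k _ _ _ (TensorProduct.map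
            (braiding (V.leftDual Q) (V.rightDual Q)) LinearMap.id
            ((TensorProduct.assoc k _ _ _).symm (tensorAct (V.leftDual Q).act
              (tensorAct (V.rightDual Q).act V.act) t (ψ ⊗ₜ V.coev' Q))))))) =
      Q.dualBraidingForm (V.rightDual Q).act (V.leftDual Q).act s
      (mulFlip (V.leftDual Q).act X
        (TensorProduct.map LinearMap.id (sandwichRight Q.S Q.beta) t)) ψ := by
    intro t s
    induction t using tensor_induction_three with
    | add r s hr hs =>
      simp only [map_add, LinearMap.add_apply, mulFlip, mul_add] at hr hs ⊢; rw [hr, hs]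
    | tmul x y z =>
      induction s using tensor_induction_three with
      | add r s hr hs => simp only [map_add, LinearMap.add_apply, hr, hs]
      | tmul a b c =>
        rw [coev', dualSum_apply]
        simp only [map_sum, TensorProduct.tmul_sum, TensorProduct.comm_tmul, tensorAct_tmul,
          TensorProduct.assoc_symm_tmul, TensorProduct.map_tmul, LinearMap.id_apply, braiding,
          TensorProduct.lift.tmul, LinearMap.comp_apply, hX, sandwichRight_tmul]
        clear hX
        induction X using tensor_induction_two with
        | add s t hs ht =>
          simp only [map_add, LinearMap.add_apply, TensorProduct.add_tmul, Finset.sum_add_distrib,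
            mulFlip, add_mul] at hs ht ⊢
          rw [hs, ht]
        | tmul h w =>
          simp only [evalOp_tmul, braidingAux, TensorProduct.lift.tmul, LinearMap.mk₂_apply,
            LinearMap.comp_apply, LinearMap.flip_apply, TensorProduct.mk_apply,
            TensorProduct.assoc_tmul, tensorAct_tmul, TensorProduct.map_tmul, LinearMap.id_apply,
            TensorProduct.rid_tmul, ev, contractLeft_apply, mulFlip_tmul]
          refine (sum_smul_coord ((((((V.leftDual Q).act b (w ((V.leftDual Q).act x ψ))) ∘ₗ
            V.act Q.alpha) ∘ₗ V.act c) ∘ₗ V.act z) ∘ₗ V.act (Q.Sinv Q.beta))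
            ((V.rightDual Q).act a * (V.rightDual Q).act h * (V.rightDual Q).act y)).trans ?_
          have h1 : ∀ d, (V.rightDual Q).act (Q.S d) = transp k M (V.act d) := by
            intro d; rw [rightDual_act, Sinv_S]
          rw [dualBraidingForm_tmul]
          simp only [map_mul, Q.S_mul, h1, Module.End.mul_apply]
          rw [rightDual_act Q Q.beta]
          rfl
  exact key Q.PhiInv Q.Phi

variable {R : H ⊗[k] Module.End k M} (hR : ∀ m, V.coact m = evalOp H m R)
  (hY : Q.IsYDElement V.act R)

include hR hY

/-- The double left dual contributes R conjugated by u, while the mixed double dual contributes only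
the canonical map. Cancelling vu between neighbouring factors leaves the expression of
`outerForm_Phi` times v. -/
theorem Theta_leftDual : (V.leftDual Q).Theta Q =
    conjHom (Module.evalEquiv k M).symm (Q.drinfeldInv V.act R) := by
  refine LinearMap.ext fun φ => ?_
  rw [Theta_apply (leftDual_leftDual_coact hR hY), leftDual_leftDual_act hY, mulFlip_map]
  have key : ∀ (t : H ⊗[k] (H ⊗[k] H)) (X : H ⊗[k] Module.End k M),
      Q.dualBraidingForm ((V.leftDual Q).rightDual Q).act ((conjHom (leftEquiv hY)).comp V.act) t
        (Algebra.TensorProduct.map (AlgHom.id k H) (conjHom (leftEquiv hY)) X) =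
      conjHom (Module.evalEquiv k M).symm
        (Q.outerForm V.act (Q.alphaForm V.act R) t X * Q.drinfeldInv V.act R) := by
    intro t X
    have huv : ∀ y, Q.drinfeldInv V.act R * (Q.drinfeldElt V.act R * y) = y := by
      intro y; rw [← mul_assoc, drinfeldInv_mul_drinfeldElt hY, one_mul]
    rw [← Q.S_alpha_mul_drinfeldElt hY]
    induction t using tensor_induction_three with
    | add s t hs ht => simp only [map_add, LinearMap.add_apply, add_mul, hs, ht]
    | tmul a b c =>
      induction X using tensor_induction_two with
      | add s t hs ht => simp only [map_add, add_mul, hs, ht]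
      | tmul h x =>
        rw [outerForm_tmul, Algebra.TensorProduct.map_tmul, dualBraidingForm_tmul,
          rightDual_leftDual_act]
        simp only [AlgHom.comp_apply, conjHom_leftEquiv, AlgHom.id_apply, ← map_mul (conjHom _),
          Q.S_mul, map_mul V.act, mul_assoc, huv]
  rw [key, Q.outerForm_Phi hY, one_mul]

omit hY in
-- Now the braiding uses the mixed double dual, with R itself, and the other action carries S⁻².
-- This reproduces v term by term.
theorem Theta_rightDual : (V.rightDual Q).Theta Q =
    conjHom (Module.evalEquiv k M).symm (Q.drinfeldInv V.act R) := by
  refine LinearMap.ext fun φ => ?_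
  rw [Theta_apply (leftDual_rightDual_coact hR), leftDual_rightDual_act, mulFlip_map]
  have key : ∀ (t : H ⊗[k] (H ⊗[k] H)) (X : H ⊗[k] Module.End k M),
      Q.dualBraidingForm ((V.rightDual Q).rightDual Q).act
        ((conjHom (Module.evalEquiv k M).symm).comp V.act) t
        (Algebra.TensorProduct.map (AlgHom.id k H) (conjHom (Module.evalEquiv k M).symm) X) =
      conjHom (Module.evalEquiv k M).symm
        (Q.drinfeldInvForm V.act (TensorProduct.map LinearMap.id Q.qRAux t) X) := by
    intro t X
    induction t using tensor_induction_three with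
    | add s t hs ht => simp only [map_add, LinearMap.add_apply, hs, ht]
    | tmul a b c =>
      induction X using tensor_induction_two with
      | add s t hs ht => simp only [map_add, hs, ht]
      | tmul h x =>
        rw [Algebra.TensorProduct.map_tmul, dualBraidingForm_tmul, TensorProduct.map_tmul,
          drinfeldInvForm_tmul, qRAux_tmul]
        simp only [AlgHom.comp_apply, rightDual_act, transp_transp, AlgHom.id_apply,
          LinearMap.id_apply, ← map_mul (conjHom _), Sinv_S]
        simp only [map_mul V.act, mul_assoc]
  rw [key]
  rfl

end YDData

/-! ### The map Θ⁻¹ is a Drinfeld element of the right dual. -/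

namespace YDData

open QuasiHopfAlgebra

variable {k H : Type*} [Field k] [Ring H] [Algebra k H] {Q : QuasiHopfAlgebra k H}
variable {M : Type*} [AddCommGroup M] [Module k M] [Module.Finite k M]
variable {V : YDData k H M}

/-- The word in `inverseBraidingForm_word`, with the reassociators replaced by arbitrary tensors. -/
def inverseBraidingWord {E : Type*} [Ring E] [Algebra k E] (π : H →ₐ[k] E) (X : H ⊗[k] E)
    (x : H ⊗[k] (H ⊗[k] H)) (y : H ⊗[k] (H ⊗[k] (H ⊗[k] H))) (s z t : H ⊗[k] (H ⊗[k] H)) :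
    (H ⊗[k] (H ⊗[k] H)) ⊗[k] (H ⊗[k] E) :=
  pairHom (wordLeg₁ k H E) (pairHom ((wordLeg₅ k H E).comp π) (wordLeg₄ k H E)) x *
    (quadHom (wordLeg₂ k H E) (wordLeg₃ k H E) ((wordLeg₅ k H E).comp π) (wordLeg₄ k H E) y *
    (pairHom (wordLeg₃ k H E) (pairHom ((wordLeg₅ k H E).comp π) (wordLeg₄ k H E)) s *
    (pairHom (wordLeg₃ k H E) (wordLeg₅ k H E) X *
    (pairHom ((wordLeg₅ k H E).comp π) (pairHom (wordLeg₃ k H E) (wordLeg₄ k H E)) z *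
      pairHom (wordLeg₁ k H E) (pairHom (wordLeg₂ k H E) ((wordLeg₅ k H E).comp π)) t))))

theorem inverseBraidingForm_inverseBraidingWord {E : Type*} [Ring E] [Algebra k E]
    {π : H →ₐ[k] E} {X : H ⊗[k] E} (hX : Q.IsYDElement π X) :
    Q.inverseBraidingForm π (inverseBraidingWord π X Q.PhiInv
      (Algebra.TensorProduct.map (AlgHom.id k H)
        (Algebra.TensorProduct.map (AlgHom.id k H) Q.comul) Q.PhiInv) Q.Phi Q.PhiInv Q.Phi) =
      Q.drinfeldElt π X := by
  rw [← inverseBraidingForm_word hX, inverseBraidingWord, quadHom, pairHom_map]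
  have h : (pairHom (wordLeg₃ k H E) (pairHom ((wordLeg₅ k H E).comp π) (wordLeg₄ k H E))).comp
      (Algebra.TensorProduct.map (AlgHom.id k H) Q.comul) =
      pairHom (wordLeg₃ k H E) (Q.conv ((wordLeg₅ k H E).comp π) (wordLeg₄ k H E)) := by
    refine AlgHom.ext fun t => ?_
    rw [AlgHom.comp_apply, pairHom_map]; rfl
  simp only [h]
  rfl

/-- Summing over the coevaluation of M and its dual basis turns all operators into one operator on
the right dual, in which S of the whole coefficient appears. -/
theorem ThetaInv_apply_aux (x₁ x₂ x₃ t₁ t₂ : H) (κ : H ⊗[k] Module.Dual k M) :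
    ∑ i : Fin (Module.finrank k M), TensorProduct.lid k _ (TensorProduct.map (V.ev' Q) LinearMap.id
      ((TensorProduct.assoc k _ _ _).symm
        (V.act x₁ (V.act t₁ (V.act Q.beta (Module.finBasis k M i))) ⊗ₜ
          tensorAct (V.rightDual Q).act (V.leftDual Q).act (x₂ ⊗ₜ x₃)
            (braidingInvAux Q _ (V.leftDual Q) κ
              ((V.leftDual Q).act t₂ ((Module.finBasis k M).coord i)))))) =
    (V.rightDual Q).actVia (LinearMap.mulRight k (Q.alpha * x₂) ∘ₗ Q.S ∘ₗ
      LinearMap.mulRight k (Q.S x₃) ∘ₗ LinearMap.mulLeft k (x₁ * t₁ * Q.beta * Q.S t₂)) κ := by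
  induction κ using tensor_induction_two with
  | add s t hs ht =>
    simp only [map_add, LinearMap.add_apply, TensorProduct.tmul_add, Finset.sum_add_distrib, hs, ht]
  | tmul h χ =>
    simp only [braidingInvAux, TensorProduct.lift.tmul, LinearMap.mk₂_apply, LinearMap.comp_apply,
      TensorProduct.mk_apply, tensorAct_tmul, TensorProduct.assoc_symm_tmul, TensorProduct.map_tmul,
      ev', contractRight_apply, LinearMap.id_apply, TensorProduct.lid_tmul]
    refine (sum_smul_coord (((((V.rightDual Q).act x₂ χ) ∘ₗ V.act (Q.Sinv Q.alpha)) ∘ₗ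
      V.act x₁) ∘ₗ V.act t₁ ∘ₗ V.act Q.beta)
      ((V.leftDual Q).act x₃ * (V.leftDual Q).act (Q.Sinv h) * (V.leftDual Q).act t₂)).trans ?_
    simp only [actVia, TensorProduct.lift.tmul, LinearMap.comp_apply, LinearMap.mulRight_apply,
      LinearMap.mulLeft_apply, AlgHom.toLinearMap_apply]
    ext m
    simp only [Module.End.mul_apply, leftDual_act, rightDual_act, map_mul, Sinv_S,
      S_Sinv, Module.Dual.transpose_apply, LinearMap.comp_apply, mul_assoc]

theorem map_comul_qL : Algebra.TensorProduct.map (AlgHom.id k H) Q.comul Q.qL =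
    TensorProduct.map (sandwichLeft Q.S Q.alpha) LinearMap.id ((TensorProduct.assoc k H H _).symm
      (Algebra.TensorProduct.map (AlgHom.id k H)
        (Algebra.TensorProduct.map (AlgHom.id k H) Q.comul) Q.PhiInv)) := by
  have h : ∀ t : H ⊗[k] (H ⊗[k] H), Algebra.TensorProduct.map (AlgHom.id k H) Q.comul
      (TensorProduct.map (sandwichLeft Q.S Q.alpha) LinearMap.id
        ((TensorProduct.assoc k H H H).symm t)) =
      TensorProduct.map (sandwichLeft Q.S Q.alpha) LinearMap.id ((TensorProduct.assoc k H H _).symm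
      (Algebra.TensorProduct.map (AlgHom.id k H)
        (Algebra.TensorProduct.map (AlgHom.id k H) Q.comul) t)) := by
    intro t
    induction t using tensor_induction_three with
    | add s t hs ht => simp only [map_add, hs, ht]
    | tmul x y z => simp
  exact h _

set_option maxHeartbeats 1000000 in
theorem ThetaInv_eq {X : H ⊗[k] Module.End k (Module.Dual k M)}
    (hX : ∀ ψ, (V.rightDual Q).coact ψ = evalOp H ψ X)
    (hX' : Q.IsYDElement (V.rightDual Q).act X) :
    V.ThetaInv Q = Q.drinfeldElt (V.rightDual Q).act X := by
  refine LinearMap.ext fun χ => ?_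
  -- The five reassociators of the composite are made independent tensors, so that multilinearity
  -- reduces to pure ones. The fourfold tensor y is Φ⁻¹ with Δ in its last slot; it comes from the
  -- coproduct of q̃² in the formula for c⁻¹.
  have key : ∀ (x : H ⊗[k] (H ⊗[k] H)) (y : H ⊗[k] (H ⊗[k] (H ⊗[k] H)))
      (s z t : H ⊗[k] (H ⊗[k] H)),
      TensorProduct.lid k _ (TensorProduct.map (V.ev' Q) LinearMap.id
      ((TensorProduct.assoc k _ _ _).symm (tensorAct V.act (tensorAct (V.rightDual Q).act
        (V.leftDual Q).act) x (TensorProduct.map LinearMap.id (TensorProduct.lift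
          (braidingInvAux Q _ (V.leftDual Q) ∘ₗ (V.rightDual Q).braidingInvMul Q
            ((TensorProduct.assoc k H H H).symm (TensorProduct.map (sandwichLeft Q.S Q.alpha)
              LinearMap.id ((TensorProduct.assoc k H H _).symm y) * s)) ∘ₗ
            (V.rightDual Q).coactMul
              (TensorProduct.map LinearMap.id (sandwichRight Q.S Q.beta) z)).flip)
          (tensorAct V.act (tensorAct (V.leftDual Q).act (V.rightDual Q).act) t
            (TensorProduct.assoc k _ _ _ (V.coev Q ⊗ₜ χ))))))) =
      Q.inverseBraidingForm (V.rightDual Q).act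
        (inverseBraidingWord (V.rightDual Q).act X x y s z t) χ := by
    intro x y s z t
    induction x using tensor_induction_three with
    | add r s hr hs =>
      simp only [inverseBraidingWord, map_add, LinearMap.add_apply, add_mul] at hr hs ⊢; rw [hr, hs]
    | tmul x₁ x₂ x₃ =>
    induction t using tensor_induction_three with
    | add r s hr hs =>
      simp only [inverseBraidingWord, map_add, LinearMap.add_apply, mul_add] at hr hs ⊢; rw [hr, hs]
    | tmul t₁ t₂ t₃ =>
    rw [coev, dualSum_apply]
    simp only [map_sum, TensorProduct.sum_tmul, TensorProduct.assoc_tmul, tensorAct_tmul,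
      TensorProduct.map_tmul, LinearMap.id_apply, TensorProduct.lift.tmul, LinearMap.flip_apply,
      LinearMap.comp_apply]
    rw [ThetaInv_apply_aux, coactMul_eq hX]
    clear hX hX'
    induction y using tensor_induction_four with
    | add r s hr hs =>
      simp only [inverseBraidingWord, map_add, LinearMap.add_apply, mul_add, add_mul] at hr hs ⊢
      rw [hr, hs]
    | tmul y₁ y₂ y₃ y₄ =>
    induction s using tensor_induction_three with
    | add r s hr hs =>
      simp only [inverseBraidingWord, map_add, LinearMap.add_apply, mul_add, add_mul] at hr hs ⊢
      rw [hr, hs]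
    | tmul s₁ s₂ s₃ =>
    induction z using tensor_induction_three with
    | add r s hr hs =>
      simp only [inverseBraidingWord, map_add, mul_add, add_mul, LinearMap.add_apply] at hr hs ⊢
      rw [hr, hs]
    | tmul z₁ z₂ z₃ =>
    induction X using tensor_induction_two with
    | add r s hr hs =>
      simp only [inverseBraidingWord, map_add, mul_add, add_mul, LinearMap.add_apply] at hr hs ⊢
      rw [hr, hs]
    | tmul h w =>
    simp only [inverseBraidingWord, quadHom_tmul, pairHom_tmul, AlgHom.comp_apply,
      Algebra.TensorProduct.includeLeft_apply, Algebra.TensorProduct.includeRight_apply,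
      Algebra.TensorProduct.tmul_mul_tmul, mul_one, one_mul, TensorProduct.map_tmul,
      TensorProduct.assoc_symm_tmul, sandwichLeft_tmul, sandwichRight_tmul, evalOp_tmul,
      braidingInvMul, TensorProduct.lift.tmul, LinearMap.mk₂_apply, LinearMap.comp_apply,
      tensorAct_tmul, LinearMap.id_apply, actVia, LinearMap.mulRight_apply,
      LinearMap.mulLeft_apply, AlgHom.toLinearMap_apply, inverseBraidingForm_tmul, betaAlpha_tmul]
    have hl : ∀ a b, Algebra.lmul k H a b = a * b := fun _ _ => rfl
    simp only [hl, map_mul (V.rightDual Q).act, Q.S_mul, Module.End.mul_apply, mul_assoc]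
  have h := key Q.PhiInv (Algebra.TensorProduct.map (AlgHom.id k H)
        (Algebra.TensorProduct.map (AlgHom.id k H) Q.comul) Q.PhiInv) Q.Phi Q.PhiInv Q.Phi
  rw [inverseBraidingForm_inverseBraidingWord hX', ← map_comul_qL] at h
  exact h

end YDData

/-! ### Θ⁻¹ on the duals of M, and the conclusion. -/

namespace YDData

open QuasiHopfAlgebra

variable {k H : Type*} [Field k] [Ring H] [Algebra k H] {Q : QuasiHopfAlgebra k H}
variable {M : Type*} [AddCommGroup M] [Module k M] [Module.Finite k M]
variable {V : YDData k H M} {R : H ⊗[k] Module.End k M}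
  (hR : ∀ m, V.coact m = evalOp H m R) (hY : Q.IsYDElement V.act R)

include hR hY

theorem ThetaInv_leftDual : (V.leftDual Q).ThetaInv Q =
    conjHom (Module.evalEquiv k M).symm (Q.drinfeldElt V.act R) := by
  rw [ThetaInv_eq (rightDual_leftDual_coact hR) (by rw [rightDual_leftDual_act]; exact hY.map _),
    rightDual_leftDual_act, drinfeldElt_map]

/-- The double right dual is transported along the Drinfeld element, whose conjugation fixes the
Drinfeld element itself. -/
theorem ThetaInv_rightDual : (V.rightDual Q).ThetaInv Q =
    conjHom (Module.evalEquiv k M).symm (Q.drinfeldElt V.act R) := by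
  rw [ThetaInv_eq (rightDual_rightDual_coact hR hY)
    (by rw [rightDual_rightDual_act hY]; exact hY.map _),
    rightDual_rightDual_act hY, drinfeldElt_map, conjHom_rightEquiv,
    drinfeldInv_mul_drinfeldElt hY, one_mul]

omit hR in
theorem areInverse_conjHom_drinfeld :
    AreInverse (conjHom (Module.evalEquiv k M).symm (Q.drinfeldInv V.act R))
      (conjHom (Module.evalEquiv k M).symm (Q.drinfeldElt V.act R)) := by
  constructor <;>
  · rw [← Module.End.mul_eq_comp, ← map_mul]
    simp only [Q.drinfeldElt_mul_drinfeldInv hY, drinfeldInv_mul_drinfeldElt hY, map_one]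
    rfl

end YDData

theorem proposition4 {k : Type*} {H : Type*} {M : Type*} [Field k] [Ring H] [Algebra k H]
    [AddCommGroup M] [Module k M] [Module.Finite k M]
    (Q : QuasiHopfAlgebra k H) (V : YDData k H M)
    (hV : V.IsYetterDrinfeld Q.toQuasiBialgebra)
    {ι : Type*} [Fintype ι] (b : Module.Basis ι k M) :
    (AreInverse (V.theta' Q) (V.thetaInv' Q) ∧
      AreInverse ((V.leftDual Q).Theta Q) ((V.leftDual Q).ThetaInv Q) ∧
      ∃ e : Module.Dual k (Module.Dual k M) ≃ₗ[k] M,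
        e.toLinearMap = V.rGamma Q ∧
        YDData.IsYDIso Q.toQuasiBialgebra ((V.leftDual Q).leftDual Q) V e ∧
        (∀ x, e x = ∑ i, x (b.coord i) • V.rGammaFormula Q (b i)) ∧
        e.symm.toLinearMap = (V.leftDual Q).ThetaInv Q ∘ₗ V.theta' Q ∧
        (∀ m, e.symm m =
          ∑ i, b.coord i (V.rGammaInvFormula Q m) • Module.Dual.eval k M (b i))) ∧
    (AreInverse (V.theta Q) (V.thetaInv Q) ∧
      AreInverse ((V.rightDual Q).Theta Q) ((V.rightDual Q).ThetaInv Q) ∧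
      ∃ e : Module.Dual k (Module.Dual k M) ≃ₗ[k] M,
        e.toLinearMap = V.lGamma Q ∧
        YDData.IsYDIso Q.toQuasiBialgebra ((V.rightDual Q).rightDual Q) V e ∧
        (∀ x, e x = ∑ i, x (b.coord i) • V.lGammaFormula Q (b i)) ∧
        (∀ m, e.symm m =
          ∑ i, b.coord i (V.lGammaInvFormula Q m) • Module.Dual.eval k M (b i))) := by
  obtain ⟨R, hR⟩ := exists_evalOp_eq V.coact
  have hY := YDData.isYDElement_of_isYetterDrinfeld Q hR hV
  -- Every x is evaluation at a vector m, and the sum is T applied to the expansion of m in the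
  -- basis.
  have hsum : ∀ (T : Module.End k M) (x : Module.Dual k (Module.Dual k M)),
      ∑ i, x (b.coord i) • T (b i) = T ((Module.evalEquiv k M).symm x) := by
    intro T x
    obtain ⟨m, rfl⟩ := (Module.evalEquiv k M).surjective x
    rw [LinearEquiv.symm_apply_apply]
    conv_rhs => rw [← b.sum_repr m, map_sum]
    simp only [map_smul]
    rfl
  have hsum' : ∀ m : M, Module.Dual.eval k M m =
      ∑ i, b.coord i m • Module.Dual.eval k M (b i) := by
    intro m
    conv_lhs => rw [← b.sum_repr m, map_sum]
    simp only [map_smul]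
    rfl
  -- The two isomorphisms are the inverse of the canonical map followed by v for the double left
  -- dual and by u for the double right dual.
  refine ⟨⟨YDData.areInverse_theta' Q V, ?_, YDData.leftEquiv hY, ?_, ?_, ?_, ?_, ?_⟩,
    YDData.areInverse_theta Q V, ?_, YDData.rightEquiv hY, ?_, ?_, ?_, ?_⟩
  · rw [YDData.Theta_leftDual hR hY, YDData.ThetaInv_leftDual hR hY]
    exact YDData.areInverse_conjHom_drinfeld hY
  · rw [YDData.rGamma, YDData.Theta_leftDual hR hY, YDData.thetaInv'_eq]
    refine LinearMap.ext fun x => ?_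
    exact ((Module.evalEquiv k M).symm_apply_apply _).symm
  · exact YDData.isYDIso_of_conjHom Q hV hR _ (YDData.leftDual_leftDual_act hY)
      (YDData.leftDual_leftDual_coact hR hY)
  · intro x
    rw [YDData.rGammaFormula_eq Q hR hY, hsum]
    rfl
  · rw [YDData.ThetaInv_leftDual hR hY, YDData.theta'_eq]
    refine LinearMap.ext fun m => ?_
    rw [LinearMap.comp_apply, YDData.conjHom_eval]
    rfl
  · intro m
    rw [YDData.rGammaInvFormula_eq Q hR, ← hsum']
    rfl
  · rw [YDData.Theta_rightDual hR, YDData.ThetaInv_rightDual hR hY]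
    exact YDData.areInverse_conjHom_drinfeld hY
  · rw [YDData.lGamma, YDData.ThetaInv_rightDual hR hY, YDData.thetaInv_eq]
    refine LinearMap.ext fun x => ?_
    exact ((Module.evalEquiv k M).symm_apply_apply _).symm
  · exact YDData.isYDIso_of_conjHom Q hV hR _ (YDData.rightDual_rightDual_act hY)
      (YDData.rightDual_rightDual_coact hR hY)
  · intro x
    rw [YDData.lGammaFormula_eq Q hR hY, hsum]
    rfl
  · intro m
    rw [YDData.lGammaInvFormula_eq Q hR, ← hsum']
    rfl

end
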